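/- **Setting.** Let $k\ge 1$, let $D\subset\mathbb R^k$ be a bounded domain (open, connected, non-empty), and let $0<\alpha<1$, $0<\beta\le 1$, $T>0$, $J=(0,T)$. Let $\mathcal L v=-\sum_i\partial_i\big(\sum_j \mathcal L_{ij}\partial_j v\big)+b\,v$ with $\mathcal L_{ij}=\mathcal L_{ji}\in C^1(\overline D)$, $b\in C(\overline D)$, $b\ge 0$ and $\sum_{i,j}\mathcal L_{ij}(x)\xi_i\xi_j\ge L_0|\xi|^2$ for some $L_0>0$ and all $x\in\overline D$, $\xi\in\mathbb R^k$. Let the boundary operator be $\mathcal Hv=v$ or $\mathcal Hv=\partial v/\partial n+\kappa v$ with a constant $\kappa>0$. Let $0<m_1\le m_2\le\dots\to\infty$ and let $(e_j)_{j\ge1}$ be an orthonormal basis of $L^2(D)$ with $e_j\in\{v\in H^2(D):\mathcal Hv=0\}$ and $\mathcal L e_j=m_je_j$. Write $\|\cdot\|$ and $(\cdot,\cdot)$ for the norm and inner product of $L^2(D)$. For $\gamma\ge 0$ let ${\bf V}_\gamma=\{v\in L^2(D):\sum_j m_j^{2\gamma}(v,e_j)^2<\infty\}$ with norm $\|v\|_{{\bf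 V}_\gamma}=\|\mathcal L^\gamma v\|$, where $\mathcal L^\gamma v=\sum_j m_j^\gamma(v,e_j)e_j$, and let ${\bf V}_{-\gamma}=({\bf V}_\gamma)'$ with its dual norm; $L^2(D)\subset{\bf V}_{-\gamma}$ by identifying $v$ with $w\mapsto(v,w)$. For $0<\eta<1$ let $\mathcal X_{2,\eta}$ be the set of measurable $f:J\to L^2(D)$ with $$|||f|||_{\mathcal X_{2,\eta}}:=\operatorname*{ess\,sup}_{0\le t\le T}\int_0^t\|f(\tau)\|(t-\tau)^{\eta-1}\,d\tau<\infty .$$ For a Banach space $X$, $C^{\rho}((0,T];X)$ is the set of continuous $v:(0,T]\to X$ with $\|v\|_{C^\rho((0,T];X)}:=\sup_{0<t\le T}t^\rho\|v(t)\|_X<\infty$, and $C^{\theta}([0,T];X)$ is the set of continuous $v:[0,T]\to X$ with $|||v|||_{C^\theta([0,T];X)}:=\sup_{0\le t_1<t_2\le T}\|v(t_2)-v(t_1)\|_X/|t_2-t_1|^\theta<\infty$. Let $E_{a,b}(z)=\sum_{n\ge0}z^n/\Gamma(an+b)$, $\varphi_j=(\varphi,e_j)$, $F_j(t)=(F(t),e_j)$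 and $G_j(t)=\int_0^tF_j(\tau)(t-\tau)^{\alpha-1}E_{\alpha,\alpha}(-m_j^\beta(t-\tau)^\alpha)\,d\tau$. A *mild solution* of the final value problem $${}^cD_t^\alpha u=-\mathcal L^\beta u+F(t,x)\ \text{ in } J\times D,\qquad \mathcal Hu=0\ \text{ on } J\times\partial D,\qquad u(T)=\varphi$$ is a function $u\in L^{\varrho}(0,T;L^2(D))$, for some $\varrho\ge1$, such that for almost every $t\in(0,T)$ $$u(t)=\sum_{j}G_j(t)\,e_j+\sum_j\varphi_j\frac{E_{\alpha,1}(-m_j^\beta t^\alpha)}{E_{\alpha,1}(-m_j^\beta T^\alpha)}\,e_j-\sum_jG_j(T)\frac{E_{\alpha,1}(-m_j^\beta t^\alpha)}{E_{\alpha,1}(-m_j^\beta T^\alpha)}\,e_j ,\tag{$*$}$$ each series converging in $L^2(D)$. **Theorem.** Let $0<p,q<1$ with $p+q=1$. (a) Let $0<r\le\frac{1-\alpha q}{\alpha q}$. There is a constant $C_1>0$ such that for all $\varphi\in{\bf V}_{\beta p}$ and $F\in\mathcal X_{2,\alpha q}$ the problem has a mild solution $u\in L^{\frac1{\alpha q}-r}(0,T;L^2(D))$,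 which satisfies $(*)$ for every $t\in(0,T]$; every mild solution agrees with $u$ almost everywhere on $(0,T)$; and $$\|u\|_{L^{\frac1{\alpha q}-r}(0,T;L^2(D))}\le C_1\|\varphi\|_{{\bf V}_{\beta p}}+C_1|||F|||_{\mathcal X_{2,\alpha q}} .$$ (b) Let $0<s<\min(\alpha q,1-\alpha q)$, $0<p'\le p-\frac s\alpha$, $q'=1-p'$ and $0<r\le\frac{1-\alpha q'}{\alpha q'}$. There is a constant $C_2>0$ such that for all $\varphi\in{\bf V}_{\beta p}$ and $F\in\mathcal X_{2,\alpha q-s}$ the problem has a mild solution $$u\in L^{\frac1{\alpha q'}-r}(0,T;{\bf V}_{\beta(p-p')})\cap C^{\alpha q}((0,T];L^2(D))\cap C^s([0,T];{\bf V}_{-\beta q'}),$$ which satisfies $(*)$ in $L^2(D)$ for every $t\in(0,T]$ and in ${\bf V}_{-\beta q'}$ for every $t\in[0,T]$ (membership in the last space is meant with the value $u(0)\in{\bf V}_{-\beta q'}$ given by $(*)$); every mild solution agrees with $u$ almost everywhere on $(0,T)$; and $$\|u\|_{L^{\frac1{\alpha q'}-r}(0,T;{\bf V}_{\beta(p-p')})}+\|u\|_{C^{\alpha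 q}((0,T];L^2(D))}+|||u|||_{C^s([0,T];{\bf V}_{-\beta q'})}\le C_2\|\varphi\|_{{\bf V}_{\beta p}}+C_2|||F|||_{\mathcal X_{2,\alpha q-s}} .$$ -/

import Mathlib

open MeasureTheory Filter Set
open scoped Topology ENNReal ContDiff InnerProductSpace

noncomputable section

namespace TerminalValue

/-- The real Hilbert space `L²(D)`, for `D ⊆ ℝᵏ` with Lebesgue measure. -/
abbrev L2 {k : ℕ} (D : Set (EuclideanSpace ℝ (Fin k))) : Type :=
  Lp ℝ 2 (volume.restrict D)

/-! ### Weak derivatives, Sobolev classes and boundary values -/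

/-- The partial derivative `∂ψ/∂xᵢ`. -/
def partialD {k : ℕ} (i : Fin k) (ψ : EuclideanSpace ℝ (Fin k) → ℝ)
    (x : EuclideanSpace ℝ (Fin k)) : ℝ :=
  fderiv ℝ ψ x (EuclideanSpace.single i 1)

/-- Test functions: smooth with compact support inside `D`. -/
def IsTestFunction {k : ℕ} (D : Set (EuclideanSpace ℝ (Fin k)))
    (ψ : EuclideanSpace ℝ (Fin k) → ℝ) : Prop :=
  ContDiff ℝ ∞ ψ ∧ HasCompactSupport ψ ∧ tsupport ψ ⊆ D

/-- `g ∈ L²(D)` is the weak partial derivative `∂f/∂xᵢ` of `f ∈ L²(D)`. -/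
def HasWeakPartial {k : ℕ} (D : Set (EuclideanSpace ℝ (Fin k))) (i : Fin k)
    (f g : L2 D) : Prop :=
  ∀ ψ, IsTestFunction D ψ →
    ∫ x in D, f x * partialD i ψ x = -∫ x in D, g x * ψ x

/-- `v ∈ H²(D)`. -/
def MemH2 {k : ℕ} (D : Set (EuclideanSpace ℝ (Fin k))) (v : L2 D) : Prop :=
  ∃ (g : Fin k → L2 D) (h : Fin k → Fin k → L2 D),
    (∀ i, HasWeakPartial D i v (g i)) ∧ ∀ i j, HasWeakPartial D j (g i) (h i j)

/-- The functions `ψ n` converge to `v` in `H¹(D)`. -/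
def TendstoH1 {k : ℕ} (D : Set (EuclideanSpace ℝ (Fin k)))
    (ψ : ℕ → EuclideanSpace ℝ (Fin k) → ℝ) (v : L2 D) : Prop :=
  Tendsto (fun n => eLpNorm (fun x => v x - ψ n x) 2 (volume.restrict D)) atTop (𝓝 0) ∧
  ∃ g : Fin k → L2 D, (∀ i, HasWeakPartial D i v (g i)) ∧
    ∀ i, Tendsto (fun n => eLpNorm (fun x => g i x - partialD i (ψ n) x) 2
      (volume.restrict D)) atTop (𝓝 0)

/-- `v ∈ H¹₀(D)`: the closure of the test functions in `H¹(D)`. -/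
def MemH10 {k : ℕ} (D : Set (EuclideanSpace ℝ (Fin k))) (v : L2 D) : Prop :=
  ∃ ψ : ℕ → EuclideanSpace ℝ (Fin k) → ℝ,
    (∀ n, IsTestFunction D (ψ n)) ∧ TendstoH1 D ψ v

/-- The surface measure on `∂D`: the `(k-1)`-dimensional Hausdorff measure. -/
def surfaceMeasure {k : ℕ} (D : Set (EuclideanSpace ℝ (Fin k))) :
    Measure (EuclideanSpace ℝ (Fin k)) :=
  (Measure.hausdorffMeasure ((k : ℝ) - 1)).restrict (frontier D)

/-- `g` is the boundary trace of `v ∈ H¹(D)`: some `C¹` functions converge to `v` in `H¹(D)` and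
their boundary values converge to `g` in `L²(∂D)`. -/
def HasTrace {k : ℕ} (D : Set (EuclideanSpace ℝ (Fin k))) (v : L2 D)
    (g : EuclideanSpace ℝ (Fin k) → ℝ) : Prop :=
  ∃ ψ : ℕ → EuclideanSpace ℝ (Fin k) → ℝ,
    (∀ n, ContDiff ℝ 1 (ψ n)) ∧ TendstoH1 D ψ v ∧
    Tendsto (fun n => eLpNorm (fun x => g x - ψ n x) 2 (surfaceMeasure D)) atTop (𝓝 0)

/-- `ν` is the outer unit normal of `D` at `x`, in the measure-theoretic (Federer) sense, which
agrees with the classical one at every boundary point near which `∂D` is `C¹`: near `x`, up to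
relative volume tending to `0`, the set `D` is the half space `⟪y - x, ν⟫ < 0`. -/
def IsOuterNormal {k : ℕ} (D : Set (EuclideanSpace ℝ (Fin k)))
    (x ν : EuclideanSpace ℝ (Fin k)) : Prop :=
  ‖ν‖ = 1 ∧
  Tendsto (fun r : ℝ => volume (Metric.ball x r ∩ {y | y ∈ D ∧ 0 < ⟪y - x, ν⟫_ℝ})
    / volume (Metric.ball x r)) (𝓝[>] 0) (𝓝 0) ∧
  Tendsto (fun r : ℝ => volume (Metric.ball x r ∩ {y | y ∉ D ∧ ⟪y - x, ν⟫_ℝ < 0})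
    / volume (Metric.ball x r)) (𝓝[>] 0) (𝓝 0)

/-- The two boundary operators: `ℋ v = v`, and `ℋ v = ∂v/∂n + κ v` with `κ > 0`. -/
inductive BoundaryOperator : Type
  | dirichlet : BoundaryOperator
  | robin (κ : ℝ) (hκ : 0 < κ) : BoundaryOperator

/-- `ℋ v = 0` on `∂D`, for `v ∈ H²(D)`. -/
def BoundaryOperator.Vanishes {k : ℕ} (D : Set (EuclideanSpace ℝ (Fin k))) (v : L2 D) :
    BoundaryOperator → Prop
  | .dirichlet => MemH10 D v
  | .robin κ _ => ∃ (g : EuclideanSpace ℝ (Fin k) → ℝ) (G : Fin k → L2 D)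
      (h : Fin k → EuclideanSpace ℝ (Fin k) → ℝ),
      HasTrace D v g ∧ (∀ i, HasWeakPartial D i v (G i)) ∧ (∀ i, HasTrace D (G i) (h i)) ∧
      ∀ᵐ x ∂(surfaceMeasure D), ∃ ν, IsOuterNormal D x ν ∧ ∑ i, ν i * h i x + κ * g x = 0

/-! ### The elliptic operator and its eigenfunctions -/

/-- `f ∈ C¹(closure D)`: continuous up to the boundary together with its derivative. -/
def IsC1UpToBoundary {k : ℕ} (D : Set (EuclideanSpace ℝ (Fin k)))
    (f : EuclideanSpace ℝ (Fin k) → ℝ) : Prop :=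
  ContinuousOn f (closure D) ∧
  ∃ f' : EuclideanSpace ℝ (Fin k) → (EuclideanSpace ℝ (Fin k) →L[ℝ] ℝ),
    ContinuousOn f' (closure D) ∧ ∀ x ∈ D, HasFDerivAt f (f' x) x

/-- Coefficients of a symmetric uniformly elliptic operator
`ℒ v = - ∑ᵢ ∂ᵢ (∑ⱼ Aᵢⱼ ∂ⱼ v) + b v` on `D`. -/
structure EllipticOperator {k : ℕ} (D : Set (EuclideanSpace ℝ (Fin k))) where
  A : Fin k → Fin k → EuclideanSpace ℝ (Fin k) → ℝ
  b : EuclideanSpace ℝ (Fin k) → ℝ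
  A_C1 : ∀ i j, IsC1UpToBoundary D (A i j)
  A_symm : ∀ i j, ∀ x ∈ closure D, A i j x = A j i x
  A_elliptic : ∃ L₀ : ℝ, 0 < L₀ ∧ ∀ x ∈ closure D, ∀ ξ : EuclideanSpace ℝ (Fin k),
    L₀ * ‖ξ‖ ^ 2 ≤ ∑ i, ∑ j, A i j x * ξ i * ξ j
  b_cont : ContinuousOn b (closure D)
  b_nonneg : ∀ x ∈ closure D, 0 ≤ b x

/-- `ℒ v = w`, with the derivatives taken in the weak sense. -/
def EllipticOperator.Maps {k : ℕ} {D : Set (EuclideanSpace ℝ (Fin k))}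
    (L : EllipticOperator D) (v w : L2 D) : Prop :=
  ∃ g σ d : Fin k → L2 D,
    (∀ j, HasWeakPartial D j v (g j)) ∧
    (∀ i, σ i =ᵐ[volume.restrict D] fun x => ∑ j, L.A i j x * g j x) ∧
    (∀ i, HasWeakPartial D i (σ i) (d i)) ∧
    w =ᵐ[volume.restrict D] fun x => -∑ i, d i x + L.b x * v x

/-- The spectrum `0 < m₁ ≤ m₂ ≤ … → ∞` of `ℒ` with boundary condition `ℋ v = 0`, and a
corresponding orthonormal basis of `L²(D)` of eigenfunctions in `{v ∈ H²(D) : ℋ v = 0}`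
(numbered from `0`). -/
structure Eigensystem {k : ℕ} {D : Set (EuclideanSpace ℝ (Fin k))} (L : EllipticOperator D)
    (B : BoundaryOperator) where
  m : ℕ → ℝ
  e : HilbertBasis ℕ ℝ (L2 D)
  m_zero_pos : 0 < m 0
  m_mono : Monotone m
  m_tendsto : Tendsto m atTop atTop
  e_memH2 : ∀ j, MemH2 D (e j)
  e_boundary : ∀ j, B.Vanishes D (e j)
  e_eigen : ∀ j, L.Maps (e j) (m j • e j)

namespace Eigensystem

variable {k : ℕ} {D : Set (EuclideanSpace ℝ (Fin k))} {L : EllipticOperator D}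
  {B : BoundaryOperator} (S : Eigensystem L B)

theorem m_pos (j : ℕ) : 0 < S.m j :=
  S.m_zero_pos.trans_le (S.m_mono (Nat.zero_le j))

/-! ### The spaces `V_γ` and their duals -/

/-- The domain of `ℒ^γ` in `L²(D)`: those `v` with `∑ⱼ (m_j^γ (v, e_j))² < ⊤`. -/
def powDomain (γ : ℝ) : Submodule ℝ (L2 D) where
  carrier := {v | Memℓp (fun j => S.m j ^ γ * ⟪S.e j, v⟫_ℝ) 2}
  zero_mem' := by
    have h : (fun j => S.m j ^ γ * ⟪S.e j, (0 : L2 D)⟫_ℝ) = (0 : ℕ → ℝ) := by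
      ext j; simp
    change Memℓp (fun j => S.m j ^ γ * ⟪S.e j, (0 : L2 D)⟫_ℝ) 2
    rw [h]
    exact zero_memℓp
  add_mem' := by
    intro v w hv hw
    have h : (fun j => S.m j ^ γ * ⟪S.e j, v + w⟫_ℝ)
        = (fun j => S.m j ^ γ * ⟪S.e j, v⟫_ℝ) + fun j => S.m j ^ γ * ⟪S.e j, w⟫_ℝ := by
      ext j; simp [inner_add_right, mul_add]
    change Memℓp (fun j => S.m j ^ γ * ⟪S.e j, v + w⟫_ℝ) 2
    rw [h]
    exact Memℓp.add hv hw
  smul_mem' := by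
    intro c v hv
    have h : (fun j => S.m j ^ γ * ⟪S.e j, c • v⟫_ℝ)
        = c • fun j => S.m j ^ γ * ⟪S.e j, v⟫_ℝ := by
      ext j; simp [inner_smul_right]; ring
    change Memℓp (fun j => S.m j ^ γ * ⟪S.e j, c • v⟫_ℝ) 2
    rw [h]
    exact Memℓp.const_smul hv c

/-- The space `V_γ`, the domain of `ℒ^γ` (used for `γ ≥ 0`), with the norm `‖ℒ^γ v‖`. -/
def V (γ : ℝ) : Type := S.powDomain γ

instance (γ : ℝ) : AddCommGroup (S.V γ) := inferInstanceAs (AddCommGroup (S.powDomain γ))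

instance (γ : ℝ) : Module ℝ (S.V γ) := inferInstanceAs (Module ℝ (S.powDomain γ))

/-- The inclusion of `V_γ` in `L²(D)`. -/
def toL2 (γ : ℝ) : S.V γ →ₗ[ℝ] L2 D := (S.powDomain γ).subtype

/-- The fractional power `ℒ^γ v = ∑ⱼ m_j^γ (v, e_j) e_j` on its domain. -/
def pow (γ : ℝ) : S.V γ →ₗ[ℝ] L2 D where
  toFun v := S.e.repr.symm ⟨fun j => S.m j ^ γ * ⟪S.e j, S.toL2 γ v⟫_ℝ, v.2⟩
  map_add' v w := by
    rw [← map_add]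
    congr 1
    ext j
    simp [inner_add_right, mul_add]
    rfl
  map_smul' c v := by
    rw [RingHom.id_apply, ← map_smul]
    congr 1
    ext j
    simp [inner_smul_right]
    ring

theorem inner_pow (γ : ℝ) (v : S.V γ) (j : ℕ) :
    ⟪S.e j, S.pow γ v⟫_ℝ = S.m j ^ γ * ⟪S.e j, S.toL2 γ v⟫_ℝ := by
  rw [← S.e.repr_apply_apply]
  simp [pow]

theorem pow_injective (γ : ℝ) : Function.Injective (S.pow γ) := by
  intro v w h
  have h2 : S.toL2 γ v = S.toL2 γ w := by
    apply S.e.repr.injective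
    ext j
    have h3 := S.inner_pow γ v j
    rw [h, S.inner_pow γ w j] at h3
    have h4 := mul_left_cancel₀ (Real.rpow_pos_of_pos (S.m_pos j) γ).ne' h3
    rw [S.e.repr_apply_apply, S.e.repr_apply_apply, h4]
  exact Subtype.ext h2

instance (γ : ℝ) : NormedAddCommGroup (S.V γ) :=
  NormedAddCommGroup.induced (S.V γ) (L2 D) (S.pow γ) (S.pow_injective γ)

instance (γ : ℝ) : NormedSpace ℝ (S.V γ) :=
  NormedSpace.induced ℝ (S.V γ) (L2 D) (S.pow γ)

theorem norm_V (γ : ℝ) (v : S.V γ) : ‖v‖ = ‖S.pow γ v‖ := rfl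

/-- The space `V_{-γ}`, the dual of `V_γ` (used for `γ ≥ 0`). Its dual norm is
`(∑ⱼ (x, e_j)² m_j^{-2γ})^{1/2}`. -/
abbrev VNeg (γ : ℝ) : Type := StrongDual ℝ (S.V γ)

/-- The functional `x ∈ V_{-γ}` is the function `v ∈ L²(D)`, under `L²(D) ⊆ V_{-γ}`. -/
def IsFunction {γ : ℝ} (x : S.VNeg γ) (v : L2 D) : Prop :=
  ∀ w : S.V γ, x w = ⟪v, S.toL2 γ w⟫_ℝ

/-- The eigenfunction `e_j` as an element of `V_{-γ}`, that is the functional `w ↦ (e_j, w)`. -/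
def eNeg (γ : ℝ) (j : ℕ) : S.VNeg γ :=
  LinearMap.mkContinuous ((innerₛₗ ℝ (S.e j)).comp (S.toL2 γ)) ((S.m j ^ γ)⁻¹) (by
    intro v
    have hm := Real.rpow_pos_of_pos (S.m_pos j) γ
    have h1 := S.inner_pow γ v j
    have h2 := abs_real_inner_le_norm (S.e j) (S.pow γ v)
    rw [S.e.orthonormal.1 j, one_mul, h1, abs_mul, abs_of_pos hm] at h2
    rw [S.norm_V, inv_mul_eq_div, le_div_iff₀ hm, mul_comm]
    exact h2)

theorem isFunction_eNeg (γ : ℝ) (j : ℕ) : S.IsFunction (S.eNeg γ j) (S.e j) := fun _ => rfl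

end Eigensystem

/-! ### Function spaces in time -/

/-- The norm `ess sup_{0 ≤ t ≤ T} ∫₀ᵗ ‖f(τ)‖ (t - τ)^{η-1} dτ` of `𝒳_{2,η}(J × D)`. -/
def normX {H : Type*} [NormedAddCommGroup H] (T η : ℝ) (f : ℝ → H) : ℝ≥0∞ :=
  essSup (fun t => ∫⁻ τ in Ioo 0 t, ‖f τ‖ₑ * ENNReal.ofReal ((t - τ) ^ (η - 1)))
    (volume.restrict (Icc 0 T))

/-- `f ∈ 𝒳_{2,η}(J × D)`, `J = (0,T)`, when `H = L²(D)`. -/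
def MemX {H : Type*} [NormedAddCommGroup H] (T η : ℝ) (f : ℝ → H) : Prop :=
  AEStronglyMeasurable f (volume.restrict (Ioo 0 T)) ∧ normX T η f < ⊤

/-- The norm `sup_{0 < t ≤ T} t^ρ ‖v(t)‖` of `C^ρ((0,T];H)`. -/
def normCWeighted {H : Type*} [NormedAddCommGroup H] (T ρ : ℝ) (v : ℝ → H) : ℝ≥0∞ :=
  ⨆ t ∈ Ioc 0 T, ENNReal.ofReal (t ^ ρ) * ‖v t‖ₑ

/-- `v ∈ C^ρ((0,T];H)`. -/
def MemCWeighted {H : Type*} [NormedAddCommGroup H] (T ρ : ℝ) (v : ℝ → H) : Prop :=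
  ContinuousOn v (Ioc 0 T) ∧ normCWeighted T ρ v < ⊤

/-- The Hölder norm `sup_{0 ≤ t₁ < t₂ ≤ T} ‖v(t₂) - v(t₁)‖ / (t₂ - t₁)^θ` of `C^θ([0,T];H)`. -/
def normHolder {H : Type*} [NormedAddCommGroup H] (T θ : ℝ) (v : ℝ → H) : ℝ≥0∞ :=
  ⨆ (t₁ : ℝ) (t₂ : ℝ) (_ : 0 ≤ t₁) (_ : t₁ < t₂) (_ : t₂ ≤ T),
    ‖v t₂ - v t₁‖ₑ / ENNReal.ofReal ((t₂ - t₁) ^ θ)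

/-- `v ∈ C^θ([0,T];H)`. -/
def MemHolder {H : Type*} [NormedAddCommGroup H] (T θ : ℝ) (v : ℝ → H) : Prop :=
  ContinuousOn v (Icc 0 T) ∧ normHolder T θ v < ⊤

/-! ### Mild solutions -/

/-- The Mittag-Leffler function `E_{a,b}(z) = ∑_{n ≥ 0} zⁿ / Γ(a n + b)` on the real line. -/
def mittagLeffler (a b z : ℝ) : ℝ := ∑' n : ℕ, z ^ n / Real.Gamma (a * n + b)

namespace Eigensystem

variable {k : ℕ} {D : Set (EuclideanSpace ℝ (Fin k))} {L : EllipticOperator D}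
  {B : BoundaryOperator} (S : Eigensystem L B)

/-- `F_j(t) ⋆ [t^{α-1} E_{α,α}(-m_j^β t^α)]`, where `F_j(τ) = (F(τ), e_j)`. -/
def conv (α β : ℝ) (F : ℝ → L2 D) (j : ℕ) (t : ℝ) : ℝ :=
  ∫ τ in (0 : ℝ)..t, ⟪F τ, S.e j⟫_ℝ *
    ((t - τ) ^ (α - 1) * mittagLeffler α α (-(S.m j ^ β * (t - τ) ^ α)))

/-- `E_{α,1}(-m_j^β t^α) / E_{α,1}(-m_j^β T^α)`. -/
def ratio (α β T : ℝ) (j : ℕ) (t : ℝ) : ℝ :=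
  mittagLeffler α 1 (-(S.m j ^ β * t ^ α)) / mittagLeffler α 1 (-(S.m j ^ β * T ^ α))

/-- `y = 𝒪₁(t) F + 𝒪₂(t) φ + 𝒪₃(t) F`, where `𝒪₃(t) = -𝒪₂(t) 𝒪₁(T)` and the three series converge
in the space `Y`, in which the eigenfunction `e_j` is the vector `ε j`. -/
def SpectralFormula {Y : Type*} [NormedAddCommGroup Y] [NormedSpace ℝ Y] (ε : ℕ → Y)
    (α β T : ℝ) (φ : L2 D) (F : ℝ → L2 D) (t : ℝ) (y : Y) : Prop :=
  ∃ y₁ y₂ y₃ : Y,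
    HasSum (fun j => S.conv α β F j t • ε j) y₁ ∧
    HasSum (fun j => (⟪φ, S.e j⟫_ℝ * S.ratio α β T j t) • ε j) y₂ ∧
    HasSum (fun j => (-(S.conv α β F j T * S.ratio α β T j t)) • ε j) y₃ ∧
    y = y₁ + y₂ + y₃

/-- `u` is a mild solution of `ᶜD_t^α u = -ℒ^β u + F`, `ℋ u = 0`, `u(T) = φ`: it belongs to
`L^ϱ(0,T;L²(D))` for some `ϱ ≥ 1` and satisfies the spectral formula. -/
def IsMildSolution (α β T : ℝ) (φ : L2 D) (F u : ℝ → L2 D) : Prop :=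
  (∃ ϱ : ℝ≥0∞, 1 ≤ ϱ ∧ MemLp u ϱ (volume.restrict (Ioo 0 T))) ∧
  ∀ᵐ t ∂(volume.restrict (Ioo 0 T)), S.SpectralFormula S.e α β T φ F t (u t)

end Eigensystem

end TerminalValue

end

open TerminalValue

noncomputable section

namespace TerminalValue

/-! ### Power series with Gamma function denominators -/

/-! The problem is diagonal in the eigenbasis. It therefore reduces to scalar estimates, uniform in
l = m_j^β, for the relaxation function E(t) = E_{α,1}(-l t^α) (`mlE`) and the kernel g(t) = t^{α-1}
E_{α,α}(-l t^α) (`mlG`), combined with a Minkowski inequality for square summable coefficients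
(`l2Bdd_integral`).

Scalar part. E and g are series in t^α with Gamma denominators, and Laplace convolution of such
series is the Cauchy product of their coefficients (`integral_gammaKernel_mul`). Writing I^b for the
fractional integral, this gives E = I^{1-α} g, E + l I^α E = 1, E + l ∫ g = 1, g + l I^α g =
t^{α-1}/Γ(α) and t g = α (E ⋆ g). The last identity, together with E = I^{1-α} g, forces g > 0
(`mlG_pos`), so complete monotonicity and contour integrals are not needed. Positivity turns the
identities into inequalities: E decreases from 1 and is comparable to 1/(1 + l t^α), while g ≤
t^{α-1}/Γ(α) and l t g ≤ α. Interpolation gives l^θ g ≤ C t^{α(1-θ)-1} (`rpow_mul_mlG_le`) and E(t)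
≤ C l^{-κ} t^{-ακ}. Since 1/E(T) ≤ C l, the quotient E(t)/E(T) is at most C l^{1-κ} t^{-ακ}
(`relaxRatio_le`): the final value costs powers of l, and fewer powers cost a stronger singularity
at t = 0.

Function spaces. With κ = q the cost l^p is paid by φ ∈ V_{βp}. The vector with coefficients G_j(T)
lies in the same space, because l^p g is bounded by a multiple of t^{αq-1}, the weight defining
𝒳_{2,αq}. Hence ‖u(t)‖ ≤ C t^{-αq}, which gives the L^ρ bound of (a) and the weighted bound of (b).
Keeping p - p' powers of l in reserve gives values in V_{β(p-p')} with singularity t^{-αq'}. In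
V_{-βq'} the weight l^{p'-1} absorbs the factor l of 1/E(T), so the formula makes sense at t = 0; a
Hölder exponent s costs l^{s/α} more, which p' + s/α ≤ p allows. Uniqueness holds because the
formula determines u(t). -/

/-- The series `∑ cₙ zⁿ / Γ(α n + b)`. -/
def gammaSeries (α : ℝ) (c : ℕ → ℝ) (b z : ℝ) : ℝ := ∑' n : ℕ, c n * z ^ n / Real.Gamma (α * n + b)

/-- Log-convexity of Γ at x + 1 = α (x + α) + (1 - α) (x + α + 1), followed by the functional
equation at both x + 1 and x + α + 1. -/
theorem Gamma_add_ge {α x : ℝ} (hα : 0 < α) (hα1 : α < 1) (hx : 0 < x) :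
    Real.Gamma x * (x / (x + α) ^ (1 - α)) ≤ Real.Gamma (x + α) := by
  have h := Real.Gamma_mul_add_mul_le_rpow_Gamma_mul_rpow_Gamma (s := x + α) (t := x + α + 1)
    (a := α) (b := 1 - α) (by linarith) (by linarith) hα (by linarith) (by ring)
  have e1 : α * (x + α) + (1 - α) * (x + α + 1) = x + 1 := by ring
  have hG : 0 < Real.Gamma (x + α) := Real.Gamma_pos_of_pos (by linarith)
  rw [e1, Real.Gamma_add_one hx.ne', Real.Gamma_add_one (s := x + α) (by linarith),
    Real.mul_rpow (by linarith) hG.le] at h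
  have e2 : Real.Gamma (x + α) ^ α * ((x + α) ^ (1 - α) * Real.Gamma (x + α) ^ (1 - α))
      = (x + α) ^ (1 - α) * Real.Gamma (x + α) := by
    rw [mul_left_comm, ← Real.rpow_add hG]; simp
  rw [e2] at h
  have hp : 0 < (x + α) ^ (1 - α) := Real.rpow_pos_of_pos (by linarith) _
  rw [← mul_div_assoc, div_le_iff₀ hp]
  linarith

/-- Ratio test. With y = α n + b, `Gamma_add_ge` bounds the ratio of consecutive terms by 2 |x|
y^{-α} as soon as y ≥ α, so that y + α ≤ 2y. -/
theorem summable_pow_div_Gamma {α b : ℝ} (hα : 0 < α) (hα1 : α < 1) (hb : 0 < b) (x : ℝ) :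
    Summable fun n : ℕ => x ^ n / Real.Gamma (α * n + b) := by
  rcases eq_or_ne x 0 with rfl | hx
  · exact summable_of_ne_finset_zero (s := {0}) (by
      intro n hn; simp at hn; simp [hn])
  have hpos : ∀ n : ℕ, 0 < α * n + b := fun n => by positivity
  have hGp : ∀ n : ℕ, 0 < Real.Gamma (α * n + b) := fun n => Real.Gamma_pos_of_pos (hpos n)
  have hlim : Tendsto (fun n : ℕ => α * (n : ℝ) + b) atTop atTop :=
    tendsto_atTop_add_const_right _ _ (tendsto_natCast_atTop_atTop.const_mul_atTop hα)
  refine summable_of_ratio_test_tendsto_lt_one (l := 0) zero_lt_one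
    (Eventually.of_forall fun n => div_ne_zero (pow_ne_zero _ hx) (hGp n).ne') ?_
  have hb1 : Tendsto (fun n : ℕ => |x| * (2 * (α * (n : ℝ) + b) ^ (-α))) atTop (𝓝 0) := by
    have := ((tendsto_rpow_neg_atTop hα).comp hlim).const_mul 2 |>.const_mul |x|
    simpa using this
  refine squeeze_zero' (Eventually.of_forall fun n => by positivity) ?_ hb1
  filter_upwards [hlim.eventually_ge_atTop α] with n hn
  set y := α * (n : ℝ) + b with hy
  have hy0 : 0 < y := hpos n
  have e1 : α * ((n + 1 : ℕ) : ℝ) + b = y + α := by rw [hy]; push_cast; ring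
  rw [e1, norm_div, norm_div, norm_pow, norm_pow, Real.norm_eq_abs, Real.norm_eq_abs,
    Real.norm_eq_abs, abs_of_pos (hGp n),
    abs_of_pos (Real.Gamma_pos_of_pos (by linarith : 0 < y + α)), ← hy]
  have hG := hGp n
  have hG' : 0 < Real.Gamma (y + α) := Real.Gamma_pos_of_pos (by linarith)
  have h1 := Gamma_add_ge hα hα1 hy0
  have hx0 : 0 < |x| := abs_pos.2 hx
  have e3 : |x| ^ (n + 1) / Real.Gamma (y + α) / (|x| ^ n / Real.Gamma y)
      = |x| * (Real.Gamma y / Real.Gamma (y + α)) := by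
    field_simp
    ring
  rw [e3]
  refine mul_le_mul_of_nonneg_left ?_ hx0.le
  rw [div_le_iff₀ hG']
  have h2 : (y + α) ^ (1 - α) ≤ 2 * y ^ (1 - α) := by
    calc (y + α) ^ (1 - α) ≤ (2 * y) ^ (1 - α) :=
          Real.rpow_le_rpow (by linarith) (by linarith) (by linarith)
      _ = 2 ^ (1 - α) * y ^ (1 - α) := Real.mul_rpow (by norm_num) hy0.le
      _ ≤ 2 * y ^ (1 - α) := by
          gcongr
          calc (2 : ℝ) ^ (1 - α) ≤ 2 ^ (1 : ℝ) :=
                Real.rpow_le_rpow_of_exponent_le (by norm_num) (by linarith)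
            _ = 2 := by simp
  have h3 : 1 ≤ 2 * y ^ (-α) * (y / (y + α) ^ (1 - α)) := by
    rw [← mul_div_assoc, le_div_iff₀ (Real.rpow_pos_of_pos (by linarith) _), one_mul]
    calc (y + α) ^ (1 - α) ≤ 2 * y ^ (1 - α) := h2
      _ = 2 * y ^ (-α) * y := by
        rw [mul_assoc, ← Real.rpow_add_one hy0.ne']; ring_nf
  have hq : 0 ≤ 2 * y ^ (-α) := by positivity
  calc Real.Gamma y ≤ Real.Gamma y * (2 * y ^ (-α) * (y / (y + α) ^ (1 - α))) :=
        le_mul_of_one_le_right hG.le h3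
    _ = 2 * y ^ (-α) * (Real.Gamma y * (y / (y + α) ^ (1 - α))) := by ring
    _ ≤ _ := mul_le_mul_of_nonneg_left h1 hq

section Series

variable {α : ℝ} {c : ℕ → ℝ} {R b : ℝ}

theorem abs_gammaSeries_term_le (hα : 0 < α) (hb : 0 < b) (hc : ∀ n, |c n| ≤ R ^ n)
    {z r : ℝ} (hz : |z| ≤ r) (n : ℕ) :
    |c n * z ^ n / Real.Gamma (α * n + b)| ≤ (R * r) ^ n / Real.Gamma (α * n + b) := by
  have hG : 0 < Real.Gamma (α * n + b) := Real.Gamma_pos_of_pos (by positivity)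
  rw [abs_div, abs_of_pos hG, abs_mul, abs_pow, mul_pow]
  have := hc n
  have h0 : 0 ≤ R ^ n := (abs_nonneg _).trans this
  gcongr

theorem summable_gammaSeries (hα : 0 < α) (hα1 : α < 1) (hb : 0 < b) (hc : ∀ n, |c n| ≤ R ^ n)
    (z : ℝ) : Summable fun n : ℕ => c n * z ^ n / Real.Gamma (α * n + b) :=
  Summable.of_norm_bounded (summable_pow_div_Gamma hα hα1 hb (R * |z|))
    fun n => abs_gammaSeries_term_le hα hb hc le_rfl n

theorem continuous_gammaSeries (hα : 0 < α) (hα1 : α < 1) (hb : 0 < b)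
    (hc : ∀ n, |c n| ≤ R ^ n) : Continuous (gammaSeries α c b) := by
  rw [continuous_iff_continuousAt]
  intro z
  have h : ContinuousOn (gammaSeries α c b) (Metric.ball 0 (|z| + 1)) := by
    refine continuousOn_tsum (fun n => by fun_prop)
      (summable_pow_div_Gamma hα hα1 hb (R * (|z| + 1))) ?_
    intro n x hx
    refine abs_gammaSeries_term_le hα hb hc ?_ n
    simpa using (mem_ball_zero_iff.1 hx).le
  exact h.continuousAt (Metric.isOpen_ball.mem_nhds (by simp))

end Series

/-! ### Beta integrals and Laplace convolution of the kernels. -/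

theorem intervalIntegrable_beta {a b t : ℝ} (ha : 0 < a) (hb : 0 < b) (ht : 0 < t) :
    IntervalIntegrable (fun τ : ℝ => τ ^ (a - 1) * (t - τ) ^ (b - 1)) volume 0 t := by
  -- On the left half only the endpoint 0 is singular; the reflection τ ↦ t - τ, with a and b
  -- exchanged, handles the right half.
  have key : ∀ {a b : ℝ}, 0 < a → 0 < b →
      IntervalIntegrable (fun τ : ℝ => τ ^ (a - 1) * (t - τ) ^ (b - 1)) volume 0 (t / 2) := by
    intro a b ha hb
    refine (intervalIntegral.intervalIntegrable_rpow' (by linarith)).mul_continuousOn ?_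
    intro x hx
    rw [uIcc_of_le (by linarith)] at hx
    refine ContinuousAt.continuousWithinAt ?_
    refine ContinuousAt.rpow_const (by fun_prop) (Or.inl ?_)
    have := hx.2
    linarith
  refine (key ha hb).trans ?_
  have h := ((key hb ha).comp_sub_left t).symm
  have e : t - t / 2 = t / 2 := by ring
  rw [sub_zero, e] at h
  refine h.congr ?_
  intro x hx
  change (t - x) ^ (b - 1) * (t - (t - x)) ^ (a - 1) = x ^ (a - 1) * (t - x) ^ (b - 1)
  rw [sub_sub_cancel, mul_comm]

theorem integral_beta {a b t : ℝ} (ha : 0 < a) (hb : 0 < b) (ht : 0 < t) :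
    ∫ τ in (0 : ℝ)..t, τ ^ (a - 1) * (t - τ) ^ (b - 1)
      = t ^ (a + b - 1) * (Real.Gamma a * Real.Gamma b / Real.Gamma (a + b)) := by
  have h := Complex.betaIntegral_scaled a b ht
  rw [Complex.betaIntegral_eq_Gamma_mul_div _ _ (by simpa using ha) (by simpa using hb)] at h
  have h2 : ∫ x in (0 : ℝ)..t, (x : ℂ) ^ ((a : ℂ) - 1) * ((t : ℂ) - x) ^ ((b : ℂ) - 1)
      = ((∫ τ in (0 : ℝ)..t, τ ^ (a - 1) * (t - τ) ^ (b - 1) : ℝ) : ℂ) := by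
    rw [← intervalIntegral.integral_ofReal]
    refine intervalIntegral.integral_congr fun x hx => ?_
    rw [uIcc_of_le ht.le] at hx
    push_cast
    rw [Complex.ofReal_cpow hx.1, Complex.ofReal_cpow (by linarith [hx.2])]
    push_cast
    rfl
  rw [h2] at h
  have h3 : ((t : ℂ) ^ ((a : ℂ) + b - 1)) = ((t ^ (a + b - 1) : ℝ) : ℂ) := by
    rw [Complex.ofReal_cpow ht.le]; push_cast; rfl
  rw [h3, ← Complex.ofReal_add, Complex.Gamma_ofReal, Complex.Gamma_ofReal,
    Complex.Gamma_ofReal] at h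
  exact_mod_cast h

section Convolution

variable {α : ℝ} {c c' d : ℕ → ℝ} {R a b : ℝ}

/-- The function `t^{b-1} ∑ cₙ (t^α)ⁿ / Γ(α n + b)`. -/
def gammaKernel (α : ℝ) (c : ℕ → ℝ) (b t : ℝ) : ℝ := t ^ (b - 1) * gammaSeries α c b (t ^ α)

theorem continuous_gammaSeries_rpow (hα : 0 < α) (hα1 : α < 1) (hb : 0 < b)
    (hc : ∀ n, |c n| ≤ R ^ n) : Continuous fun t : ℝ => gammaSeries α c b (t ^ α) :=
  (continuous_gammaSeries hα hα1 hb hc).comp (Real.continuous_rpow_const hα.le)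

theorem intervalIntegrable_gammaKernel (hα : 0 < α) (hα1 : α < 1) (hb : 0 < b)
    (hc : ∀ n, |c n| ≤ R ^ n) (s t : ℝ) : IntervalIntegrable (gammaKernel α c b) volume s t :=
  (intervalIntegral.intervalIntegrable_rpow' (by linarith)).mul_continuousOn
    (continuous_gammaSeries_rpow hα hα1 hb hc).continuousOn

theorem intervalIntegrable_gammaKernel_mul (hα : 0 < α) (hα1 : α < 1) (ha : 0 < a) (hb : 0 < b)
    (hc : ∀ n, |c n| ≤ R ^ n) (hc' : ∀ n, |c' n| ≤ R ^ n) {t : ℝ} (ht : 0 < t) :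
    IntervalIntegrable (fun τ => gammaKernel α c a τ * gammaKernel α c' b (t - τ)) volume 0 t := by
  have h := (intervalIntegrable_beta ha hb ht).mul_continuousOn
    (g := fun τ => gammaSeries α c a (τ ^ α) * gammaSeries α c' b ((t - τ) ^ α))
    (((continuous_gammaSeries_rpow hα hα1 ha hc).mul
      ((continuous_gammaSeries_rpow hα hα1 hb hc').comp
        (by fun_prop : Continuous fun τ : ℝ => t - τ))).continuousOn)
  refine h.congr fun x _ => ?_
  simp only [gammaKernel]
  ring

/-- The terms of the single series at 2x are bounded, and the factor 2^{-(i+j)} that this leaves is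
a product of two geometric sequences. -/
theorem summable_prod_pow_div_Gamma (hα : 0 < α) (hα1 : α < 1) (hb : 0 < b) {x : ℝ}
    (hx : 0 ≤ x) :
    Summable fun i : ℕ × ℕ => x ^ (i.1 + i.2) / Real.Gamma (α * ((i.1 + i.2 : ℕ) : ℝ) + b) := by
  have h0 := (summable_pow_div_Gamma hα hα1 hb (2 * x)).tendsto_atTop_zero
  obtain ⟨K, hK⟩ := h0.bddAbove_range
  have hg : Summable fun i : ℕ × ℕ => K * ((1 / 2 : ℝ) ^ i.1 * (1 / 2) ^ i.2) :=
    (Summable.mul_of_nonneg summable_geometric_two summable_geometric_two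
      (fun _ => by positivity) (fun _ => by positivity)).mul_left K
  refine Summable.of_nonneg_of_le (fun i => ?_) (fun i => ?_) hg
  · have : 0 < Real.Gamma (α * ((i.1 + i.2 : ℕ) : ℝ) + b) :=
      Real.Gamma_pos_of_pos (by positivity)
    positivity
  · have h1 : (2 * x) ^ (i.1 + i.2) / Real.Gamma (α * ((i.1 + i.2 : ℕ) : ℝ) + b) ≤ K :=
      hK ⟨i.1 + i.2, rfl⟩
    have h2 : x ^ (i.1 + i.2) / Real.Gamma (α * ((i.1 + i.2 : ℕ) : ℝ) + b)
        = (2 * x) ^ (i.1 + i.2) / Real.Gamma (α * ((i.1 + i.2 : ℕ) : ℝ) + b)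
          * ((1 / 2 : ℝ) ^ i.1 * (1 / 2) ^ i.2) := by
      rw [← pow_add, div_mul_eq_mul_div, ← mul_pow]
      congr 2
      ring
    rw [h2]
    exact mul_le_mul_of_nonneg_right h1 (by positivity)

/-- The Laplace convolution of two kernels is the kernel of the Cauchy product. -/
theorem integral_gammaKernel_mul (hα : 0 < α) (hα1 : α < 1) (ha : 0 < a) (hb : 0 < b)
    (hR : 0 ≤ R) (hc : ∀ n, |c n| ≤ R ^ n) (hc' : ∀ n, |c' n| ≤ R ^ n)
    (hd : ∀ n, ∑ i ∈ Finset.HasAntidiagonal.antidiagonal n, c i.1 * c' i.2 = d n) {t : ℝ} (ht : 0 < t) :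
    ∫ τ in (0 : ℝ)..t, gammaKernel α c a τ * gammaKernel α c' b (t - τ)
      = gammaKernel α d (a + b) t := by
  have hGa : ∀ n : ℕ, 0 < Real.Gamma (α * n + a) := fun n => Real.Gamma_pos_of_pos (by positivity)
  have hGb : ∀ n : ℕ, 0 < Real.Gamma (α * n + b) := fun n => Real.Gamma_pos_of_pos (by positivity)
  have hGab : ∀ n : ℕ, 0 < Real.Gamma (α * n + (a + b)) :=
    fun n => Real.Gamma_pos_of_pos (by positivity)
  let f : ℕ × ℕ → ℝ → ℝ := fun i τ =>
    (c i.1 * c' i.2 / (Real.Gamma (α * i.1 + a) * Real.Gamma (α * i.2 + b)))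
      * (τ ^ (α * i.1 + a - 1) * (t - τ) ^ (α * i.2 + b - 1))
  have hβ : ∀ i : ℕ × ℕ, ∫ τ in (0 : ℝ)..t, τ ^ (α * i.1 + a - 1) * (t - τ) ^ (α * i.2 + b - 1)
      = t ^ (a + b - 1) * ((t ^ α) ^ (i.1 + i.2) * (Real.Gamma (α * i.1 + a)
        * Real.Gamma (α * i.2 + b) / Real.Gamma (α * ((i.1 + i.2 : ℕ) : ℝ) + (a + b)))) := by
    intro i
    rw [integral_beta (by positivity) (by positivity) ht]
    have e1 : α * i.1 + a + (α * i.2 + b) = α * ((i.1 + i.2 : ℕ) : ℝ) + (a + b) := by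
      push_cast; ring
    rw [e1, ← mul_assoc, ← Real.rpow_mul_natCast ht.le, ← Real.rpow_add ht]
    congr 2
    ring
  have hint : ∀ i, IntervalIntegrable (f i) volume 0 t := fun i =>
    (intervalIntegrable_beta (by positivity) (by positivity) ht).const_mul _
  have hnorm : ∀ i, ∫ τ in Ioc 0 t, ‖f i τ‖ = t ^ (a + b - 1) * (|c i.1| * |c' i.2|
      * (t ^ α) ^ (i.1 + i.2) / Real.Gamma (α * ((i.1 + i.2 : ℕ) : ℝ) + (a + b))) := by
    intro i
    have h1 : ∫ τ in Ioc 0 t, ‖f i τ‖ = ∫ τ in Ioc 0 t,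
        (|c i.1| * |c' i.2| / (Real.Gamma (α * i.1 + a) * Real.Gamma (α * i.2 + b)))
        * (τ ^ (α * i.1 + a - 1) * (t - τ) ^ (α * i.2 + b - 1)) := by
      refine setIntegral_congr_fun measurableSet_Ioc fun τ hτ => ?_
      have h2 : 0 ≤ τ ^ (α * i.1 + a - 1) := Real.rpow_nonneg hτ.1.le _
      have h3 : 0 ≤ (t - τ) ^ (α * i.2 + b - 1) := Real.rpow_nonneg (by linarith [hτ.2]) _
      simp only [f, Real.norm_eq_abs, abs_mul, abs_div, abs_of_nonneg h2, abs_of_nonneg h3,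
        abs_of_pos (hGa _), abs_of_pos (hGb _)]
    rw [h1, integral_const_mul, ← intervalIntegral.integral_of_le ht.le, hβ]
    have := hGa i.1
    have := hGb i.2
    field_simp
  -- Absolute convergence of the double series in L¹(0,t) is what allows exchanging it with the
  -- integral.
  have hsum : Summable fun i => ∫ τ in Ioc 0 t, ‖f i τ‖ := by
    simp_rw [hnorm]
    refine Summable.mul_left _ ?_
    refine Summable.of_nonneg_of_le (fun i => ?_) (fun i => ?_)
      (summable_prod_pow_div_Gamma hα hα1 (add_pos ha hb)
        (mul_nonneg hR (Real.rpow_nonneg ht.le α)))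
    · have := hGab (i.1 + i.2)
      positivity
    · have := hGab (i.1 + i.2)
      rw [mul_pow, pow_add R]
      have := hc i.1
      have := hc' i.2
      gcongr
  have hI := hasSum_integral_of_summable_integral_norm
    (fun i => (intervalIntegrable_iff_integrableOn_Ioc_of_le ht.le).1 (hint i)) hsum
  -- The point τ = t is left out because the factor s^{b-1} is absorbed termwise into s^{αn+b-1},
  -- which requires s > 0.
  have hfsum : ∀ τ ∈ Ioc 0 t, τ ≠ t → ∑' i, f i τ
      = gammaKernel α c a τ * gammaKernel α c' b (t - τ) := by
    intro τ hτ hτt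
    have hτ' : 0 < t - τ := sub_pos.2 (lt_of_le_of_ne hτ.2 hτt)
    have e : ∀ {c : ℕ → ℝ} {b : ℝ} {s : ℝ}, 0 < s → gammaKernel α c b s
        = ∑' n : ℕ, c n / Real.Gamma (α * n + b) * s ^ (α * n + b - 1) := by
      intro c b s hs
      rw [gammaKernel, gammaSeries, ← tsum_mul_left]
      congr 1
      ext n
      rw [← Real.rpow_mul_natCast hs.le, add_sub_assoc, Real.rpow_add hs]
      ring
    have sm : ∀ {c : ℕ → ℝ} {b : ℝ} {s : ℝ}, 0 < s → 0 < b → (∀ n, |c n| ≤ R ^ n) →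
        Summable fun n : ℕ => ‖c n / Real.Gamma (α * n + b) * s ^ (α * n + b - 1)‖ := by
      intro c b s hs hb hc
      have := ((summable_gammaSeries hα hα1 hb hc (s ^ α)).norm).mul_left (s ^ (b - 1))
      refine this.congr fun n => ?_
      rw [← Real.rpow_mul_natCast hs.le, add_sub_assoc, Real.rpow_add hs, norm_div, norm_mul,
        norm_mul, norm_mul, norm_div, Real.norm_of_nonneg (Real.rpow_nonneg hs.le (b - 1))]
      ring
    rw [e hτ.1, e hτ', tsum_mul_tsum_of_summable_norm (sm hτ.1 ha hc) (sm hτ' hb hc')]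
    congr 1
    ext i
    simp only [f]
    ring
  have hI2 : ∫ τ in Ioc 0 t, ∑' i, f i τ
      = ∫ τ in (0 : ℝ)..t, gammaKernel α c a τ * gammaKernel α c' b (t - τ) := by
    rw [intervalIntegral.integral_of_le ht.le]
    refine setIntegral_congr_ae measurableSet_Ioc ?_
    have : ∀ᵐ τ : ℝ, τ ≠ t := by simp [ae_iff]
    filter_upwards [this] with τ h1 h2 using hfsum τ h2 h1
  rw [hI2] at hI
  have hI3 : HasSum (fun i : ℕ × ℕ => t ^ (a + b - 1) * (c i.1 * c' i.2
      * (t ^ α) ^ (i.1 + i.2) / Real.Gamma (α * ((i.1 + i.2 : ℕ) : ℝ) + (a + b))))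
      (∫ τ in (0 : ℝ)..t, gammaKernel α c a τ * gammaKernel α c' b (t - τ)) := by
    refine hI.congr_fun ?_
    intro i
    simp only [f]
    rw [integral_const_mul, ← intervalIntegral.integral_of_le ht.le, hβ]
    have := hGa i.1
    have := hGb i.2
    field_simp
  have hI4 := (Finset.HasAntidiagonal.sigmaAntidiagonalEquivProd.hasSum_iff.2 hI3).sigma
    (fun n => hasSum_fintype _)
  rw [gammaKernel, gammaSeries, ← tsum_mul_left, ← hI4.tsum_eq]
  congr 1
  ext n
  rw [← hd n, Finset.sum_mul, Finset.sum_div, Finset.mul_sum,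
    ← Finset.sum_coe_sort (Finset.HasAntidiagonal.antidiagonal n)]
  refine Finset.sum_congr rfl fun i _ => ?_
  have h1 := Finset.HasAntidiagonal.mem_antidiagonal.1 i.2
  have h2 : (i.1.1 : ℝ) + i.1.2 = n := by exact_mod_cast h1
  simp [Finset.HasAntidiagonal.sigmaAntidiagonalEquivProd, h1, h2]

end Convolution

/-! ### The relaxation function and its resolvent kernel -/

/-- The relaxation function `E_{α,1}(-l t^α)`. -/
def mlE (α l t : ℝ) : ℝ := mittagLeffler α 1 (-(l * t ^ α))

/-- The kernel `t^{α-1} E_{α,α}(-l t^α)`. -/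
def mlG (α l t : ℝ) : ℝ := t ^ (α - 1) * mittagLeffler α α (-(l * t ^ α))

section Identities

variable {α l b t : ℝ}

theorem mittagLeffler_neg_mul (α b l z : ℝ) :
    mittagLeffler α b (-(l * z)) = gammaSeries α (fun n => (-l) ^ n) b z := by
  rw [mittagLeffler, gammaSeries]
  congr 1
  ext n
  rw [← neg_mul, mul_pow]

theorem mlE_eq_gammaSeries (α l t : ℝ) :
    mlE α l t = gammaSeries α (fun n => (-l) ^ n) 1 (t ^ α) := mittagLeffler_neg_mul _ _ _ _

theorem mlE_eq_gammaKernel (α l t : ℝ) : mlE α l t = gammaKernel α (fun n => (-l) ^ n) 1 t := by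
  rw [mlE_eq_gammaSeries, gammaKernel]; simp

theorem mlG_eq_gammaKernel (α l t : ℝ) : mlG α l t = gammaKernel α (fun n => (-l) ^ n) α t := by
  rw [mlG, mittagLeffler_neg_mul, gammaKernel]

/-- The base 2l, rather than l, serves all three coefficient sequences in use: (-l)^n, (n+1)(-l)^n
and the unit sequence. The convolution theorem asks for a common R. -/
theorem abs_geom_le (hl : 0 < l) (n : ℕ) : |(-l) ^ n| ≤ (2 * l) ^ n := by
  rw [abs_pow, abs_neg, abs_of_pos hl]
  gcongr
  linarith

theorem abs_succ_mul_geom_le (hl : 0 < l) (n : ℕ) : |(n + 1) * (-l) ^ n| ≤ (2 * l) ^ n := by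
  rw [abs_mul, abs_pow, abs_neg, abs_of_pos hl, mul_pow, abs_of_nonneg (by positivity)]
  gcongr
  have : n + 1 ≤ 2 ^ n := Nat.lt_two_pow_self
  exact_mod_cast this

theorem abs_single_le (hl : 0 < l) (n : ℕ) : |(if n = 0 then 1 else 0 : ℝ)| ≤ (2 * l) ^ n := by
  split_ifs with h
  · simp [h]
  · simp only [abs_zero]; positivity

/-- Convolution with this kernel is the fractional integral of order b, so fractional integrals are
instances of the convolution theorem. -/
theorem gammaKernel_single (α b t : ℝ) :
    gammaKernel α (fun n => if n = 0 then 1 else 0) b t = t ^ (b - 1) / Real.Gamma b := by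
  rw [gammaKernel, gammaSeries, tsum_eq_single 0 (by intro n hn; simp [hn])]
  simp [div_eq_mul_inv]

/-- Raising b by α shifts the Gamma denominators by one index and contributes a factor t^α, so the
two series combine coefficientwise: multiplication of the generating series of c by 1 + l z. -/
theorem gammaKernel_add_mul {c d : ℕ → ℝ} {R : ℝ} (hα : 0 < α) (hα1 : α < 1) (hb : 0 < b)
    (ht : 0 < t) (hc : ∀ n, |c n| ≤ R ^ n) (h0 : c 0 = d 0)
    (hd : ∀ n, c (n + 1) + l * c n = d (n + 1)) (hdR : ∀ n, |d n| ≤ R ^ n) :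
    gammaKernel α c b t + l * gammaKernel α c (b + α) t = gammaKernel α d b t := by
  have hs := summable_gammaSeries hα hα1 hb hc (t ^ α)
  have hs' := summable_gammaSeries hα hα1 (by linarith : 0 < b + α) hc (t ^ α)
  have hsd := summable_gammaSeries hα hα1 hb hdR (t ^ α)
  have e : t ^ (b + α - 1) = t ^ (b - 1) * t ^ α := by rw [← Real.rpow_add ht]; ring_nf
  simp only [gammaKernel, gammaSeries]
  rw [hs.tsum_eq_zero_add, hsd.tsum_eq_zero_add, e, h0]
  have key : (∑' n : ℕ, c (n + 1) * (t ^ α) ^ (n + 1) / Real.Gamma (α * ((n + 1 : ℕ) : ℝ) + b))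
      + l * (t ^ α * ∑' n : ℕ, c n * (t ^ α) ^ n / Real.Gamma (α * n + (b + α)))
      = ∑' n : ℕ, d (n + 1) * (t ^ α) ^ (n + 1) / Real.Gamma (α * ((n + 1 : ℕ) : ℝ) + b) := by
    rw [← tsum_mul_left, ← tsum_mul_left, ← Summable.tsum_add]
    · congr 1
      ext n
      have e2 : α * ((n + 1 : ℕ) : ℝ) + b = α * n + (b + α) := by push_cast; ring
      rw [e2, ← hd n]
      ring
    · exact (summable_nat_add_iff 1).2 hs
    · exact (hs'.mul_left _).mul_left _
  linear_combination t ^ (b - 1) * key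

theorem sum_antidiagonal_geom_single (l : ℝ) (n : ℕ) :
    ∑ i ∈ Finset.HasAntidiagonal.antidiagonal n, (-l) ^ i.1 * (if i.2 = 0 then 1 else 0 : ℝ)
      = (-l) ^ n := by
  rw [Finset.sum_eq_single (n, 0)]
  · simp
  · rintro ⟨i, j⟩ h1 h2
    rw [Finset.HasAntidiagonal.mem_antidiagonal] at h1
    have : j ≠ 0 := by
      rintro rfl
      exact h2 (by simpa using h1)
    simp [this]
  · intro h; exact absurd (by simp) h

theorem sum_antidiagonal_succ_geom_single (l : ℝ) (n : ℕ) :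
    ∑ i ∈ Finset.HasAntidiagonal.antidiagonal n,
      ((i.1 : ℝ) + 1) * (-l) ^ i.1 * (if i.2 = 0 then 1 else 0 : ℝ) = (n + 1) * (-l) ^ n := by
  rw [Finset.sum_eq_single (n, 0)]
  · simp
  · rintro ⟨i, j⟩ h1 h2
    rw [Finset.HasAntidiagonal.mem_antidiagonal] at h1
    have : j ≠ 0 := by
      rintro rfl
      exact h2 (by simpa using h1)
    simp [this]
  · intro h; exact absurd (by simp) h

theorem sum_antidiagonal_geom_geom (l : ℝ) (n : ℕ) :
    ∑ i ∈ Finset.HasAntidiagonal.antidiagonal n, (-l) ^ i.1 * (-l) ^ i.2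
      = (n + 1) * (-l) ^ n := by
  rw [Finset.sum_congr rfl (g := fun _ => (-l) ^ n)]
  · simp
  · intro i hi
    rw [← pow_add, Finset.HasAntidiagonal.mem_antidiagonal.1 hi]

theorem intervalIntegrable_sub_rpow (r a b : ℝ) (hr : -1 < r) :
    IntervalIntegrable (fun τ => (t - τ) ^ r) volume a b := by
  have := (intervalIntegral.intervalIntegrable_rpow' (a := t - a) (b := t - b) hr).comp_sub_left t
  simpa using this

theorem mlE_zero (hα : 0 < α) : mlE α l 0 = 1 := by
  rw [mlE_eq_gammaSeries, Real.zero_rpow hα.ne', gammaSeries,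
    tsum_eq_single 0 (by intro n hn; simp [hn])]
  simp

variable (hα : 0 < α) (hα1 : α < 1) (hl : 0 < l) (ht : 0 < t)
include hα hα1 hl

theorem continuous_mlE : Continuous (mlE α l) := by
  have := continuous_gammaSeries_rpow hα hα1 one_pos (abs_geom_le hl)
  exact this.congr fun t => (mlE_eq_gammaSeries α l t).symm

theorem intervalIntegrable_mlG (a b : ℝ) : IntervalIntegrable (mlG α l) volume a b := by
  have := intervalIntegrable_gammaKernel hα hα1 hα (abs_geom_le hl) a b
  exact this.congr fun t _ => (mlG_eq_gammaKernel α l t).symm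

theorem intervalIntegrable_mlG_comp_sub (a b : ℝ) :
    IntervalIntegrable (fun τ => mlG α l (t - τ)) volume a b := by
  have := (intervalIntegrable_mlG hα hα1 hl (t - a) (t - b)).comp_sub_left t
  simpa using this

include ht

/-- In Laplace variables g and E correspond to 1/(z^α + l) and z^{α-1}/(z^α + l). This identity and
the next ones are rational relations between these symbols, verified on coefficients. Here the
factor z^{α-1} is the symbol of t^{-α}/Γ(1-α). -/
theorem integral_mlG_mul_rpow :
    ∫ τ in (0 : ℝ)..t, mlG α l τ * ((t - τ) ^ (-α) / Real.Gamma (1 - α)) = mlE α l t := by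
  have h := integral_gammaKernel_mul hα hα1 hα (by linarith : 0 < 1 - α) (by positivity)
    (abs_geom_le hl) (abs_single_le hl) (sum_antidiagonal_geom_single l) ht
  simp only [gammaKernel_single, ← mlG_eq_gammaKernel] at h
  rw [mlE_eq_gammaKernel]
  convert h using 3
  · ring_nf
  · ring_nf

theorem integral_mlG_eq : ∫ τ in (0 : ℝ)..t, mlG α l τ
    = gammaKernel α (fun n => (-l) ^ n) (1 + α) t := by
  have h := integral_gammaKernel_mul hα hα1 hα one_pos (by positivity)
    (abs_geom_le hl) (abs_single_le hl) (sum_antidiagonal_geom_single l) ht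
  simpa [gammaKernel_single, ← mlG_eq_gammaKernel, add_comm] using h

theorem mlE_add_gammaKernel : mlE α l t + l * gammaKernel α (fun n => (-l) ^ n) (1 + α) t = 1 := by
  have h := gammaKernel_add_mul hα hα1 one_pos ht (abs_geom_le hl) (l := l)
    (d := fun n => if n = 0 then 1 else 0) (by simp) (fun n => by simp; ring) (abs_single_le hl)
  rw [gammaKernel_single] at h
  rw [mlE_eq_gammaKernel, h]
  simp

theorem mlE_add_integral_mlG : mlE α l t + l * ∫ τ in (0 : ℝ)..t, mlG α l τ = 1 := by
  rw [integral_mlG_eq hα hα1 hl ht, mlE_add_gammaKernel hα hα1 hl ht]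

theorem mlE_add_integral_mlE :
    mlE α l t + l * ∫ τ in (0 : ℝ)..t, mlE α l τ * ((t - τ) ^ (α - 1) / Real.Gamma α) = 1 := by
  have h := integral_gammaKernel_mul hα hα1 one_pos hα (by positivity)
    (abs_geom_le hl) (abs_single_le hl) (sum_antidiagonal_geom_single l) ht
  simp only [gammaKernel_single, ← mlE_eq_gammaKernel] at h
  rw [h, mlE_add_gammaKernel hα hα1 hl ht]

theorem mlG_add_integral_mlG :
    mlG α l t + l * ∫ τ in (0 : ℝ)..t, mlG α l τ * ((t - τ) ^ (α - 1) / Real.Gamma α)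
      = t ^ (α - 1) / Real.Gamma α := by
  have h := integral_gammaKernel_mul hα hα1 hα hα (by positivity)
    (abs_geom_le hl) (abs_single_le hl) (sum_antidiagonal_geom_single l) ht
  simp only [gammaKernel_single, ← mlG_eq_gammaKernel] at h
  have h2 := gammaKernel_add_mul hα hα1 hα ht (abs_geom_le hl) (l := l)
    (d := fun n => if n = 0 then 1 else 0) (by simp) (fun n => by simp; ring) (abs_single_le hl)
  rw [gammaKernel_single] at h2
  rw [h, mlG_eq_gammaKernel, h2]

-- From Γ(x + 1) = x Γ(x) with x = α(n + 1): the factor n + 1 cancels against the denominator.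
omit hα1 hl in
theorem mul_gammaKernel_succ_geom :
    α * gammaKernel α (fun n => (n + 1) * (-l) ^ n) (1 + α) t = t * mlG α l t := by
  rw [mlG_eq_gammaKernel, gammaKernel, gammaKernel, gammaSeries, gammaSeries, ← tsum_mul_left,
    ← tsum_mul_left, ← tsum_mul_left, ← tsum_mul_left]
  congr 1
  ext n
  have e1 : α * n + (1 + α) = (α * n + α) + 1 := by ring
  have e2 : t ^ (1 + α - 1) = t * t ^ (α - 1) := by
    rw [← Real.rpow_one_add' ht.le (by linarith)]; ring_nf
  have hG : 0 < Real.Gamma (α * n + α) := Real.Gamma_pos_of_pos (by positivity)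
  rw [e1, Real.Gamma_add_one (by positivity), e2]
  have : α * n + α ≠ 0 := by positivity
  field_simp

/-- Multiplication by t is -d/dz, and -d/dz of 1/(z^α + l) is α times the product of the symbols of
E and g. -/
theorem mul_mlG_eq_integral :
    t * mlG α l t = α * ∫ τ in (0 : ℝ)..t, mlE α l τ * mlG α l (t - τ) := by
  have h := integral_gammaKernel_mul hα hα1 one_pos hα (by positivity)
    (abs_geom_le hl) (abs_geom_le hl) (sum_antidiagonal_geom_geom l) ht
  simp only [← mlG_eq_gammaKernel, ← mlE_eq_gammaKernel] at h
  rw [h, mul_gammaKernel_succ_geom hα ht]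

/-- An integrated form of (t g)' = α w, where w has symbol z^α/(z^α + l)². It serves for time
differences of g without differentiating the series. -/
theorem mul_mlG_eq_integral_gammaKernel :
    t * mlG α l t = α * ∫ τ in (0 : ℝ)..t, gammaKernel α (fun n => (n + 1) * (-l) ^ n) α τ := by
  have h := integral_gammaKernel_mul hα hα1 hα one_pos (by positivity)
    (abs_succ_mul_geom_le hl) (abs_single_le hl) (sum_antidiagonal_succ_geom_single l) ht
  simp only [gammaKernel_single, sub_self, Real.rpow_zero, Real.Gamma_one, div_one, mul_one] at h
  rw [h, add_comm α 1, mul_gammaKernel_succ_geom hα ht]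

/-- The partial fraction z^α/(z^α + l)² = 1/(z^α + l) - l/(z^α + l)². It expresses w through g,
where positivity gives bounds uniform in l. -/
theorem gammaKernel_succ_geom_eq :
    gammaKernel α (fun n => (n + 1) * (-l) ^ n) α t
      = mlG α l t - l * ∫ τ in (0 : ℝ)..t, mlG α l τ * mlG α l (t - τ) := by
  have h := integral_gammaKernel_mul hα hα1 hα hα (by positivity)
    (abs_geom_le hl) (abs_geom_le hl) (sum_antidiagonal_geom_geom l) ht
  simp only [← mlG_eq_gammaKernel] at h
  have h2 := gammaKernel_add_mul hα hα1 hα ht (abs_succ_mul_geom_le hl) (l := l)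
    (d := fun n => (-l) ^ n) (by simp) (fun n => by push_cast; ring) (abs_geom_le hl)
  rw [h, mlG_eq_gammaKernel, ← h2]
  ring

omit ht in
theorem intervalIntegrable_mlE_mul_mlG :
    IntervalIntegrable (fun τ => mlE α l τ * mlG α l (t - τ)) volume 0 t :=
  (intervalIntegrable_mlG_comp_sub hα hα1 hl 0 t).continuousOn_mul
    (continuous_mlE hα hα1 hl).continuousOn

theorem intervalIntegrable_mlG_mul_mlG :
    IntervalIntegrable (fun τ => mlG α l τ * mlG α l (t - τ)) volume 0 t := by
  have h := intervalIntegrable_gammaKernel_mul hα hα1 hα hα (abs_geom_le hl) (abs_geom_le hl) ht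
  simpa only [← mlG_eq_gammaKernel] using h

theorem intervalIntegrable_mlG_mul_rpow {r : ℝ} (hr : 0 < r) :
    IntervalIntegrable (fun τ => mlG α l τ * ((t - τ) ^ (r - 1) / Real.Gamma r)) volume 0 t := by
  have h := intervalIntegrable_gammaKernel_mul hα hα1 hα hr (abs_geom_le hl) (abs_single_le hl) ht
  simpa only [← mlG_eq_gammaKernel, gammaKernel_single] using h

end Identities

/-! ### Positivity, monotonicity and decay, uniform in l. -/

section Bounds

variable {α l t : ℝ}

theorem mlE_pos_of_mlG_pos (hα : 0 < α) (hα1 : α < 1) (hl : 0 < l) (ht : 0 < t)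
    (h : ∀ τ ∈ Ioo 0 t, 0 < mlG α l τ) : 0 < mlE α l t := by
  rw [← integral_mlG_mul_rpow hα hα1 hl ht]
  have hi := intervalIntegrable_mlG_mul_rpow hα hα1 hl ht (by linarith : 0 < 1 - α)
  have e : 1 - α - 1 = -α := by ring
  rw [e] at hi
  refine intervalIntegral.intervalIntegral_pos_of_pos_on hi (fun τ hτ => ?_) ht
  have h1 := h τ hτ
  have h2 : 0 < (t - τ) ^ (-α) := Real.rpow_pos_of_pos (by linarith [hτ.2]) _
  have h3 : 0 < Real.Gamma (1 - α) := Real.Gamma_pos_of_pos (by linarith)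
  positivity

/-- The resolvent kernel is positive: at a first zero `t` of it, the identity
`t g(t) = α (E ⋆ g)(t)` would give `0 > 0`. -/
theorem mlG_pos (hα : 0 < α) (hα1 : α < 1) (hl : 0 < l) (ht : 0 < t) : 0 < mlG α l t := by
  by_contra hneg
  -- The singular factor t^{α-1} is removed so that f is continuous up to 0 with f(0) = 1/Γ(α) > 0;
  -- a least point of {f ≤ 0} in [0,t] then exists and is positive.
  let f : ℝ → ℝ := fun s => mittagLeffler α α (-(l * s ^ α))
  have hf : Continuous f :=
    (continuous_gammaSeries_rpow hα hα1 hα (abs_geom_le hl)).congr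
      fun s => (mittagLeffler_neg_mul _ _ _ _).symm
  have hG : ∀ s, mlG α l s = s ^ (α - 1) * f s := fun s => rfl
  have hf0 : 0 < f 0 := by
    have : f 0 = 1 / Real.Gamma α := by
      change mittagLeffler α α (-(l * 0 ^ α)) = _
      rw [mittagLeffler_neg_mul, Real.zero_rpow hα.ne', gammaSeries,
        tsum_eq_single 0 (by intro n hn; simp [hn])]
      simp
    rw [this]
    exact one_div_pos.2 (Real.Gamma_pos_of_pos hα)
  have hft : f t ≤ 0 := by
    by_contra h
    exact hneg ((hG t).symm ▸ mul_pos (Real.rpow_pos_of_pos ht _) (not_le.1 h))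
  obtain ⟨s, ⟨hs1, hs2⟩, hmin⟩ := (isCompact_Icc.inter_right
    (isClosed_le hf continuous_const) : IsCompact (Icc 0 t ∩ {s | f s ≤ 0})).exists_isLeast
      ⟨t, ⟨ht.le, le_rfl⟩, hft⟩
  have hs2 : f s ≤ 0 := hs2
  have hs0 : 0 < s := lt_of_le_of_ne hs1.1 (by rintro rfl; linarith)
  have hpos : ∀ τ ∈ Ioo 0 s, 0 < mlG α l τ := by
    intro τ hτ
    rw [hG]
    refine mul_pos (Real.rpow_pos_of_pos hτ.1 _) ?_
    by_contra h
    have := hmin ⟨⟨hτ.1.le, hτ.2.le.trans hs1.2⟩, not_lt.1 h⟩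
    linarith [hτ.2]
  have h1 := mul_mlG_eq_integral hα hα1 hl hs0
  have h2 : 0 < ∫ τ in (0 : ℝ)..s, mlE α l τ * mlG α l (s - τ) := by
    refine intervalIntegral.intervalIntegral_pos_of_pos_on
      (intervalIntegrable_mlE_mul_mlG hα hα1 hl) (fun τ hτ => ?_) hs0
    refine mul_pos (mlE_pos_of_mlG_pos hα hα1 hl hτ.1 fun x hx =>
      hpos x ⟨hx.1, hx.2.trans hτ.2⟩) (hpos _ ⟨by linarith [hτ.2], by linarith [hτ.1]⟩)
  have h3 : s * mlG α l s ≤ 0 := by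
    rw [hG]
    exact mul_nonpos_of_nonneg_of_nonpos hs0.le
      (mul_nonpos_of_nonneg_of_nonpos (Real.rpow_nonneg hs0.le _) hs2)
  have h4 := mul_pos hα h2
  linarith

variable (hα : 0 < α) (hα1 : α < 1) (hl : 0 < l)
include hα hα1 hl

theorem mlE_pos (ht : 0 ≤ t) : 0 < mlE α l t := by
  rcases ht.eq_or_lt with rfl | ht
  · rw [mlE_zero hα]; exact one_pos
  · exact mlE_pos_of_mlG_pos hα hα1 hl ht fun τ hτ => mlG_pos hα hα1 hl hτ.1

theorem mlE_eq (ht : 0 ≤ t) : mlE α l t = 1 - l * ∫ τ in (0 : ℝ)..t, mlG α l τ := by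
  rcases ht.eq_or_lt with rfl | ht
  · simp [mlE_zero hα]
  · linarith [mlE_add_integral_mlG hα hα1 hl ht]

theorem mlE_sub {s : ℝ} (hs : 0 ≤ s) (hst : s ≤ t) :
    mlE α l s - mlE α l t = l * ∫ τ in s..t, mlG α l τ := by
  rw [mlE_eq hα hα1 hl hs, mlE_eq hα hα1 hl (hs.trans hst),
    ← intervalIntegral.integral_add_adjacent_intervals
      (intervalIntegrable_mlG hα hα1 hl 0 s) (intervalIntegrable_mlG hα hα1 hl s t)]
  ring

theorem integral_mlG_nonneg {s : ℝ} (hs : 0 ≤ s) (hst : s ≤ t) :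
    0 ≤ ∫ τ in s..t, mlG α l τ := by
  rw [intervalIntegral.integral_of_le hst]
  exact setIntegral_nonneg measurableSet_Ioc fun τ hτ =>
    (mlG_pos hα hα1 hl (hs.trans_lt hτ.1)).le

theorem mlE_anti {s : ℝ} (hs : 0 ≤ s) (hst : s ≤ t) : mlE α l t ≤ mlE α l s := by
  have := mlE_sub hα hα1 hl hs hst
  have := mul_nonneg hl.le (integral_mlG_nonneg hα hα1 hl hs hst)
  linarith

theorem mlE_le_one (ht : 0 ≤ t) : mlE α l t ≤ 1 := by
  have := mlE_anti hα hα1 hl le_rfl ht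
  rwa [mlE_zero hα] at this

theorem mul_integral_mlG_le_one (ht : 0 ≤ t) : l * ∫ τ in (0 : ℝ)..t, mlG α l τ ≤ 1 := by
  have := mlE_eq hα hα1 hl ht
  linarith [mlE_pos hα hα1 hl ht]

/-- In E = I^{1-α} g the kernel (t - τ)^{-α} is at least t^{-α}, and l ∫ g = 1 - E. This lower bound
on E controls the division by E(T). -/
theorem one_le_mlE_mul (ht : 0 < t) :
    1 ≤ mlE α l t * (1 + l * Real.Gamma (1 - α) * t ^ α) := by
  have hGm : 0 < Real.Gamma (1 - α) := Real.Gamma_pos_of_pos (by linarith)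
  have htα : 0 < t ^ α := Real.rpow_pos_of_pos ht α
  have e : 1 - α - 1 = -α := by ring
  have hi := intervalIntegrable_mlG_mul_rpow hα hα1 hl ht (by linarith : 0 < 1 - α)
  rw [e] at hi
  have h : (∫ τ in (0 : ℝ)..t, mlG α l τ) * (t ^ (-α) / Real.Gamma (1 - α)) ≤ mlE α l t := by
    rw [← integral_mlG_mul_rpow hα hα1 hl ht, ← intervalIntegral.integral_mul_const]
    refine intervalIntegral.integral_mono_on_of_le_Ioo ht.le
      ((intervalIntegrable_mlG hα hα1 hl 0 t).mul_const _) hi fun τ hτ => ?_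
    refine mul_le_mul_of_nonneg_left ?_ (mlG_pos hα hα1 hl hτ.1).le
    gcongr ?_ / _
    exact Real.rpow_le_rpow_of_nonpos (by linarith [hτ.2]) (by linarith [hτ.1]) (by linarith)
  rw [Real.rpow_neg ht.le] at h
  have h2 := mlE_eq hα hα1 hl ht.le
  have h3 : (∫ τ in (0 : ℝ)..t, mlG α l τ) ≤ mlE α l t * (Real.Gamma (1 - α) * t ^ α) := by
    have := mul_le_mul_of_nonneg_right h (mul_pos hGm htα).le
    calc _ = (∫ τ in (0 : ℝ)..t, mlG α l τ) * ((t ^ α)⁻¹ / Real.Gamma (1 - α))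
          * (Real.Gamma (1 - α) * t ^ α) := by field_simp
      _ ≤ _ := this
  have h4 := mul_le_mul_of_nonneg_left h3 hl.le
  linarith

/-- E is decreasing, so I^α E at t is at least E(t) t^α/Γ(α+1); insert this in E + l I^α E = 1. -/
theorem mlE_mul_le_one (ht : 0 < t) :
    mlE α l t * (1 + l * t ^ α / Real.Gamma (α + 1)) ≤ 1 := by
  have hGm : 0 < Real.Gamma α := Real.Gamma_pos_of_pos hα
  have hk : IntervalIntegrable (fun τ => (t - τ) ^ (α - 1) / Real.Gamma α) volume 0 t :=
    (intervalIntegrable_sub_rpow (α - 1) 0 t (by linarith)).div_const _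
  have h : mlE α l t * (t ^ α / Real.Gamma (α + 1))
      ≤ ∫ τ in (0 : ℝ)..t, mlE α l τ * ((t - τ) ^ (α - 1) / Real.Gamma α) := by
    have e : t ^ α / Real.Gamma (α + 1)
        = ∫ τ in (0 : ℝ)..t, (t - τ) ^ (α - 1) / Real.Gamma α := by
      rw [intervalIntegral.integral_div,
        intervalIntegral.integral_comp_sub_left (fun x => x ^ (α - 1)) t,
        integral_rpow (Or.inl (by linarith)), Real.Gamma_add_one hα.ne']
      simp only [sub_self, sub_zero, sub_add_cancel, Real.zero_rpow hα.ne', div_div]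
    rw [e, ← intervalIntegral.integral_const_mul]
    refine intervalIntegral.integral_mono_on_of_le_Ioo ht.le (hk.const_mul _)
      (hk.continuousOn_mul (continuous_mlE hα hα1 hl).continuousOn) fun τ hτ => ?_
    refine mul_le_mul_of_nonneg_right (mlE_anti hα hα1 hl hτ.1.le hτ.2.le) ?_
    exact div_nonneg (Real.rpow_nonneg (by linarith [hτ.2]) _) hGm.le
  have h2 := mlE_add_integral_mlE hα hα1 hl ht
  have h3 := mul_le_mul_of_nonneg_left h hl.le
  rw [mul_add, mul_one]
  linarith [show mlE α l t * (l * t ^ α / Real.Gamma (α + 1))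
    = l * (mlE α l t * (t ^ α / Real.Gamma (α + 1))) by ring]

theorem mlG_le_rpow (ht : 0 < t) : mlG α l t ≤ t ^ (α - 1) / Real.Gamma α := by
  rw [← mlG_add_integral_mlG hα hα1 hl ht]
  have hGm : 0 < Real.Gamma α := Real.Gamma_pos_of_pos hα
  have : 0 ≤ ∫ τ in (0 : ℝ)..t, mlG α l τ * ((t - τ) ^ (α - 1) / Real.Gamma α) := by
    rw [intervalIntegral.integral_of_le ht.le]
    refine setIntegral_nonneg measurableSet_Ioc fun τ hτ => mul_nonneg
      (mlG_pos hα hα1 hl hτ.1).le ?_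
    exact div_nonneg (Real.rpow_nonneg (by linarith [hτ.2]) _) hGm.le
  have := mul_nonneg hl.le this
  linarith

/-- Use E ≤ 1 in t g = α (E ⋆ g), then l ∫ g ≤ 1. -/
theorem mul_mlG_le (ht : 0 < t) : l * (t * mlG α l t) ≤ α := by
  rw [mul_mlG_eq_integral hα hα1 hl ht]
  have h : ∫ τ in (0 : ℝ)..t, mlE α l τ * mlG α l (t - τ) ≤ ∫ τ in (0 : ℝ)..t, mlG α l τ := by
    have e : ∫ τ in (0 : ℝ)..t, mlG α l τ = ∫ τ in (0 : ℝ)..t, mlG α l (t - τ) := by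
      rw [intervalIntegral.integral_comp_sub_left (fun x => mlG α l x) t]; simp
    rw [e]
    refine intervalIntegral.integral_mono_on_of_le_Ioo ht.le
      (intervalIntegrable_mlE_mul_mlG hα hα1 hl)
      (intervalIntegrable_mlG_comp_sub hα hα1 hl 0 t) fun τ hτ => ?_
    exact mul_le_of_le_one_left (mlG_pos hα hα1 hl (by linarith [hτ.2])).le
      (mlE_le_one hα hα1 hl hτ.1.le)
  have h2 := mul_integral_mlG_le_one hα hα1 hl ht.le
  have h3 := mul_le_mul_of_nonneg_left h hl.le
  calc l * (α * ∫ τ in (0 : ℝ)..t, mlE α l τ * mlG α l (t - τ))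
      = α * (l * ∫ τ in (0 : ℝ)..t, mlE α l τ * mlG α l (t - τ)) := by ring
    _ ≤ α * 1 := mul_le_mul_of_nonneg_left (h3.trans h2) hα.le
    _ = α := mul_one α

/-- One of τ, t - τ is at least t/2, and there g is at most M, of order t^{α-1}. The other factor
has integral at most 1/l, which compensates the prefactor l. -/
theorem mul_integral_mlG_mul_mlG_le (ht : 0 < t) :
    l * ∫ τ in (0 : ℝ)..t, mlG α l τ * mlG α l (t - τ) ≤ 4 / Real.Gamma α * t ^ (α - 1) := by
  have hGm : 0 < Real.Gamma α := Real.Gamma_pos_of_pos hα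
  have hp : 0 < t ^ (α - 1) := Real.rpow_pos_of_pos ht _
  set M := 2 * t ^ (α - 1) / Real.Gamma α with hM
  have hM0 : 0 < M := by positivity
  have hMle : ∀ x, t / 2 ≤ x → mlG α l x ≤ M := by
    intro x hx
    refine (mlG_le_rpow hα hα1 hl (by linarith)).trans ?_
    rw [hM]
    gcongr
    calc x ^ (α - 1) ≤ (t / 2) ^ (α - 1) :=
          Real.rpow_le_rpow_of_nonpos (by linarith) hx (by linarith)
      _ = 2 ^ (1 - α) * t ^ (α - 1) := by
          rw [Real.div_rpow ht.le (by norm_num), div_eq_mul_inv, ← Real.rpow_neg (by norm_num),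
            mul_comm, neg_sub]
      _ ≤ 2 * t ^ (α - 1) := by
          gcongr
          calc (2 : ℝ) ^ (1 - α) ≤ 2 ^ (1 : ℝ) :=
                Real.rpow_le_rpow_of_exponent_le (by norm_num) (by linarith)
            _ = 2 := by simp
  have e : ∫ τ in (0 : ℝ)..t, mlG α l (t - τ) = ∫ τ in (0 : ℝ)..t, mlG α l τ := by
    rw [intervalIntegral.integral_comp_sub_left (fun x => mlG α l x) t]; simp
  have h : ∫ τ in (0 : ℝ)..t, mlG α l τ * mlG α l (t - τ)
      ≤ ∫ τ in (0 : ℝ)..t, M * (mlG α l τ + mlG α l (t - τ)) := by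
    refine intervalIntegral.integral_mono_on_of_le_Ioo ht.le
      (intervalIntegrable_mlG_mul_mlG hα hα1 hl ht)
      (((intervalIntegrable_mlG hα hα1 hl 0 t).add
        (intervalIntegrable_mlG_comp_sub hα hα1 hl 0 t)).const_mul _) fun τ hτ => ?_
    have h1 := mlG_pos hα hα1 hl hτ.1
    have h2 : 0 < mlG α l (t - τ) := mlG_pos hα hα1 hl (by linarith [hτ.2])
    rcases le_total (t / 2) τ with h3 | h3
    · have := mul_le_mul_of_nonneg_right (hMle τ h3) h2.le
      have := mul_pos hM0 h1
      linarith
    · have := mul_le_mul_of_nonneg_left (hMle (t - τ) (by linarith)) h1.le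
      have := mul_pos hM0 h2
      linarith
  rw [intervalIntegral.integral_const_mul, intervalIntegral.integral_add
    (intervalIntegrable_mlG hα hα1 hl 0 t) (intervalIntegrable_mlG_comp_sub hα hα1 hl 0 t), e] at h
  have h2 := mul_integral_mlG_le_one hα hα1 hl ht.le
  have h3 := mul_le_mul_of_nonneg_left h hl.le
  have h4 := mul_le_mul_of_nonneg_left h2 hM0.le
  calc _ ≤ _ := h3
    _ = 2 * (M * (l * ∫ τ in (0 : ℝ)..t, mlG α l τ)) := by ring
    _ ≤ 2 * (M * 1) := by linarith
    _ = _ := by rw [hM]; ring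

/-- A substitute for |g'(t)| ≤ C t^{α-2} with C independent of l: write s (g(t) - g(s)) as the
increment of t g, namely α ∫ w, minus (t - s) g(t). -/
theorem abs_mlG_sub_le {s : ℝ} (hs : 0 < s) (hst : s ≤ t) :
    |mlG α l t - mlG α l s| ≤ 6 / Real.Gamma α * ((t - s) / s * s ^ (α - 1)) := by
  have hGm : 0 < Real.Gamma α := Real.Gamma_pos_of_pos hα
  have ht : 0 < t := hs.trans_le hst
  set w := gammaKernel α (fun n => (n + 1) * (-l) ^ n) α with hw
  have hwi : ∀ a b, IntervalIntegrable w volume a b :=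
    intervalIntegrable_gammaKernel hα hα1 hα (abs_succ_mul_geom_le hl)
  -- The 5 is 1 from g plus 4 from l (g ⋆ g); the term (t - s) g(t) later raises it to 6.
  have hwle : ∀ x ∈ Ioc s t, ‖w x‖ ≤ 5 / Real.Gamma α * s ^ (α - 1) := by
    intro x hx
    have hx0 : 0 < x := hs.trans hx.1
    have hxs : x ^ (α - 1) ≤ s ^ (α - 1) :=
      Real.rpow_le_rpow_of_nonpos hs hx.1.le (by linarith)
    rw [hw, gammaKernel_succ_geom_eq hα hα1 hl hx0, Real.norm_eq_abs, abs_le]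
    have h1 := mul_integral_mlG_mul_mlG_le hα hα1 hl hx0
    have h2 : 0 ≤ l * ∫ τ in (0 : ℝ)..x, mlG α l τ * mlG α l (x - τ) := by
      refine mul_nonneg hl.le ?_
      rw [intervalIntegral.integral_of_le hx0.le, integral_Ioc_eq_integral_Ioo]
      exact setIntegral_nonneg measurableSet_Ioo fun τ hτ => mul_nonneg
        (mlG_pos hα hα1 hl hτ.1).le (mlG_pos hα hα1 hl (by linarith [hτ.2])).le
    have h3 := mlG_le_rpow hα hα1 hl hx0
    have h4 := mlG_pos hα hα1 hl hx0
    have h5 : 1 / Real.Gamma α * x ^ (α - 1) ≤ 1 / Real.Gamma α * s ^ (α - 1) := by gcongr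
    have h6 : 0 < 1 / Real.Gamma α * x ^ (α - 1) := by positivity
    have e1 : x ^ (α - 1) / Real.Gamma α = 1 / Real.Gamma α * x ^ (α - 1) := by ring
    have e2 : 4 / Real.Gamma α * x ^ (α - 1) = 4 * (1 / Real.Gamma α * x ^ (α - 1)) := by ring
    have e3 : 5 / Real.Gamma α * s ^ (α - 1) = 5 * (1 / Real.Gamma α * s ^ (α - 1)) := by ring
    rw [e1] at h3
    rw [e2] at h1
    rw [e3]
    constructor <;> linarith
  have hI : |∫ x in s..t, w x| ≤ 5 / Real.Gamma α * s ^ (α - 1) * (t - s) := by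
    have := intervalIntegral.norm_integral_le_of_norm_le_const (a := s) (b := t) (f := w)
      (C := 5 / Real.Gamma α * s ^ (α - 1)) (by rwa [uIoc_of_le hst])
    rwa [abs_of_nonneg (by linarith), Real.norm_eq_abs] at this
  have hdiff : t * mlG α l t - s * mlG α l s = α * ∫ x in s..t, w x := by
    rw [mul_mlG_eq_integral_gammaKernel hα hα1 hl ht, mul_mlG_eq_integral_gammaKernel hα hα1 hl hs,
      ← intervalIntegral.integral_add_adjacent_intervals (hwi 0 s) (hwi s t)]
    ring
  have hGt : mlG α l t ≤ 1 / Real.Gamma α * s ^ (α - 1) := by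
    refine (mlG_le_rpow hα hα1 hl ht).trans ?_
    rw [div_mul_eq_mul_div, one_mul]
    exact div_le_div_of_nonneg_right
      (Real.rpow_le_rpow_of_nonpos hs hst (by linarith : α - 1 ≤ 0)) hGm.le
  have hGt0 := mlG_pos hα hα1 hl ht
  have e : s * (mlG α l t - mlG α l s)
      = α * (∫ x in s..t, w x) - (t - s) * mlG α l t := by
    rw [← hdiff]; ring
  have hts : 0 ≤ t - s := by linarith
  have h1 : s * |mlG α l t - mlG α l s| ≤ 6 / Real.Gamma α * s ^ (α - 1) * (t - s) := by
    rw [← abs_of_pos hs, ← abs_mul, abs_of_pos hs, e]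
    refine (abs_sub _ _).trans ?_
    rw [abs_mul, abs_of_pos hα, abs_of_nonneg (mul_nonneg hts hGt0.le)]
    have h2 : α * |∫ x in s..t, w x| ≤ 1 * (5 / Real.Gamma α * s ^ (α - 1) * (t - s)) :=
      mul_le_mul hα1.le hI (abs_nonneg _) zero_le_one
    have h3 := mul_le_mul_of_nonneg_left hGt hts
    calc _ ≤ _ := add_le_add h2 h3
      _ = _ := by ring
  have e2 : 6 / Real.Gamma α * ((t - s) / s * s ^ (α - 1))
      = 6 / Real.Gamma α * s ^ (α - 1) * (t - s) / s := by ring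
  rw [e2, le_div_iff₀ hs, mul_comm]
  exact h1

/-! ### Interpolated bounds, uniform in the eigenvalue -/

/-- A constant dominating `1`, `α` and `6 / Γ(α)`. -/
def mlConst (α : ℝ) : ℝ := 1 + 6 / Real.Gamma α

omit hα1 hl in
theorem mlConst_pos : 0 < mlConst α := by
  have := Real.Gamma_pos_of_pos hα
  rw [mlConst]; positivity

/-- Geometric interpolation l^θ g = g^{1-θ} (l g)^θ between g ≤ C t^{α-1} and l g ≤ C t^{-1}. -/
theorem rpow_mul_mlG_le {θ : ℝ} (h0 : 0 ≤ θ) (h1 : θ ≤ 1) (ht : 0 < t) :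
    l ^ θ * mlG α l t ≤ mlConst α * t ^ (α * (1 - θ) - 1) := by
  have hGm : 0 < Real.Gamma α := Real.Gamma_pos_of_pos hα
  have hC := mlConst_pos hα
  have hg := mlG_pos hα hα1 hl ht
  have hb1 : mlG α l t ≤ mlConst α * t ^ (α - 1) := by
    refine (mlG_le_rpow hα hα1 hl ht).trans ?_
    rw [mlConst, div_eq_mul_inv, mul_comm]
    gcongr
    have e6 : 6 / Real.Gamma α = 6 * (Real.Gamma α)⁻¹ := div_eq_mul_inv _ _
    linarith [inv_pos.2 hGm]
  have hb2 : l * mlG α l t ≤ mlConst α * t ^ (-1 : ℝ) := by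
    rw [Real.rpow_neg_one, ← div_eq_mul_inv, le_div_iff₀ ht]
    have := mul_mlG_le hα hα1 hl ht
    have : 1 ≤ mlConst α := by rw [mlConst]; linarith [div_pos (by norm_num : (0:ℝ) < 6) hGm]
    linarith
  have e : l ^ θ * mlG α l t = mlG α l t ^ (1 - θ) * (l * mlG α l t) ^ θ := by
    rw [Real.mul_rpow hl.le hg.le, mul_left_comm, ← Real.rpow_add hg]; simp
  rw [e]
  calc mlG α l t ^ (1 - θ) * (l * mlG α l t) ^ θ
      ≤ (mlConst α * t ^ (α - 1)) ^ (1 - θ) * (mlConst α * t ^ (-1 : ℝ)) ^ θ := by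
        have h1' : 0 ≤ 1 - θ := by linarith
        gcongr
    _ = mlConst α * t ^ (α * (1 - θ) - 1) := by
        rw [Real.mul_rpow hC.le (by positivity), Real.mul_rpow hC.le (by positivity),
          mul_mul_mul_comm, ← Real.rpow_add hC, ← Real.rpow_mul ht.le, ← Real.rpow_mul ht.le,
          ← Real.rpow_add ht]
        ring_nf
        simp [mul_comm]

/-- With x = (t - s)/s: for x ≤ 1 use the Lipschitz type bound and x ≤ x^σ; for x ≥ 1 both values
lie between 0 and s^{α-1}/Γ(α), and x^σ ≥ 1. -/
theorem abs_mlG_sub_le_rpow {s σ : ℝ} (h0 : 0 ≤ σ) (h1 : σ ≤ 1) (hs : 0 < s) (hst : s ≤ t) :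
    |mlG α l t - mlG α l s| ≤ mlConst α * ((t - s) ^ σ * s ^ (α - σ - 1)) := by
  have hGm : 0 < Real.Gamma α := Real.Gamma_pos_of_pos hα
  have hC := mlConst_pos hα
  have ht := hs.trans_le hst
  have hs1 : 0 < s ^ (α - 1) := Real.rpow_pos_of_pos hs _
  have hx : 0 ≤ (t - s) / s := div_nonneg (by linarith) hs.le
  have hCge : 6 / Real.Gamma α ≤ mlConst α := by rw [mlConst]; linarith
  have e : (t - s) ^ σ * s ^ (α - σ - 1) = ((t - s) / s) ^ σ * s ^ (α - 1) := by
    rw [Real.div_rpow (by linarith) hs.le, div_mul_eq_mul_div, mul_div_assoc, ← Real.rpow_sub hs]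
    ring_nf
  rw [e]
  rcases le_total ((t - s) / s) 1 with h | h
  · refine (abs_mlG_sub_le hα hα1 hl hs hst).trans ?_
    gcongr
    rcases hx.eq_or_lt with h2 | h2
    · rw [← h2]; positivity
    · exact Real.self_le_rpow_of_le_one hx h h1
  · have g1 := mlG_pos hα hα1 hl hs
    have g2 := mlG_pos hα hα1 hl ht
    have g3 := mlG_le_rpow hα hα1 hl hs
    have g4 := (mlG_le_rpow hα hα1 hl ht).trans (div_le_div_of_nonneg_right
      (Real.rpow_le_rpow_of_nonpos hs hst (by linarith : α - 1 ≤ 0)) hGm.le)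
    have g5 : |mlG α l t - mlG α l s| ≤ s ^ (α - 1) / Real.Gamma α := by
      rw [abs_le]; constructor <;> linarith
    refine g5.trans ?_
    have h3 : 1 ≤ ((t - s) / s) ^ σ := Real.one_le_rpow h h0
    have h4 : 1 / Real.Gamma α ≤ mlConst α := le_trans (by gcongr; norm_num) hCge
    calc s ^ (α - 1) / Real.Gamma α = 1 / Real.Gamma α * (1 * s ^ (α - 1)) := by ring
      _ ≤ _ := by gcongr

/-- The increment is at most 1, and at most x because it equals l ∫ g with g(τ) ≤ (τ -
s)^{α-1}/Γ(α); finally min(1, x) ≤ x^σ. -/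
theorem abs_mlE_sub_le_rpow {s σ : ℝ} (h0 : 0 ≤ σ) (h1 : σ ≤ 1) (hs : 0 ≤ s) (hst : s ≤ t) :
    |mlE α l t - mlE α l s| ≤ (l * (t - s) ^ α / Real.Gamma (α + 1)) ^ σ := by
  have hGm : 0 < Real.Gamma α := Real.Gamma_pos_of_pos hα
  have hGm1 : 0 < Real.Gamma (α + 1) := Real.Gamma_pos_of_pos (by linarith)
  have ht := hs.trans hst
  have hd := mlE_anti hα hα1 hl hs hst
  rw [abs_sub_comm, abs_of_nonneg (by linarith)]
  set x := l * (t - s) ^ α / Real.Gamma (α + 1) with hx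
  have hx0 : 0 ≤ x := by
    have : 0 ≤ (t - s) ^ α := Real.rpow_nonneg (by linarith) _
    positivity
  have hle1 : mlE α l s - mlE α l t ≤ 1 := by
    linarith [mlE_le_one hα hα1 hl hs, mlE_pos hα hα1 hl ht]
  have hlex : mlE α l s - mlE α l t ≤ x := by
    rw [mlE_sub hα hα1 hl hs hst, hx, mul_div_assoc]
    refine mul_le_mul_of_nonneg_left ?_ hl.le
    have hi : IntervalIntegrable (fun τ : ℝ => (τ - s) ^ (α - 1) / Real.Gamma α) volume s t := by
      have := (intervalIntegral.intervalIntegrable_rpow' (a := 0) (b := t - s)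
        (by linarith : -1 < α - 1)).comp_sub_right s
      simpa using this.div_const (Real.Gamma α)
    calc ∫ τ in s..t, mlG α l τ ≤ ∫ τ in s..t, (τ - s) ^ (α - 1) / Real.Gamma α := by
          refine intervalIntegral.integral_mono_on_of_le_Ioo hst
            (intervalIntegrable_mlG hα hα1 hl s t) hi fun τ hτ => ?_
          refine (mlG_le_rpow hα hα1 hl (hs.trans_lt hτ.1)).trans ?_
          gcongr ?_ / _
          exact Real.rpow_le_rpow_of_nonpos (by linarith [hτ.1]) (by linarith) (by linarith)
      _ = (t - s) ^ α / Real.Gamma (α + 1) := by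
          rw [intervalIntegral.integral_div,
            intervalIntegral.integral_comp_sub_right (fun x => x ^ (α - 1)) s,
            integral_rpow (Or.inl (by linarith)), Real.Gamma_add_one hα.ne']
          simp only [sub_self, sub_add_cancel, Real.zero_rpow hα.ne', div_div, sub_zero]
  rcases le_total x 1 with h | h
  · refine hlex.trans ?_
    rcases hx0.eq_or_lt with h2 | h2
    · rw [← h2]; positivity
    · exact Real.self_le_rpow_of_le_one hx0 h h1
  · exact hle1.trans (Real.one_le_rpow h h0)

/-- Prescribing the value at T instead of at 0 costs one full power of l. The lower bound l₀ of the
spectrum absorbs the constant term. -/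
theorem inv_mlE_le {l₀ T : ℝ} (hl₀ : 0 < l₀) (hll : l₀ ≤ l) (hT : 0 < T) :
    (mlE α l T)⁻¹ ≤ (1 / l₀ + Real.Gamma (1 - α) * T ^ α) * l := by
  have hE := mlE_pos hα hα1 hl hT.le
  have h := one_le_mlE_mul hα hα1 hl hT
  rw [inv_le_iff_one_le_mul₀' hE]
  refine h.trans ?_
  gcongr
  have : 1 ≤ 1 / l₀ * l := by rw [one_div, inv_mul_eq_div, le_div_iff₀ hl₀]; linarith
  linarith

theorem mlE_le_rpow {θ : ℝ} (h0 : 0 ≤ θ) (h1 : θ ≤ 1) (ht : 0 < t) :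
    mlE α l t ≤ Real.Gamma (α + 1) ^ θ * (l ^ (-θ) * t ^ (-(α * θ))) := by
  have hGm1 : 0 < Real.Gamma (α + 1) := Real.Gamma_pos_of_pos (by linarith)
  have hE := mlE_pos hα hα1 hl ht.le
  have h := mlE_mul_le_one hα hα1 hl ht
  set x := l * t ^ α / Real.Gamma (α + 1) with hx
  have hx0 : 0 < x := by positivity
  have h2 : x ^ θ ≤ 1 + x := by
    calc x ^ θ ≤ (1 + x) ^ θ := Real.rpow_le_rpow hx0.le (by linarith) h0
      _ ≤ (1 + x) ^ (1 : ℝ) := Real.rpow_le_rpow_of_exponent_le (by linarith) h1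
      _ = 1 + x := Real.rpow_one _
  have h3 : mlE α l t * x ^ θ ≤ 1 := (mul_le_mul_of_nonneg_left h2 hE.le).trans h
  have e : Real.Gamma (α + 1) ^ θ * (l ^ (-θ) * t ^ (-(α * θ))) = (x ^ θ)⁻¹ := by
    rw [hx, Real.div_rpow (by positivity) hGm1.le, Real.mul_rpow hl.le (by positivity),
      ← Real.rpow_mul ht.le, Real.rpow_neg hl.le, Real.rpow_neg ht.le]
    field_simp
  rw [e, ← one_div, le_div_iff₀ (Real.rpow_pos_of_pos hx0 _)]
  exact h3

end Bounds

/-! ### Square summable coefficients -/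

/-- The sequence `a` has `ℓ²` norm at most `M`. -/
def L2Bdd (a : ℕ → ℝ) (M : ℝ) : Prop := 0 ≤ M ∧ ∀ s : Finset ℕ, ∑ j ∈ s, a j ^ 2 ≤ M ^ 2

theorem L2Bdd.of_abs_le {a b : ℕ → ℝ} {M C : ℝ} (h : L2Bdd b M) (hC : 0 ≤ C)
    (hab : ∀ j, |a j| ≤ C * |b j|) : L2Bdd a (C * M) := by
  refine ⟨mul_nonneg hC h.1, fun s => ?_⟩
  calc ∑ j ∈ s, a j ^ 2 ≤ ∑ j ∈ s, C ^ 2 * b j ^ 2 := by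
        refine Finset.sum_le_sum fun j _ => ?_
        rw [← sq_abs, ← sq_abs (b j), ← mul_pow]
        exact pow_le_pow_left₀ (abs_nonneg _) (hab j) 2
    _ = C ^ 2 * ∑ j ∈ s, b j ^ 2 := (Finset.mul_sum _ _ _).symm
    _ ≤ C ^ 2 * M ^ 2 := mul_le_mul_of_nonneg_left (h.2 s) (sq_nonneg C)
    _ = (C * M) ^ 2 := (mul_pow _ _ _).symm

theorem L2Bdd.mono {a : ℕ → ℝ} {M N : ℝ} (h : L2Bdd a M) (hMN : M ≤ N) : L2Bdd a N :=
  ⟨h.1.trans hMN, fun s => (h.2 s).trans (pow_le_pow_left₀ h.1 hMN 2)⟩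

theorem L2Bdd.summable {a : ℕ → ℝ} {M : ℝ} (h : L2Bdd a M) : Summable fun j => a j ^ 2 :=
  summable_of_sum_le (fun _ => sq_nonneg _) h.2

section Hilbert

variable {H : Type*} [NormedAddCommGroup H] [InnerProductSpace ℝ H]
  (e : HilbertBasis ℕ ℝ H) {a b : ℕ → ℝ} {M N : ℝ}

theorem inner_of_hasSum {y : H} (h : HasSum (fun j => a j • e j) y) (i : ℕ) :
    ⟪e i, y⟫_ℝ = a i := by
  have h1 : HasSum (fun j => ⟪e i, a j • e j⟫_ℝ) ⟪e i, y⟫_ℝ := h.mapL (innerSL ℝ (e i))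
  have h2 : HasSum (fun j => ⟪e i, a j • e j⟫_ℝ) ⟪e i, a i • e i⟫_ℝ :=
    hasSum_single i fun j hj => by
      rw [inner_smul_right, e.orthonormal.2 hj.symm, mul_zero]
  rw [h1.unique h2, inner_smul_right, real_inner_self_eq_norm_sq, e.orthonormal.1 i]
  simp

theorem hasSum_sq_coords (y : H) : HasSum (fun j => ⟪e j, y⟫_ℝ ^ 2) (‖y‖ ^ 2) := by
  have h := e.hasSum_inner_mul_inner y y
  rw [real_inner_self_eq_norm_sq] at h
  refine h.congr_fun fun j => ?_
  rw [real_inner_comm, sq]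

theorem L2Bdd.norm_le {y : H} (h : L2Bdd a M) (hy : ∀ j, ⟪e j, y⟫_ℝ = a j) : ‖y‖ ≤ M := by
  refine (pow_le_pow_iff_left₀ (norm_nonneg _) h.1 two_ne_zero).1 ?_
  exact hasSum_le_of_sum_le (hasSum_sq_coords e y) fun s => by simpa [hy] using h.2 s

theorem L2Bdd.exists_hasSum (h : L2Bdd a M) :
    ∃ y : H, HasSum (fun j => a j • e j) y ∧ (∀ j, ⟪e j, y⟫_ℝ = a j) ∧ ‖y‖ ≤ M := by
  have hm : Memℓp a 2 := by
    refine memℓp_gen ?_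
    simpa using h.summable
  have hs : HasSum (fun j => a j • e j) (e.repr.symm ⟨a, hm⟩) := e.hasSum_repr_symm ⟨a, hm⟩
  exact ⟨_, hs, inner_of_hasSum e hs, h.norm_le e (inner_of_hasSum e hs)⟩

theorem l2Bdd_coords (y : H) : L2Bdd (fun j => ⟪e j, y⟫_ℝ) ‖y‖ :=
  ⟨norm_nonneg _, fun s => sum_le_hasSum s (fun _ _ => sq_nonneg _) (hasSum_sq_coords e y)⟩

-- The triangle inequality of ℓ², read off from H by realizing both sequences as coordinates.
include e in
theorem L2Bdd.add (ha : L2Bdd a M) (hb : L2Bdd b N) : L2Bdd (fun j => a j + b j) (M + N) := by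
  obtain ⟨y, -, hy, hyn⟩ := ha.exists_hasSum e
  obtain ⟨z, -, hz, hzn⟩ := hb.exists_hasSum e
  have := (l2Bdd_coords e (y + z)).mono ((norm_add_le y z).trans (add_le_add hyn hzn))
  simpa only [inner_add_right, hy, hz] using this

/-- Minkowski's integral inequality for the coefficients of diagonal integral operators. -/
theorem l2Bdd_integral {F : ℝ → H} {s t C : ℝ} {K : ℝ → ℝ} {k : ℕ → ℝ → ℝ} (hst : s ≤ t)
    (hF : AEStronglyMeasurable F (volume.restrict (Ioo s t))) (hM : 0 ≤ M) (hC : 0 ≤ C)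
    (hKm : AEStronglyMeasurable K (volume.restrict (Ioo s t))) (hK0 : ∀ τ ∈ Ioo s t, 0 ≤ K τ)
    (hK : ∫⁻ τ in Ioo s t, ‖F τ‖ₑ * ENNReal.ofReal (K τ) ≤ ENNReal.ofReal M)
    (hkm : ∀ j, AEStronglyMeasurable (k j) (volume.restrict (Ioo s t)))
    (hk : ∀ j, ∀ τ ∈ Ioo s t, |k j τ| ≤ C * K τ) :
    (∀ j, IntervalIntegrable (fun τ => ⟪F τ, e j⟫_ℝ * k j τ) volume s t) ∧
    L2Bdd (fun j => ∫ τ in s..t, ⟪F τ, e j⟫_ℝ * k j τ) (C * M) := by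
  have henn : ∀ τ ∈ Ioo s t, ‖‖F τ‖ * K τ‖ₑ = ‖F τ‖ₑ * ENNReal.ofReal (K τ) := by
    intro τ hτ
    rw [enorm_mul, enorm_norm, Real.enorm_of_nonneg (hK0 τ hτ)]
  have hgi : IntegrableOn (fun τ => ‖F τ‖ * K τ) (Ioo s t) := by
    refine ⟨hF.norm.mul hKm, ?_⟩
    rw [HasFiniteIntegral, setLIntegral_congr_fun measurableSet_Ioo henn]
    exact hK.trans_lt ENNReal.ofReal_lt_top
  have hgM : ∫ τ in Ioo s t, ‖F τ‖ * K τ ≤ M := by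
    rw [integral_eq_lintegral_of_nonneg_ae
      ((ae_restrict_iff' measurableSet_Ioo).2 (ae_of_all _ fun τ hτ =>
        mul_nonneg (norm_nonneg _) (hK0 τ hτ))) hgi.1]
    refine ENNReal.toReal_le_of_le_ofReal hM (le_trans (le_of_eq ?_) hK)
    refine setLIntegral_congr_fun measurableSet_Ioo fun τ hτ => ?_
    rw [ENNReal.ofReal_mul (norm_nonneg _), ofReal_norm]
  have hb : ∀ j, ∀ τ ∈ Ioo s t, ‖⟪F τ, e j⟫_ℝ * k j τ‖ ≤ C * (‖F τ‖ * K τ) := by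
    intro j τ hτ
    have h1 := abs_real_inner_le_norm (F τ) (e j)
    rw [e.orthonormal.1 j, mul_one] at h1
    rw [Real.norm_eq_abs, abs_mul]
    calc _ ≤ ‖F τ‖ * (C * K τ) := mul_le_mul h1 (hk j τ hτ) (abs_nonneg _) (norm_nonneg _)
      _ = _ := by ring
  have hint : ∀ j, IntegrableOn (fun τ => ⟪F τ, e j⟫_ℝ * k j τ) (Ioo s t) := by
    intro j
    refine Integrable.mono' (hgi.const_mul C)
      ((hF.inner aestronglyMeasurable_const).mul (hkm j)) ?_
    exact (ae_restrict_iff' measurableSet_Ioo).2 (ae_of_all _ (hb j))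
  refine ⟨fun j => (intervalIntegrable_iff_integrableOn_Ioo_of_le hst).2 (hint j),
    mul_nonneg hC hM, fun u => ?_⟩
  have heq : ∀ j, ∫ τ in s..t, ⟪F τ, e j⟫_ℝ * k j τ = ∫ τ in Ioo s t, ⟪F τ, e j⟫_ℝ * k j τ :=
    fun j => by rw [intervalIntegral.integral_of_le hst, integral_Ioc_eq_integral_Ioo]
  simp only [heq]
  set a : ℕ → ℝ := fun j => ∫ τ in Ioo s t, ⟪F τ, e j⟫_ℝ * k j τ with ha
  -- Duality: pairing the finite vector of integrals with itself moves the sum under the integral,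
  -- where Cauchy–Schwarz and Bessel give A ≤ √A · C M; then √A is cancelled.
  set A := ∑ j ∈ u, a j ^ 2 with hA
  have hA0 : 0 ≤ A := Finset.sum_nonneg fun _ _ => sq_nonneg _
  have h1 : A = ∫ τ in Ioo s t, ∑ j ∈ u, a j * (⟪F τ, e j⟫_ℝ * k j τ) := by
    rw [integral_finsetSum _ fun j _ => (hint j).const_mul (a j)]
    refine Finset.sum_congr rfl fun j _ => ?_
    rw [integral_const_mul, sq]
  have h2 : A ≤ √A * (C * M) := by
    calc A = _ := h1
      _ ≤ ∫ τ in Ioo s t, (√A * C) * (‖F τ‖ * K τ) := by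
        refine setIntegral_mono_on
          (integrable_finsetSum _ fun j _ => (hint j).const_mul (a j)) (hgi.const_mul _)
          measurableSet_Ioo fun τ hτ => ?_
        have hCK : 0 ≤ C * K τ := mul_nonneg hC (hK0 τ hτ)
        have c1 := Finset.sum_mul_sq_le_sq_mul_sq u (fun j => a j * k j τ) (fun j => ⟪F τ, e j⟫_ℝ)
        have c2 : ∑ j ∈ u, (a j * k j τ) ^ 2 ≤ A * (C * K τ) ^ 2 := by
          rw [hA, Finset.sum_mul]
          refine Finset.sum_le_sum fun j _ => ?_
          rw [mul_pow]
          refine mul_le_mul_of_nonneg_left ?_ (sq_nonneg _)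
          rw [← sq_abs]
          exact pow_le_pow_left₀ (abs_nonneg _) (hk j τ hτ) 2
        have c3 : ∑ j ∈ u, ⟪F τ, e j⟫_ℝ ^ 2 ≤ ‖F τ‖ ^ 2 := by
          simpa only [real_inner_comm] using (l2Bdd_coords e (F τ)).2 u
        have c4 : (∑ j ∈ u, a j * k j τ * ⟪F τ, e j⟫_ℝ) ^ 2
            ≤ (√A * C * (‖F τ‖ * K τ)) ^ 2 := by
          calc _ ≤ _ := c1
            _ ≤ (A * (C * K τ) ^ 2) * ‖F τ‖ ^ 2 :=
              mul_le_mul c2 c3 (Finset.sum_nonneg fun _ _ => sq_nonneg _) (by positivity)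
            _ = (√A * C * (‖F τ‖ * K τ)) ^ 2 := by
              simp only [mul_pow, Real.sq_sqrt hA0]; ring
        calc ∑ j ∈ u, a j * (⟪F τ, e j⟫_ℝ * k j τ) = ∑ j ∈ u, a j * k j τ * ⟪F τ, e j⟫_ℝ :=
              Finset.sum_congr rfl fun j _ => by ring
          _ ≤ _ := (abs_le.1 (abs_le_of_sq_le_sq c4 (by
              have := hK0 τ hτ
              positivity))).2
      _ = (√A * C) * ∫ τ in Ioo s t, ‖F τ‖ * K τ := integral_const_mul _ _
      _ ≤ (√A * C) * M := mul_le_mul_of_nonneg_left hgM (by positivity)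
      _ = _ := by ring
  rcases hA0.eq_or_lt with h3 | h3
  · rw [← h3]; positivity
  · have h4 : 0 < √A := Real.sqrt_pos.2 h3
    have h5 : √A ≤ C * M := by
      refine le_of_mul_le_mul_left ?_ h4
      rwa [Real.mul_self_sqrt hA0]
    calc A = √A ^ 2 := (Real.sq_sqrt hA0).symm
      _ ≤ (C * M) ^ 2 := pow_le_pow_left₀ h4.le h5 2

end Hilbert

/-! ### The weighted time integrability class -/

section XBound

variable {H : Type*} [NormedAddCommGroup H]

/-- The function `F` belongs to `𝒳_{2,η}`, and `M` bounds the defining integral at every `t`. -/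
def XBound (T η : ℝ) (F : ℝ → H) (M : ℝ) : Prop :=
  0 ≤ M ∧ AEStronglyMeasurable F (volume.restrict (Ioo 0 T)) ∧
  ∀ t ∈ Icc 0 T, ∫⁻ τ in Ioo 0 t, ‖F τ‖ₑ * ENNReal.ofReal ((t - τ) ^ (η - 1)) ≤ ENNReal.ofReal M

/-- By Fatou's lemma the essential supremum bounds the defining integral at every time. -/
theorem lintegral_le_normX {T η : ℝ} {F : ℝ → H}
    (hF : AEStronglyMeasurable F (volume.restrict (Ioo 0 T))) {t : ℝ} (ht : t ∈ Icc 0 T) :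
    ∫⁻ τ in Ioo 0 t, ‖F τ‖ₑ * ENNReal.ofReal ((t - τ) ^ (η - 1)) ≤ normX T η F := by
  rcases ht.1.eq_or_lt with rfl | ht0
  · simp
  have hae := ae_le_essSup (μ := volume.restrict (Icc 0 T))
    (f := fun t => ∫⁻ τ in Ioo 0 t, ‖F τ‖ₑ * ENNReal.ofReal ((t - τ) ^ (η - 1)))
  rw [ae_restrict_iff' measurableSet_Icc] at hae
  -- Every interval to the left of t has positive measure, so the essential bound holds at some
  -- point of it. Approaching from the left keeps the domain (0, s n) inside (0, t).
  have hex : ∀ n : ℕ, ∃ s ∈ Ioo (t - t / (n + 1)) t,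
      ∫⁻ τ in Ioo 0 s, ‖F τ‖ₑ * ENNReal.ofReal ((s - τ) ^ (η - 1)) ≤ normX T η F := by
    intro n
    have hlt : t - t / (n + 1) < t := by
      have : 0 < t / ((n : ℝ) + 1) := by positivity
      linarith
    have hge : 0 ≤ t - t / (n + 1) := by
      rw [sub_nonneg, div_le_iff₀ (by positivity)]
      nlinarith [Nat.cast_nonneg (α := ℝ) n]
    by_contra hcon
    push Not at hcon
    have hsub : Ioo (t - t / (n + 1)) t ⊆ {s | ¬ (s ∈ Icc 0 T →
        ∫⁻ τ in Ioo 0 s, ‖F τ‖ₑ * ENNReal.ofReal ((s - τ) ^ (η - 1)) ≤ normX T η F)} := by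
      intro s hs hbad
      exact absurd (hbad ⟨hge.trans hs.1.le, hs.2.le.trans ht.2⟩) (not_le.2 (hcon s hs))
    have h0 := measure_mono_null hsub hae
    rw [Real.volume_Ioo, ENNReal.ofReal_eq_zero] at h0
    linarith
  choose s hs hsN using hex
  have hlim : Tendsto s atTop (𝓝 t) := by
    refine tendsto_of_tendsto_of_tendsto_of_le_of_le (g := fun n : ℕ => t - t / (n + 1)) ?_
      tendsto_const_nhds (fun n => (hs n).1.le) (fun n => (hs n).2.le)
    have h1 : Tendsto (fun n : ℕ => t * (1 / ((n : ℝ) + 1))) atTop (𝓝 (t * 0)) :=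
      tendsto_one_div_add_atTop_nhds_zero_nat.const_mul t
    have h2 := h1.const_sub t
    simpa [div_eq_mul_inv] using h2
  have hFt : AEStronglyMeasurable F (volume.restrict (Ioo 0 t)) :=
    hF.mono_measure (Measure.restrict_mono (Ioo_subset_Ioo_right ht.2) le_rfl)
  let f : ℕ → ℝ → ℝ≥0∞ := fun n =>
    (Iio (s n)).indicator fun τ => ‖F τ‖ₑ * ENNReal.ofReal ((s n - τ) ^ (η - 1))
  have hfm : ∀ n, AEMeasurable (f n) (volume.restrict (Ioo 0 t)) := by
    intro n
    refine AEMeasurable.indicator ?_ measurableSet_Iio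
    exact hFt.enorm.mul (by fun_prop)
  calc ∫⁻ τ in Ioo 0 t, ‖F τ‖ₑ * ENNReal.ofReal ((t - τ) ^ (η - 1))
      ≤ ∫⁻ τ in Ioo 0 t, liminf (fun n => f n τ) atTop := by
        refine setLIntegral_mono' measurableSet_Ioo fun τ hτ => le_of_eq ?_
        have h1 : Tendsto (fun n => ‖F τ‖ₑ * ENNReal.ofReal ((s n - τ) ^ (η - 1))) atTop
            (𝓝 (‖F τ‖ₑ * ENNReal.ofReal ((t - τ) ^ (η - 1)))) := by
          refine ENNReal.Tendsto.const_mul ?_ (Or.inr enorm_ne_top)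
          refine ENNReal.tendsto_ofReal ?_
          exact (hlim.sub_const τ).rpow_const (Or.inl (by linarith [hτ.2]))
        have h2 : Tendsto (fun n => f n τ) atTop
            (𝓝 (‖F τ‖ₑ * ENNReal.ofReal ((t - τ) ^ (η - 1)))) := by
          refine h1.congr' ?_
          filter_upwards [hlim.eventually (lt_mem_nhds hτ.2)] with n hn
          change _ = (Iio (s n)).indicator _ τ
          rw [indicator_of_mem (mem_Iio.2 hn)]
        exact h2.liminf_eq.symm
    _ ≤ liminf (fun n => ∫⁻ τ in Ioo 0 t, f n τ) atTop := lintegral_liminf_le' hfm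
    _ ≤ normX T η F := by
        have : ∀ n, ∫⁻ τ in Ioo 0 t, f n τ ≤ normX T η F := by
          intro n
          refine le_trans (le_of_eq ?_) (hsN n)
          rw [setLIntegral_indicator measurableSet_Iio]
          congr 2
          ext τ
          simp only [mem_inter_iff, mem_Iio, mem_Ioo]
          have := (hs n).2
          constructor
          · rintro ⟨h1, h2, -⟩; exact ⟨h2, h1⟩
          · rintro ⟨h1, h2⟩; exact ⟨h2, h1, h2.trans this⟩
        refine (liminf_le_liminf (Eventually.of_forall this)).trans ?_
        simp

theorem MemX.xBound {T η : ℝ} {F : ℝ → H} (hF : MemX T η F) :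
    XBound T η F (normX T η F).toReal := by
  refine ⟨ENNReal.toReal_nonneg, hF.1, fun t ht => ?_⟩
  rw [ENNReal.ofReal_toReal hF.2.ne]
  exact lintegral_le_normX hF.1 ht

theorem XBound.mono_exponent {T η η' M : ℝ} {F : ℝ → H} (h : XBound T η F M) (hT : 0 < T)
    (hη : η ≤ η') : XBound T η' F (T ^ (η' - η) * M) := by
  have hTp : 0 < T ^ (η' - η) := Real.rpow_pos_of_pos hT _
  refine ⟨mul_nonneg hTp.le h.1, h.2.1, fun t ht => ?_⟩
  rw [ENNReal.ofReal_mul hTp.le]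
  calc ∫⁻ τ in Ioo 0 t, ‖F τ‖ₑ * ENNReal.ofReal ((t - τ) ^ (η' - 1))
      ≤ ∫⁻ τ in Ioo 0 t, ENNReal.ofReal (T ^ (η' - η))
          * (‖F τ‖ₑ * ENNReal.ofReal ((t - τ) ^ (η - 1))) := by
        refine setLIntegral_mono' measurableSet_Ioo fun τ hτ => ?_
        have hpos : 0 < t - τ := by linarith [hτ.2]
        rw [mul_left_comm, ← ENNReal.ofReal_mul hTp.le]
        gcongr
        have e : (t - τ) ^ (η' - 1) = (t - τ) ^ (η' - η) * (t - τ) ^ (η - 1) := by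
          rw [← Real.rpow_add hpos]; ring_nf
        rw [e]
        gcongr
        linarith [hτ.1, ht.2]
    _ = ENNReal.ofReal (T ^ (η' - η)) *
          ∫⁻ τ in Ioo 0 t, ‖F τ‖ₑ * ENNReal.ofReal ((t - τ) ^ (η - 1)) :=
        lintegral_const_mul' _ _ ENNReal.ofReal_ne_top
    _ ≤ _ := by gcongr; exact h.2.2 t ht

end XBound

/-! ### Spectral coefficients of the solution -/

theorem continuousOn_of_norm_sub_le_rpow {E : Type*} [NormedAddCommGroup E] {f : ℝ → E}
    {S : Set ℝ} {K σ : ℝ} (hσ : 0 < σ)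
    (h : ∀ s ∈ S, ∀ t ∈ S, s ≤ t → ‖f t - f s‖ ≤ K * (t - s) ^ σ) :
    ContinuousOn f S := by
  intro s hs
  rw [ContinuousWithinAt, tendsto_iff_norm_sub_tendsto_zero]
  have hlim : Tendsto (fun t : ℝ => K * |t - s| ^ σ) (𝓝[S] s) (𝓝 0) := by
    have : Continuous fun t : ℝ => K * |t - s| ^ σ :=
      continuous_const.mul ((Real.continuous_rpow_const hσ.le).comp (by fun_prop))
    have h2 := this.tendsto s
    simp only [sub_self, abs_zero, Real.zero_rpow hσ.ne', mul_zero] at h2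
    exact h2.mono_left nhdsWithin_le_nhds
  refine squeeze_zero' (Eventually.of_forall fun _ => norm_nonneg _) ?_ hlim
  filter_upwards [self_mem_nhdsWithin] with t ht
  rcases le_total s t with hst | hst
  · rw [abs_of_nonneg (by linarith)]
    exact h s hs t ht hst
  · rw [norm_sub_rev, abs_sub_comm, abs_of_nonneg (by linarith)]
    exact h t ht s hs hst

/-- Powers of numbers bounded below are comparable with powers of larger exponent. -/
theorem rpow_le_rpow_sub_mul {l l₀ x y : ℝ} (hl₀ : 0 < l₀) (hl : l₀ ≤ l) (hxy : x ≤ y) :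
    l ^ x ≤ l₀ ^ (x - y) * l ^ y := by
  have hl' : 0 < l := hl₀.trans_le hl
  calc l ^ x = l ^ (x - y) * l ^ y := by rw [← Real.rpow_add hl']; ring_nf
    _ ≤ _ := mul_le_mul_of_nonneg_right
      (Real.rpow_le_rpow_of_nonpos hl₀ hl (by linarith)) (Real.rpow_nonneg hl'.le _)

section Coefficients

variable {H : Type*} [NormedAddCommGroup H] [InnerProductSpace ℝ H]
  (e : HilbertBasis ℕ ℝ H) {α T η l₀ : ℝ} {l : ℕ → ℝ}

/-- The coefficients of the convolution of `F` with the resolvent family. -/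
def convCoeff (α : ℝ) (l : ℕ → ℝ) (F : ℝ → H) (j : ℕ) (t : ℝ) : ℝ :=
  ∫ τ in (0 : ℝ)..t, ⟪F τ, e j⟫_ℝ * mlG α (l j) (t - τ)

/-- The quotient of relaxation functions `E_{α,1}(-l_j t^α) / E_{α,1}(-l_j T^α)`. -/
def relaxRatio (α T : ℝ) (l : ℕ → ℝ) (j : ℕ) (t : ℝ) : ℝ := mlE α (l j) t / mlE α (l j) T

theorem exists_hasSum_family {a : ℕ → ℝ → ℝ} {S : Set ℝ} {B : ℝ → ℝ}
    (h : ∀ t ∈ S, L2Bdd (fun j => a j t) (B t)) :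
    ∃ y : ℝ → H, ∀ t ∈ S, HasSum (fun j => a j t • e j) (y t) ∧
      (∀ j, ⟪e j, y t⟫_ℝ = a j t) ∧ ‖y t‖ ≤ B t := by
  have : ∀ t, ∃ y : H, t ∈ S → HasSum (fun j => a j t • e j) y ∧
      (∀ j, ⟪e j, y⟫_ℝ = a j t) ∧ ‖y‖ ≤ B t := by
    intro t
    by_cases ht : t ∈ S
    · obtain ⟨y, hy⟩ := (h t ht).exists_hasSum e
      exact ⟨y, fun _ => hy⟩
    · exact ⟨0, fun h => absurd h ht⟩
  choose y hy using this
  exact ⟨y, hy⟩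

theorem aestronglyMeasurable_mlG_comp_sub (hα : 0 < α) (hα1 : α < 1) {l : ℝ} (hl : 0 < l)
    (s t r : ℝ) :
    AEStronglyMeasurable (fun τ => mlG α l (r - τ)) (volume.restrict (Ioo s t)) := by
  rcases le_total s t with h | h
  · exact ((intervalIntegrable_iff_integrableOn_Ioo_of_le h).1
      (intervalIntegrable_mlG_comp_sub hα hα1 hl s t)).aestronglyMeasurable
  · rw [Ioo_eq_empty (not_lt.2 h)]; simp

theorem measurable_sub_rpow (t r : ℝ) : Measurable fun τ : ℝ => (t - τ) ^ r := by fun_prop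

variable (hα : 0 < α) (hα1 : α < 1) (hT : 0 < T) (hl₀ : 0 < l₀) (hl : ∀ j, l₀ ≤ l j)
include hα hα1 hT hl₀ hl

/-- The interpolated kernel bound has exponent α(1-θ) - 1 ≥ η - 1, so it is dominated by the weight
of 𝒳_{2,η} times a power of T. -/
theorem l2Bdd_convCoeff {F : ℝ → H} {M θ t : ℝ} (hF : XBound T η F M) (h0 : 0 ≤ θ) (h1 : θ ≤ 1)
    (hη : η ≤ α * (1 - θ)) (ht : t ∈ Icc 0 T) :
    L2Bdd (fun j => l j ^ θ * convCoeff e α l F j t)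
      (mlConst α * T ^ (α * (1 - θ) - η) * M) := by
  have hlp : ∀ j, 0 < l j := fun j => hl₀.trans_le (hl j)
  have hC := mlConst_pos hα
  have hTp : 0 < T ^ (α * (1 - θ) - η) := Real.rpow_pos_of_pos hT _
  have h := (l2Bdd_integral e (F := F) (K := fun τ => (t - τ) ^ (η - 1))
    (k := fun j τ => l j ^ θ * mlG α (l j) (t - τ)) (C := mlConst α * T ^ (α * (1 - θ) - η)) ht.1
    (hF.2.1.mono_measure (Measure.restrict_mono (Ioo_subset_Ioo_right ht.2) le_rfl)) hF.1
    (by positivity) (measurable_sub_rpow t (η - 1)).aestronglyMeasurable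
    (fun τ hτ => Real.rpow_nonneg (by linarith [hτ.2]) _) (hF.2.2 t ht)
    (fun j => (aestronglyMeasurable_mlG_comp_sub hα hα1 (hlp j) 0 t t).const_mul _) ?_).2
  · convert h using 2 with j
    rw [convCoeff, ← intervalIntegral.integral_const_mul]
    refine intervalIntegral.integral_congr fun τ _ => ?_
    ring
  · intro j τ hτ
    have hpos : 0 < t - τ := by linarith [hτ.2]
    have hg := mlG_pos hα hα1 (hlp j) hpos
    have hlθ : 0 < l j ^ θ := Real.rpow_pos_of_pos (hlp j) _
    rw [abs_of_pos (mul_pos hlθ hg)]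
    refine (rpow_mul_mlG_le hα hα1 (hlp j) h0 h1 hpos).trans ?_
    rw [mul_assoc]
    refine mul_le_mul_of_nonneg_left ?_ hC.le
    have e1 : (t - τ) ^ (α * (1 - θ) - 1) = (t - τ) ^ (α * (1 - θ) - η) * (t - τ) ^ (η - 1) := by
      rw [← Real.rpow_add hpos]; ring_nf
    rw [e1]
    gcongr
    linarith [hτ.1, ht.2]

/-- The increment is the integral over (s, t) plus the integral over (0, s) against the difference
of kernels. Taking σ = α - η makes the second kernel (t - s)^{α-η} times the weight (s - τ)^{η-1}.
-/
theorem l2Bdd_convCoeff_sub {F : ℝ → H} {M s t : ℝ} (hF : XBound T η F M) (hη0 : 0 ≤ η)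
    (hη : η ≤ α) (hs : s ∈ Icc 0 T) (ht : t ∈ Icc 0 T) (hst : s ≤ t) :
    L2Bdd (fun j => convCoeff e α l F j t - convCoeff e α l F j s)
      (2 * mlConst α * (t - s) ^ (α - η) * M) := by
  have hlp : ∀ j, 0 < l j := fun j => hl₀.trans_le (hl j)
  have hC := mlConst_pos hα
  have hp : 0 ≤ (t - s) ^ (α - η) := Real.rpow_nonneg (by linarith) _
  have hle1 : ∫⁻ τ in Ioo s t, ‖F τ‖ₑ * ENNReal.ofReal ((t - τ) ^ (η - 1)) ≤ ENNReal.ofReal M :=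
    (lintegral_mono_set (Ioo_subset_Ioo_left hs.1)).trans (hF.2.2 t ht)
  have A := l2Bdd_integral e (F := F) (K := fun τ => (t - τ) ^ (η - 1))
    (k := fun j τ => mlG α (l j) (t - τ)) (C := mlConst α * (t - s) ^ (α - η)) hst
    (hF.2.1.mono_measure (Measure.restrict_mono (Ioo_subset_Ioo hs.1 ht.2) le_rfl)) hF.1
    (by positivity) (measurable_sub_rpow t (η - 1)).aestronglyMeasurable
    (fun τ hτ => Real.rpow_nonneg (by linarith [hτ.2]) _) hle1
    (fun j => aestronglyMeasurable_mlG_comp_sub hα hα1 (hlp j) s t t) (by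
      intro j τ hτ
      have hpos : 0 < t - τ := by linarith [hτ.2]
      rw [abs_of_pos (mlG_pos hα hα1 (hlp j) hpos), mul_assoc]
      have h1 := rpow_mul_mlG_le hα hα1 (hlp j) le_rfl zero_le_one hpos
      simp only [Real.rpow_zero, one_mul, sub_zero, mul_one] at h1
      refine h1.trans (mul_le_mul_of_nonneg_left ?_ hC.le)
      have e1 : (t - τ) ^ (α - 1) = (t - τ) ^ (α - η) * (t - τ) ^ (η - 1) := by
        rw [← Real.rpow_add hpos]; ring_nf
      rw [e1]
      gcongr
      linarith [hτ.1])
  have B := l2Bdd_integral e (F := F) (K := fun τ => (s - τ) ^ (η - 1))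
    (k := fun j τ => mlG α (l j) (t - τ) - mlG α (l j) (s - τ))
    (C := mlConst α * (t - s) ^ (α - η)) hs.1
    (hF.2.1.mono_measure (Measure.restrict_mono (Ioo_subset_Ioo_right hs.2) le_rfl)) hF.1
    (by positivity) (measurable_sub_rpow s (η - 1)).aestronglyMeasurable
    (fun τ hτ => Real.rpow_nonneg (by linarith [hτ.2]) _) (hF.2.2 s hs)
    (fun j => (aestronglyMeasurable_mlG_comp_sub hα hα1 (hlp j) 0 s t).sub
      (aestronglyMeasurable_mlG_comp_sub hα hα1 (hlp j) 0 s s)) (by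
      intro j τ hτ
      have h1 := abs_mlG_sub_le_rpow hα hα1 (hlp j) (s := s - τ) (t := t - τ) (σ := α - η)
        (by linarith) (by linarith) (by linarith [hτ.2]) (by linarith)
      have e1 : t - τ - (s - τ) = t - s := by ring
      have e2 : α - (α - η) - 1 = η - 1 := by ring
      rw [e1, e2, ← mul_assoc] at h1
      exact h1)
  -- Only the integrability in D is used, to split the integral of the kernel difference.
  have D := l2Bdd_integral e (F := F) (K := fun τ => (s - τ) ^ (η - 1))
    (k := fun j τ => mlG α (l j) (s - τ))
    (C := mlConst α * T ^ (α - η)) hs.1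
    (hF.2.1.mono_measure (Measure.restrict_mono (Ioo_subset_Ioo_right hs.2) le_rfl)) hF.1
    (by positivity) (measurable_sub_rpow s (η - 1)).aestronglyMeasurable
    (fun τ hτ => Real.rpow_nonneg (by linarith [hτ.2]) _) (hF.2.2 s hs)
    (fun j => aestronglyMeasurable_mlG_comp_sub hα hα1 (hlp j) 0 s s) (by
      intro j τ hτ
      have hpos : 0 < s - τ := by linarith [hτ.2]
      rw [abs_of_pos (mlG_pos hα hα1 (hlp j) hpos), mul_assoc]
      have h1 := rpow_mul_mlG_le hα hα1 (hlp j) le_rfl zero_le_one hpos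
      simp only [Real.rpow_zero, one_mul, sub_zero, mul_one] at h1
      refine h1.trans (mul_le_mul_of_nonneg_left ?_ hC.le)
      have e1 : (s - τ) ^ (α - 1) = (s - τ) ^ (α - η) * (s - τ) ^ (η - 1) := by
        rw [← Real.rpow_add hpos]; ring_nf
      rw [e1]
      gcongr
      linarith [hτ.1, hs.2])
  have hsum := A.2.add e B.2
  have e3 : mlConst α * (t - s) ^ (α - η) * M + mlConst α * (t - s) ^ (α - η) * M
      = 2 * mlConst α * (t - s) ^ (α - η) * M := by ring
  rw [e3] at hsum
  convert hsum using 2 with j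
  have i1 : IntervalIntegrable (fun τ => ⟪F τ, e j⟫_ℝ * mlG α (l j) (t - τ)) volume 0 s := by
    refine ((B.1 j).add (D.1 j)).congr fun τ _ => ?_
    ring
  rw [convCoeff, convCoeff, ← intervalIntegral.integral_add_adjacent_intervals i1 (A.1 j)]
  have e4 : ∫ τ in (0 : ℝ)..s, ⟪F τ, e j⟫_ℝ * (mlG α (l j) (t - τ) - mlG α (l j) (s - τ))
      = (∫ τ in (0 : ℝ)..s, ⟪F τ, e j⟫_ℝ * mlG α (l j) (t - τ))
        - ∫ τ in (0 : ℝ)..s, ⟪F τ, e j⟫_ℝ * mlG α (l j) (s - τ) := by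
    rw [← intervalIntegral.integral_sub i1 (D.1 j)]
    refine intervalIntegral.integral_congr fun τ _ => ?_
    ring
  rw [e4]
  ring

omit hT in
theorem relaxRatio_nonneg (hT : 0 ≤ T) {t : ℝ} (ht : 0 ≤ t) (j : ℕ) : 0 ≤ relaxRatio α T l j t :=
  div_nonneg (mlE_pos hα hα1 (hl₀.trans_le (hl j)) ht).le
    (mlE_pos hα hα1 (hl₀.trans_le (hl j)) hT).le

theorem relaxRatio_le {θ t : ℝ} (h0 : 0 ≤ θ) (h1 : θ ≤ 1) (ht : 0 < t) (j : ℕ) :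
    relaxRatio α T l j t ≤ (1 / l₀ + Real.Gamma (1 - α) * T ^ α) * Real.Gamma (α + 1) ^ θ
      * (l j ^ (1 - θ) * t ^ (-(α * θ))) := by
  have hlj := hl₀.trans_le (hl j)
  have hA : 0 < 1 / l₀ + Real.Gamma (1 - α) * T ^ α := by
    have := Real.Gamma_pos_of_pos (by linarith : 0 < 1 - α)
    positivity
  have h := mul_le_mul (mlE_le_rpow hα hα1 hlj h0 h1 ht) (inv_mlE_le hα hα1 hlj hl₀ (hl j) hT)
    (inv_nonneg.2 (mlE_pos hα hα1 hlj hT.le).le) (by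
      have := Real.Gamma_pos_of_pos (by linarith : 0 < α + 1)
      positivity)
  rw [relaxRatio, div_eq_mul_inv]
  refine h.trans (le_of_eq ?_)
  have e1 : l j ^ (1 - θ) = l j ^ (-θ) * l j := by
    rw [← Real.rpow_add_one hlj.ne']; ring_nf
  rw [e1]
  ring

theorem relaxRatio_le_mul {t : ℝ} (ht : 0 ≤ t) (j : ℕ) :
    relaxRatio α T l j t ≤ (1 / l₀ + Real.Gamma (1 - α) * T ^ α) * l j := by
  have hlj := hl₀.trans_le (hl j)
  have h := mul_le_mul (mlE_le_one hα hα1 hlj ht) (inv_mlE_le hα hα1 hlj hl₀ (hl j) hT)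
    (inv_nonneg.2 (mlE_pos hα hα1 hlj hT.le).le) zero_le_one
  rw [relaxRatio, div_eq_mul_inv]
  linarith

theorem abs_relaxRatio_sub_le {σ s t : ℝ} (h0 : 0 ≤ σ) (h1 : σ ≤ 1) (hs : 0 ≤ s) (hst : s ≤ t)
    (j : ℕ) :
    |relaxRatio α T l j t - relaxRatio α T l j s| ≤ (1 / l₀ + Real.Gamma (1 - α) * T ^ α)
      / Real.Gamma (α + 1) ^ σ * (l j ^ (1 + σ) * (t - s) ^ (α * σ)) := by
  have hlj := hl₀.trans_le (hl j)
  have hG := Real.Gamma_pos_of_pos (by linarith : 0 < α + 1)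
  have hinv := inv_nonneg.2 (mlE_pos hα hα1 hlj hT.le).le
  have hts : 0 ≤ t - s := by linarith
  have h := mul_le_mul (abs_mlE_sub_le_rpow hα hα1 hlj h0 h1 hs hst)
    (inv_mlE_le hα hα1 hlj hl₀ (hl j) hT) hinv (by positivity)
  have e1 : relaxRatio α T l j t - relaxRatio α T l j s
      = (mlE α (l j) t - mlE α (l j) s) * (mlE α (l j) T)⁻¹ := by
    rw [relaxRatio, relaxRatio]; ring
  rw [e1, abs_mul, abs_of_nonneg hinv]
  refine h.trans (le_of_eq ?_)
  rw [Real.div_rpow (by positivity) hG.le, Real.mul_rpow hlj.le (by positivity),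
    ← Real.rpow_mul hts, add_comm 1 σ, Real.rpow_add_one hlj.ne']
  ring

omit hT in
theorem continuous_relaxRatio (j : ℕ) : Continuous (relaxRatio α T l j) :=
  (continuous_mlE hα hα1 (hl₀.trans_le (hl j))).div_const _

/-! ### Terminal data -/

/-- Of the p powers of l controlled by the datum, the quotient consumes 1 - κ and θ remain; the
price is t^{-ακ}. -/
theorem l2Bdd_mul_relaxRatio {d : ℕ → ℝ} {N p κ θ t : ℝ} (hd : L2Bdd (fun j => l j ^ p * d j) N)
    (h0 : 0 ≤ κ) (h1 : κ ≤ 1) (hκ : θ + (1 - κ) = p) (ht : 0 < t) :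
    L2Bdd (fun j => l j ^ θ * (d j * relaxRatio α T l j t))
      ((1 / l₀ + Real.Gamma (1 - α) * T ^ α) * Real.Gamma (α + 1) ^ κ * t ^ (-(α * κ)) * N) := by
  have hA : 0 < 1 / l₀ + Real.Gamma (1 - α) * T ^ α := by
    have := Real.Gamma_pos_of_pos (by linarith : 0 < 1 - α)
    positivity
  have hG := Real.Gamma_pos_of_pos (by linarith : 0 < α + 1)
  refine hd.of_abs_le (by positivity) fun j => ?_
  have hlj := hl₀.trans_le (hl j)
  have hr0 := relaxRatio_nonneg hα hα1 hl₀ hl hT.le ht.le j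
  have hr := relaxRatio_le hα hα1 hT hl₀ hl h0 h1 ht j
  have hlθ : 0 < l j ^ θ := Real.rpow_pos_of_pos hlj _
  rw [abs_mul, abs_mul, abs_mul, abs_of_nonneg hr0, abs_of_pos hlθ,
    abs_of_pos (Real.rpow_pos_of_pos hlj _), ← hκ, Real.rpow_add hlj]
  calc _ ≤ l j ^ θ * (|d j| * _) :=
        mul_le_mul_of_nonneg_left (mul_le_mul_of_nonneg_left hr (abs_nonneg _)) hlθ.le
    _ = _ := by ring

/-- The weight l^{p'-1} absorbs the whole factor l of 1/E(T), so nothing is singular and t = 0 is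
allowed. -/
theorem l2Bdd_neg_mul_relaxRatio {d : ℕ → ℝ} {N p p' t : ℝ}
    (hd : L2Bdd (fun j => l j ^ p * d j) N) (hp : p' ≤ p) (ht : 0 ≤ t) :
    L2Bdd (fun j => l j ^ (p' - 1) * (d j * relaxRatio α T l j t))
      ((1 / l₀ + Real.Gamma (1 - α) * T ^ α) * l₀ ^ (p' - p) * N) := by
  have hA : 0 < 1 / l₀ + Real.Gamma (1 - α) * T ^ α := by
    have := Real.Gamma_pos_of_pos (by linarith : 0 < 1 - α)
    positivity
  refine hd.of_abs_le (by positivity) fun j => ?_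
  have hlj := hl₀.trans_le (hl j)
  have hr0 := relaxRatio_nonneg hα hα1 hl₀ hl hT.le ht j
  have hr := relaxRatio_le_mul hα hα1 hT hl₀ hl ht j
  have hlθ : 0 < l j ^ (p' - 1) := Real.rpow_pos_of_pos hlj _
  rw [abs_mul, abs_mul, abs_mul, abs_of_nonneg hr0, abs_of_pos hlθ,
    abs_of_pos (Real.rpow_pos_of_pos hlj _)]
  have e1 : l j ^ p' = l j ^ (p' - 1) * l j := by rw [← Real.rpow_add_one hlj.ne']; ring_nf
  calc l j ^ (p' - 1) * (|d j| * relaxRatio α T l j t)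
      ≤ l j ^ (p' - 1) * (|d j| * ((1 / l₀ + Real.Gamma (1 - α) * T ^ α) * l j)) :=
        mul_le_mul_of_nonneg_left (mul_le_mul_of_nonneg_left hr (abs_nonneg _)) hlθ.le
    _ = (1 / l₀ + Real.Gamma (1 - α) * T ^ α) * (l j ^ p' * |d j|) := by rw [e1]; ring
    _ ≤ (1 / l₀ + Real.Gamma (1 - α) * T ^ α) * ((l₀ ^ (p' - p) * l j ^ p) * |d j|) := by
        gcongr
        exact rpow_le_rpow_sub_mul hl₀ (hl j) hp
    _ = _ := by ring

theorem l2Bdd_neg_mul_relaxRatio_sub {d : ℕ → ℝ} {N p p' σ s t : ℝ}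
    (hd : L2Bdd (fun j => l j ^ p * d j) N) (h0 : 0 ≤ σ) (h1 : σ ≤ 1) (hp : p' + σ ≤ p)
    (hs : 0 ≤ s) (hst : s ≤ t) :
    L2Bdd (fun j => l j ^ (p' - 1) * (d j * relaxRatio α T l j t)
        - l j ^ (p' - 1) * (d j * relaxRatio α T l j s))
      ((1 / l₀ + Real.Gamma (1 - α) * T ^ α) / Real.Gamma (α + 1) ^ σ * l₀ ^ (p' + σ - p)
        * (t - s) ^ (α * σ) * N) := by
  have hA : 0 < 1 / l₀ + Real.Gamma (1 - α) * T ^ α := by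
    have := Real.Gamma_pos_of_pos (by linarith : 0 < 1 - α)
    positivity
  have hG := Real.Gamma_pos_of_pos (by linarith : 0 < α + 1)
  have hts : 0 ≤ t - s := by linarith
  refine hd.of_abs_le (by positivity) fun j => ?_
  have hlj := hl₀.trans_le (hl j)
  have hr := abs_relaxRatio_sub_le hα hα1 hT hl₀ hl h0 h1 hs hst j
  have hlθ : 0 < l j ^ (p' - 1) := Real.rpow_pos_of_pos hlj _
  rw [← mul_sub, ← mul_sub, abs_mul, abs_mul, abs_mul, abs_of_pos hlθ,
    abs_of_pos (Real.rpow_pos_of_pos hlj p)]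
  have e1 : l j ^ (p' + σ) = l j ^ (p' - 1) * l j ^ (1 + σ) := by
    rw [← Real.rpow_add hlj]; ring_nf
  set A := (1 / l₀ + Real.Gamma (1 - α) * T ^ α) / Real.Gamma (α + 1) ^ σ with hAdef
  have hA' : 0 < A := by positivity
  calc l j ^ (p' - 1) * (|d j| * |relaxRatio α T l j t - relaxRatio α T l j s|)
      ≤ l j ^ (p' - 1) * (|d j| * (A * (l j ^ (1 + σ) * (t - s) ^ (α * σ)))) :=
        mul_le_mul_of_nonneg_left (mul_le_mul_of_nonneg_left hr (abs_nonneg _)) hlθ.le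
    _ = A * ((l j ^ (p' + σ) * |d j|) * (t - s) ^ (α * σ)) := by rw [e1]; ring
    _ ≤ A * (((l₀ ^ (p' + σ - p) * l j ^ p) * |d j|) * (t - s) ^ (α * σ)) := by
        gcongr
        exact rpow_le_rpow_sub_mul hl₀ (hl j) hp
    _ = _ := by ring

/-- Solutions of the homogeneous problem are continuous for positive times. -/
theorem continuousOn_of_coords_relaxRatio {d : ℕ → ℝ} {N p κ : ℝ}
    (hd : L2Bdd (fun j => l j ^ p * d j) N) (h0 : 0 ≤ κ) (h1 : κ ≤ 1) (hκ : 1 - κ = p)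
    {y : ℝ → H} (hy : ∀ t ∈ Ioc 0 T, ∀ j, ⟪e j, y t⟫_ℝ = d j * relaxRatio α T l j t) :
    ContinuousOn y (Ioc 0 T) := by
  intro s hs
  set A := (1 / l₀ + Real.Gamma (1 - α) * T ^ α) * Real.Gamma (α + 1) ^ κ with hA
  have hA0 : 0 < A := by
    have := Real.Gamma_pos_of_pos (by linarith : 0 < 1 - α)
    have := Real.Gamma_pos_of_pos (by linarith : 0 < α + 1)
    positivity
  set B := A * (s / 2) ^ (-(α * κ)) with hB
  have hs2 : 0 < s / 2 := by linarith [hs.1]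
  have hB0 : 0 < B := by positivity
  -- Away from 0 the singular weight is bounded, which yields a square summable majorant independent
  -- of t. All p powers of l are spent on it, so continuity comes from dominated convergence rather
  -- than from a Hölder estimate.
  have hbd : ∀ t, s / 2 ≤ t → ∀ j, |d j * relaxRatio α T l j t| ≤ B * |l j ^ p * d j| := by
    intro t ht j
    have ht0 : 0 < t := by linarith
    have hlj := hl₀.trans_le (hl j)
    have hr := relaxRatio_le hα hα1 hT hl₀ hl h0 h1 ht0 j
    rw [abs_mul, abs_mul, abs_of_nonneg (relaxRatio_nonneg hα hα1 hl₀ hl hT.le ht0.le j),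
      abs_of_pos (Real.rpow_pos_of_pos hlj p), ← hκ]
    have h3 : t ^ (-(α * κ)) ≤ (s / 2) ^ (-(α * κ)) :=
      Real.rpow_le_rpow_of_nonpos hs2 ht (by nlinarith)
    calc |d j| * relaxRatio α T l j t
        ≤ |d j| * (A * (l j ^ (1 - κ) * (s / 2) ^ (-(α * κ)))) := by
          gcongr
          refine hr.trans ?_
          gcongr
      _ = _ := by rw [hB]; ring
  rw [ContinuousWithinAt, tendsto_iff_norm_sub_tendsto_zero]
  have key : Tendsto (fun t => ∑' j, (d j * relaxRatio α T l j t - d j * relaxRatio α T l j s) ^ 2)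
      (𝓝[Ioc 0 T] s) (𝓝 (∑' _ : ℕ, 0)) := by
    refine tendsto_tsum_of_dominated_convergence
      (bound := fun j => (2 * B) ^ 2 * (l j ^ p * d j) ^ 2) (hd.summable.mul_left _) ?_ ?_
    · intro j
      have hc : Continuous fun t =>
          (d j * relaxRatio α T l j t - d j * relaxRatio α T l j s) ^ 2 := by
        have := continuous_relaxRatio (T := T) hα hα1 hl₀ hl j
        fun_prop
      have := (hc.tendsto s).mono_left (nhdsWithin_le_nhds (s := Ioc 0 T))
      simpa using this
    · have : ∀ᶠ t in 𝓝[Ioc 0 T] s, s / 2 < t :=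
        nhdsWithin_le_nhds (lt_mem_nhds (by linarith))
      filter_upwards [this] with t ht j
      rw [Real.norm_eq_abs, abs_of_nonneg (sq_nonneg _), ← mul_pow, ← sq_abs,
        ← sq_abs (2 * B * _)]
      refine pow_le_pow_left₀ (abs_nonneg _) ?_ 2
      rw [abs_mul, abs_of_pos (by positivity : 0 < 2 * B)]
      have b1 := hbd t ht.le j
      have b2 := hbd s (by linarith) j
      have b3 := abs_sub (d j * relaxRatio α T l j t) (d j * relaxRatio α T l j s)
      linarith
  rw [tsum_zero] at key
  have key2 := (Real.continuous_sqrt.tendsto 0).comp key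
  rw [Real.sqrt_zero] at key2
  refine key2.congr' ?_
  filter_upwards [self_mem_nhdsWithin] with t ht
  have h3 := hasSum_sq_coords e (y t - y s)
  simp only [inner_sub_right, hy t ht, hy s hs] at h3
  simp only [Function.comp]
  rw [h3.tsum_eq, Real.sqrt_sq (norm_nonneg _)]

end Coefficients

/-! ### The three spectral series together. -/

section Solution

variable {H : Type*} [NormedAddCommGroup H] [InnerProductSpace ℝ H]
  (e : HilbertBasis ℕ ℝ H) {α T η l₀ : ℝ} {l : ℕ → ℝ}

/-- The spectral formula for the solution of the final value problem, in a space in which the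
basis vector `e_j` is represented by `v j`. -/
def SpectralSum {Y : Type*} [NormedAddCommGroup Y] [NormedSpace ℝ Y] (v : ℕ → Y)
    (α T : ℝ) (l φ : ℕ → ℝ) (F : ℝ → H) (t : ℝ) (y : Y) : Prop :=
  ∃ y₁ y₂ y₃ : Y,
    HasSum (fun j => convCoeff e α l F j t • v j) y₁ ∧
    HasSum (fun j => (φ j * relaxRatio α T l j t) • v j) y₂ ∧
    HasSum (fun j => (-(convCoeff e α l F j T * relaxRatio α T l j t)) • v j) y₃ ∧
    y = y₁ + y₂ + y₃

/-- The coefficients of the solution of the final value problem. -/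
def solCoeff (α T : ℝ) (l φ : ℕ → ℝ) (F : ℝ → H) (j : ℕ) (t : ℝ) : ℝ :=
  convCoeff e α l F j t + φ j * relaxRatio α T l j t
    + -(convCoeff e α l F j T * relaxRatio α T l j t)

variable {e}

theorem SpectralSum.hasSum {Y : Type*} [NormedAddCommGroup Y] [NormedSpace ℝ Y] {v : ℕ → Y}
    {φ : ℕ → ℝ} {F : ℝ → H} {t : ℝ} {y : Y} (h : SpectralSum e v α T l φ F t y) :
    HasSum (fun j => solCoeff e α T l φ F j t • v j) y := by
  obtain ⟨y₁, y₂, y₃, h1, h2, h3, rfl⟩ := h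
  simpa only [solCoeff, add_smul] using (h1.add h2).add h3

theorem SpectralSum.map {Y Z : Type*} [NormedAddCommGroup Y] [NormedSpace ℝ Y]
    [NormedAddCommGroup Z] [NormedSpace ℝ Z] {v : ℕ → Y}
    {φ : ℕ → ℝ} {F : ℝ → H} {t : ℝ} {y : Y} (h : SpectralSum e v α T l φ F t y) (A : Y →L[ℝ] Z) :
    SpectralSum e (fun j => A (v j)) α T l φ F t (A y) := by
  obtain ⟨y₁, y₂, y₃, h1, h2, h3, rfl⟩ := h
  refine ⟨A y₁, A y₂, A y₃, ?_, ?_, ?_, by simp⟩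
  · simpa only [map_smul] using h1.mapL A
  · simpa only [map_smul] using h2.mapL A
  · simpa only [map_smul] using h3.mapL A

theorem SpectralSum.inner_eq {w φ : ℕ → ℝ} {F : ℝ → H} {t : ℝ} {y : H}
    (h : SpectralSum e (fun j => w j • e j) α T l φ F t y) (j : ℕ) :
    ⟪e j, y⟫_ℝ = w j * solCoeff e α T l φ F j t := by
  refine inner_of_hasSum e (a := fun j => w j * solCoeff e α T l φ F j t) ?_ j
  simpa only [smul_smul, mul_comm] using h.hasSum

theorem L2Bdd.abs_le {a : ℕ → ℝ} {M : ℝ} (h : L2Bdd a M) (j : ℕ) : |a j| ≤ M :=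
  abs_le_of_sq_le_sq (by simpa using h.2 {j}) h.1

variable (e)

theorem spectralSum_of_l2Bdd {w φ : ℕ → ℝ} {F : ℝ → H} {S : Set ℝ} {B₁ B₂ B₃ : ℝ → ℝ}
    (h1 : ∀ t ∈ S, L2Bdd (fun j => w j * convCoeff e α l F j t) (B₁ t))
    (h2 : ∀ t ∈ S, L2Bdd (fun j => w j * (φ j * relaxRatio α T l j t)) (B₂ t))
    (h3 : ∀ t ∈ S, L2Bdd (fun j => w j * (-convCoeff e α l F j T * relaxRatio α T l j t)) (B₃ t)) :
    ∃ y : ℝ → H, ∀ t ∈ S, SpectralSum e (fun j => w j • e j) α T l φ F t (y t) ∧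
      ‖y t‖ ≤ B₁ t + B₂ t + B₃ t := by
  obtain ⟨y₁, hy₁⟩ := exists_hasSum_family e h1
  obtain ⟨y₂, hy₂⟩ := exists_hasSum_family e h2
  obtain ⟨y₃, hy₃⟩ := exists_hasSum_family e h3
  refine ⟨fun t => y₁ t + y₂ t + y₃ t, fun t ht => ⟨⟨y₁ t, y₂ t, y₃ t, ?_, ?_, ?_, rfl⟩, ?_⟩⟩
  · refine (hy₁ t ht).1.congr_fun fun j => ?_
    rw [smul_smul, mul_comm]
  · refine (hy₂ t ht).1.congr_fun fun j => ?_
    rw [smul_smul, mul_comm]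
  · refine (hy₃ t ht).1.congr_fun fun j => ?_
    rw [smul_smul, mul_comm, neg_mul]
  · exact (norm_add₃_le).trans
      (add_le_add (add_le_add (hy₁ t ht).2.2 (hy₂ t ht).2.2) (hy₃ t ht).2.2)

variable (hα : 0 < α) (hα1 : α < 1) (hT : 0 < T) (hl₀ : 0 < l₀) (hl : ∀ j, l₀ ≤ l j)
include hα hα1 hT hl₀ hl

theorem continuousOn_convCoeff {F : ℝ → H} {M : ℝ} (hF : XBound T η F M) (hη0 : 0 ≤ η)
    (hη : η < α) (j : ℕ) : ContinuousOn (convCoeff e α l F j) (Icc 0 T) := by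
  refine continuousOn_of_norm_sub_le_rpow (K := 2 * mlConst α * M) (sub_pos.2 hη) ?_
  intro s hs t ht hst
  have := (l2Bdd_convCoeff_sub e hα hα1 hT hl₀ hl hF hη0 hη.le hs ht hst).abs_le j
  refine this.trans (le_of_eq ?_)
  ring

/-- The coefficients are continuous in t, so the solution is a pointwise limit of continuous partial
sums. This suffices in V_{β(p-p')}, where no continuity is claimed. -/
theorem aestronglyMeasurable_of_spectralSum {Y : Type*} [NormedAddCommGroup Y] [NormedSpace ℝ Y]
    {v : ℕ → Y} {φ : ℕ → ℝ} {F : ℝ → H} {M : ℝ} (hF : XBound T η F M) (hη0 : 0 ≤ η) (hη : η < α)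
    {y : ℝ → Y} (hy : ∀ t ∈ Ioc 0 T, SpectralSum e v α T l φ F t (y t)) :
    AEStronglyMeasurable y (volume.restrict (Ioo 0 T)) := by
  refine aestronglyMeasurable_of_tendsto_ae atTop
    (f := fun (n : ℕ) t => ∑ j ∈ Finset.range n, solCoeff e α T l φ F j t • v j) ?_ ?_
  · intro n
    refine ContinuousOn.aestronglyMeasurable ?_ measurableSet_Ioo
    refine continuousOn_finsetSum _ fun j _ => ContinuousOn.smul ?_ continuousOn_const
    have h1 := (continuousOn_convCoeff e hα hα1 hT hl₀ hl hF hη0 hη j).mono Ioo_subset_Icc_self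
    have h2 := (continuous_relaxRatio (T := T) hα hα1 hl₀ hl j).continuousOn (s := Ioo 0 T)
    exact (h1.add (h2.const_smul (φ j))).add ((h2.const_smul (convCoeff e α l F j T)).neg)
  · refine (ae_restrict_iff' measurableSet_Ioo).2 (ae_of_all _ fun t ht => ?_)
    exact (hy t ⟨ht.1, ht.2.le⟩).hasSum.tendsto_sum_nat

theorem continuousOn_of_spectralSum {p q : ℝ} (hp : 0 < p) (hq : 0 < q) (hpq : p + q = 1)
    {φ : ℕ → ℝ} {F : ℝ → H} {M N : ℝ} (hF : XBound T (α * q) F M)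
    (hφ : L2Bdd (fun j => l j ^ p * φ j) N)
    {y : ℝ → H} (hy : ∀ t ∈ Ioc 0 T, SpectralSum e e α T l φ F t (y t)) :
    ContinuousOn y (Ioc 0 T) := by
  have hex : ∀ t, ∃ y₁ y₂ y₃ : H, t ∈ Ioc 0 T →
      HasSum (fun j => convCoeff e α l F j t • e j) y₁ ∧
      HasSum (fun j => (φ j * relaxRatio α T l j t) • e j) y₂ ∧
      HasSum (fun j => (-(convCoeff e α l F j T * relaxRatio α T l j t)) • e j) y₃ ∧
      y t = y₁ + y₂ + y₃ := by
    intro t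
    by_cases ht : t ∈ Ioc 0 T
    · obtain ⟨y₁, y₂, y₃, h⟩ := hy t ht
      exact ⟨y₁, y₂, y₃, fun _ => h⟩
    · exact ⟨0, 0, 0, fun h => absurd h ht⟩
  choose y₁ y₂ y₃ h using hex
  have hqα : α * q < α := by nlinarith
  have hqα0 : 0 ≤ α * q := by positivity
  have c1 : ContinuousOn y₁ (Ioc 0 T) := by
    refine continuousOn_of_norm_sub_le_rpow (K := 2 * mlConst α * M) (sub_pos.2 hqα) ?_
    intro s hs t ht hst
    have hb := l2Bdd_convCoeff_sub e hα hα1 hT hl₀ hl hF hqα0 hqα.le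
      (Ioc_subset_Icc_self hs) (Ioc_subset_Icc_self ht) hst
    refine (hb.norm_le e fun j => ?_).trans (le_of_eq (by ring))
    rw [inner_sub_right, inner_of_hasSum e (h t ht).1, inner_of_hasSum e (h s hs).1]
  have c2 : ContinuousOn y₂ (Ioc 0 T) :=
    continuousOn_of_coords_relaxRatio e hα hα1 hT hl₀ hl hφ hq.le (by linarith) (by linarith)
      fun t ht j => inner_of_hasSum e (h t ht).2.1 j
  -- The third series is the homogeneous solution with terminal datum -G_j(T), which is as regular
  -- as φ because α(1-p) = αq.
  have hd : L2Bdd (fun j => l j ^ p * -convCoeff e α l F j T)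
      (mlConst α * T ^ (α * (1 - p) - α * q) * M) := by
    have := l2Bdd_convCoeff e hα hα1 hT hl₀ hl hF hp.le (by linarith)
      (by rw [← hpq]; ring_nf; rfl) (right_mem_Icc.2 hT.le)
    refine ⟨this.1, fun s => ?_⟩
    simpa only [mul_neg, neg_sq] using this.2 s
  have c3 : ContinuousOn y₃ (Ioc 0 T) :=
    continuousOn_of_coords_relaxRatio e hα hα1 hT hl₀ hl hd hq.le (by linarith) (by linarith)
      fun t ht j => by rw [inner_of_hasSum e (h t ht).2.2.1 j, neg_mul]
  exact ((c1.add c2).add c3).congr fun t ht => (h t ht).2.2.2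

theorem l2Bdd_neg_convCoeff {F : ℝ → H} {M p : ℝ} (hF : XBound T η F M) (h0 : 0 ≤ p) (h1 : p ≤ 1)
    (hη : η ≤ α * (1 - p)) :
    L2Bdd (fun j => l j ^ p * -convCoeff e α l F j T) (mlConst α * T ^ (α * (1 - p) - η) * M) := by
  have := l2Bdd_convCoeff e hα hα1 hT hl₀ hl hF h0 h1 hη (right_mem_Icc.2 hT.le)
  refine ⟨this.1, fun s => ?_⟩
  simpa only [mul_neg, neg_sq] using this.2 s

/-- Existence, with the singularity at `t = 0` controlled: the solution with values in the
domain of the power `θ`. -/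
theorem exists_spectralSum_le {p θ κ : ℝ} (hθ : 0 ≤ θ) (hθp : θ ≤ p) (hp : p ≤ 1)
    (hκ : θ + (1 - κ) = p) (hη : η ≤ α * (1 - p)) :
    ∃ C : ℝ, 0 < C ∧ ∀ (φ : ℕ → ℝ) (F : ℝ → H) (M N : ℝ), XBound T η F M →
      L2Bdd (fun j => l j ^ p * φ j) N →
      ∃ y : ℝ → H, ∀ t ∈ Ioc 0 T, SpectralSum e (fun j => l j ^ θ • e j) α T l φ F t (y t) ∧
        ‖y t‖ ≤ C * (N + M) * t ^ (-(α * κ)) := by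
  have hC := mlConst_pos hα
  have hG1 := Real.Gamma_pos_of_pos (by linarith : 0 < 1 - α)
  have hG2 := Real.Gamma_pos_of_pos (by linarith : 0 < α + 1)
  have hκ0 : 0 ≤ κ := by linarith
  have hκ1 : κ ≤ 1 := by linarith
  set A := (1 / l₀ + Real.Gamma (1 - α) * T ^ α) * Real.Gamma (α + 1) ^ κ with hA
  set c₁ := mlConst α * T ^ (α * (1 - θ) - η) with hc₁
  set c₃ := mlConst α * T ^ (α * (1 - p) - η) with hc₃
  have hA0 : 0 < A := by positivity
  have hc₁0 : 0 < c₁ := by positivity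
  have hc₃0 : 0 < c₃ := by positivity
  refine ⟨c₁ * T ^ (α * κ) + A + A * c₃, by positivity, ?_⟩
  intro φ F M N hF hφ
  have hηθ : η ≤ α * (1 - θ) := hη.trans (by gcongr)
  obtain ⟨y, hy⟩ := spectralSum_of_l2Bdd (T := T) e (w := fun j => l j ^ θ) (φ := φ) (F := F)
    (S := Ioc 0 T)
    (fun t ht => l2Bdd_convCoeff e hα hα1 hT hl₀ hl hF hθ (by linarith) hηθ
      (Ioc_subset_Icc_self ht))
    (fun t ht => l2Bdd_mul_relaxRatio hα hα1 hT hl₀ hl hφ hκ0 hκ1 hκ ht.1)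
    (fun t ht => l2Bdd_mul_relaxRatio hα hα1 hT hl₀ hl
      (l2Bdd_neg_convCoeff e hα hα1 hT hl₀ hl hF (by linarith) hp hη) hκ0 hκ1 hκ ht.1)
  refine ⟨y, fun t ht => ⟨(hy t ht).1, (hy t ht).2.trans ?_⟩⟩
  have hM := hF.1
  have hN := hφ.1
  have ht0 : 0 < t := ht.1
  rw [← hA, ← hc₁, ← hc₃]
  -- The convolution term is bounded in t; this factor puts it under the same singular weight as the
  -- other two.
  have hone : 1 ≤ T ^ (α * κ) * t ^ (-(α * κ)) := by
    rw [Real.rpow_neg ht0.le, ← div_eq_mul_inv, le_div_iff₀ (Real.rpow_pos_of_pos ht0 _), one_mul]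
    exact Real.rpow_le_rpow ht0.le ht.2 (by positivity)
  have hx : 0 < t ^ (-(α * κ)) := Real.rpow_pos_of_pos ht0 _
  have b1 : c₁ * M ≤ c₁ * M * (T ^ (α * κ) * t ^ (-(α * κ))) :=
    le_mul_of_one_le_right (by positivity) hone
  have b2 : 0 ≤ c₁ * T ^ (α * κ) * N * t ^ (-(α * κ)) := by positivity
  have b3 : 0 ≤ A * M * t ^ (-(α * κ)) := by positivity
  have b4 : 0 ≤ A * c₃ * N * t ^ (-(α * κ)) := by positivity
  linarith

/-- Existence of the solution on `[0, T]` with Hölder continuity in a space of negative order. -/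
theorem exists_spectralSum_holder {p p' s : ℝ} (hp0 : 0 < p) (hp1 : p < 1) (hs : 0 < s)
    (hsα : s ≤ α * (1 - p)) (hp' : p' ≤ p - s / α) :
    ∃ C : ℝ, 0 < C ∧ ∀ (φ : ℕ → ℝ) (F : ℝ → H) (M N : ℝ), XBound T (α * (1 - p) - s) F M →
      L2Bdd (fun j => l j ^ p * φ j) N →
      ∃ y : ℝ → H, (∀ t ∈ Icc 0 T,
          SpectralSum e (fun j => l j ^ (p' - 1) • e j) α T l φ F t (y t)) ∧
        ∀ t₁ ∈ Icc 0 T, ∀ t₂ ∈ Icc 0 T, t₁ ≤ t₂ →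
          ‖y t₂ - y t₁‖ ≤ C * (N + M) * (t₂ - t₁) ^ s := by
  have hC := mlConst_pos hα
  have hG1 := Real.Gamma_pos_of_pos (by linarith : 0 < 1 - α)
  have hG2 := Real.Gamma_pos_of_pos (by linarith : 0 < α + 1)
  set σ := s / α with hσ
  have hσ0 : 0 ≤ σ := by positivity
  have hασ : α * σ = s := by rw [hσ]; field_simp
  have hσ1 : σ ≤ 1 := by
    rw [hσ, div_le_one hα]
    nlinarith
  have hpp : p' ≤ p := by linarith
  have hp'1 : p' - 1 ≤ 0 := by linarith
  set A := (1 / l₀ + Real.Gamma (1 - α) * T ^ α) / Real.Gamma (α + 1) ^ σ * l₀ ^ (p' + σ - p)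
    with hA
  set c₁ := l₀ ^ (p' - 1) * (2 * mlConst α * T ^ (α * p)) with hc₁
  set c₃ := mlConst α * T ^ (α * (1 - p) - (α * (1 - p) - s)) with hc₃
  have hA0 : 0 < A := by positivity
  have hc₁0 : 0 < c₁ := by positivity
  have hc₃0 : 0 < c₃ := by positivity
  refine ⟨c₁ + A + A * c₃, by positivity, ?_⟩
  intro φ F M N hF hφ
  have hlw : ∀ j, l j ^ (p' - 1) ≤ l₀ ^ (p' - 1) := fun j =>
    Real.rpow_le_rpow_of_nonpos hl₀ (hl j) hp'1
  have hweight : ∀ {a : ℕ → ℝ} {B : ℝ}, L2Bdd a B →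
      L2Bdd (fun j => l j ^ (p' - 1) * a j) (l₀ ^ (p' - 1) * B) := by
    intro a B ha
    refine ha.of_abs_le (by positivity) fun j => ?_
    rw [abs_mul, abs_of_pos (Real.rpow_pos_of_pos (hl₀.trans_le (hl j)) _)]
    exact mul_le_mul_of_nonneg_right (hlw j) (abs_nonneg _)
  have hψ := l2Bdd_neg_convCoeff e hα hα1 hT hl₀ hl hF hp0.le hp1.le (by linarith)
  obtain ⟨y, hy⟩ := spectralSum_of_l2Bdd (T := T) e (w := fun j => l j ^ (p' - 1)) (φ := φ)
    (F := F) (S := Icc 0 T)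
    (fun t ht => hweight (by
      simpa using l2Bdd_convCoeff e hα hα1 hT hl₀ hl hF le_rfl zero_le_one
        (by nlinarith) ht))
    (fun t ht => l2Bdd_neg_mul_relaxRatio hα hα1 hT hl₀ hl hφ hpp ht.1)
    (fun t ht => l2Bdd_neg_mul_relaxRatio hα hα1 hT hl₀ hl hψ hpp ht.1)
  refine ⟨y, fun t ht => (hy t ht).1, fun t₁ ht₁ t₂ ht₂ h12 => ?_⟩
  have hM := hF.1
  have hN := hφ.1
  have h12' : 0 ≤ t₂ - t₁ := by linarith
  have k1 := hweight (l2Bdd_convCoeff_sub e hα hα1 hT hl₀ hl hF (by linarith) (by nlinarith)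
    ht₁ ht₂ h12)
  have k2 := l2Bdd_neg_mul_relaxRatio_sub hα hα1 hT hl₀ hl hφ hσ0 hσ1 (by linarith)
    ht₁.1 h12 (p' := p')
  have k3 := l2Bdd_neg_mul_relaxRatio_sub hα hα1 hT hl₀ hl hψ hσ0 hσ1 (by linarith)
    ht₁.1 h12 (p' := p')
  have k := (k1.add e k2).add e k3
  refine (k.norm_le e fun j => ?_).trans ?_
  · rw [inner_sub_right, (hy t₂ ht₂).1.inner_eq, (hy t₁ ht₁).1.inner_eq, solCoeff, solCoeff]
    ring
  · rw [hασ, ← hA, ← hc₃]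
    have hx : 0 ≤ (t₂ - t₁) ^ s := Real.rpow_nonneg h12' s
    -- The convolution term is Hölder with the better exponent αp + s; the surplus αp goes into the
    -- constant.
    have e1 : (t₂ - t₁) ^ (α - (α * (1 - p) - s)) ≤ T ^ (α * p) * (t₂ - t₁) ^ s := by
      have e2 : α - (α * (1 - p) - s) = α * p + s := by ring
      rw [e2, Real.rpow_add_of_nonneg h12' (by positivity) hs.le]
      gcongr
      linarith [ht₁.1, ht₂.2]
    have b1 : l₀ ^ (p' - 1) * (2 * mlConst α * (t₂ - t₁) ^ (α - (α * (1 - p) - s)) * M)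
        ≤ c₁ * M * (t₂ - t₁) ^ s := by
      calc _ ≤ l₀ ^ (p' - 1) * (2 * mlConst α * (T ^ (α * p) * (t₂ - t₁) ^ s) * M) := by gcongr
        _ = _ := by rw [hc₁]; ring
    have b2 : 0 ≤ c₁ * N * (t₂ - t₁) ^ s := by positivity
    have b3 : 0 ≤ A * M * (t₂ - t₁) ^ s := by positivity
    have b4 : 0 ≤ A * c₃ * N * (t₂ - t₁) ^ s := by positivity
    linarith

end Solution

/-! ### Norms of functions with a power singularity at the origin -/

theorem exists_eLpNorm_le_of_norm_le_rpow {T κ ρ : ℝ} (hT : 0 < T) (hρ : 1 ≤ ρ)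
    (hκρ : κ * ρ < 1) :
    ∃ A : ℝ, 0 < A ∧ ∀ {E : Type} [NormedAddCommGroup E] (u : ℝ → E) (K : ℝ), 0 ≤ K →
      AEStronglyMeasurable u (volume.restrict (Ioo 0 T)) →
      (∀ t ∈ Ioc 0 T, ‖u t‖ ≤ K * t ^ (-κ)) →
      MemLp u (ENNReal.ofReal ρ) (volume.restrict (Ioo 0 T)) ∧
      eLpNorm u (ENNReal.ofReal ρ) (volume.restrict (Ioo 0 T)) ≤ ENNReal.ofReal (A * K) := by
  have hρ0 : 0 < ρ := by linarith
  have hne : ENNReal.ofReal ρ ≠ 0 := by simpa using hρ0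
  have hg : MemLp (fun t : ℝ => t ^ (-κ)) (ENNReal.ofReal ρ) (volume.restrict (Ioo 0 T)) := by
    refine (integrable_norm_rpow_iff (by fun_prop) hne ENNReal.ofReal_ne_top).1 ?_
    rw [ENNReal.toReal_ofReal hρ0.le]
    have h1 : IntegrableOn (fun t : ℝ => t ^ (-(κ * ρ))) (Ioo 0 T) :=
      (intervalIntegrable_iff_integrableOn_Ioo_of_le hT.le).1
        (intervalIntegral.intervalIntegrable_rpow' (by linarith))
    refine IntegrableOn.congr_fun h1 (fun t ht => ?_) measurableSet_Ioo
    rw [Real.norm_of_nonneg (Real.rpow_nonneg ht.1.le _), ← Real.rpow_mul ht.1.le, neg_mul]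
  -- The added 1 only makes the constant visibly positive.
  refine ⟨(eLpNorm (fun t : ℝ => t ^ (-κ)) (ENNReal.ofReal ρ) (volume.restrict (Ioo 0 T))).toReal
    + 1, by positivity, ?_⟩
  intro E _ u K hK hu hle
  have hae : ∀ᵐ t ∂(volume.restrict (Ioo 0 T)), ‖u t‖ ≤ K * ‖t ^ (-κ)‖ := by
    refine (ae_restrict_iff' measurableSet_Ioo).2 (ae_of_all _ fun t ht => ?_)
    rw [Real.norm_of_nonneg (Real.rpow_nonneg ht.1.le _)]
    exact hle t ⟨ht.1, ht.2.le⟩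
  have hb := eLpNorm_le_mul_eLpNorm_of_ae_le_mul hae (ENNReal.ofReal ρ)
  refine ⟨hg.of_le_mul hu hae, hb.trans ?_⟩
  rw [mul_comm, ENNReal.ofReal_mul (by positivity)]
  gcongr
  rw [← ENNReal.ofReal_toReal hg.2.ne]
  refine ENNReal.ofReal_le_ofReal ?_
  rw [ENNReal.toReal_ofReal ENNReal.toReal_nonneg]
  linarith

theorem normCWeighted_le {H : Type*} [NormedAddCommGroup H] {T ρ K : ℝ} {u : ℝ → H}
    (h : ∀ t ∈ Ioc 0 T, ‖u t‖ ≤ K * t ^ (-ρ)) : normCWeighted T ρ u ≤ ENNReal.ofReal K := by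
  refine iSup₂_le fun t ht => ?_
  have hp : 0 < t ^ ρ := Real.rpow_pos_of_pos ht.1 _
  rw [← ofReal_norm, ← ENNReal.ofReal_mul hp.le]
  refine ENNReal.ofReal_le_ofReal ?_
  calc t ^ ρ * ‖u t‖ ≤ t ^ ρ * (K * t ^ (-ρ)) := mul_le_mul_of_nonneg_left (h t ht) hp.le
    _ = K := by rw [Real.rpow_neg ht.1.le]; field_simp

theorem normHolder_le {H : Type*} [NormedAddCommGroup H] {T θ K : ℝ} {u : ℝ → H} (hK : 0 ≤ K)
    (h : ∀ t₁ ∈ Icc 0 T, ∀ t₂ ∈ Icc 0 T, t₁ ≤ t₂ → ‖u t₂ - u t₁‖ ≤ K * (t₂ - t₁) ^ θ) :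
    normHolder T θ u ≤ ENNReal.ofReal K := by
  refine iSup_le fun t₁ => iSup_le fun t₂ => iSup_le fun h0 => iSup_le fun h12 =>
    iSup_le fun h2 => ?_
  refine ENNReal.div_le_of_le_mul ?_
  rw [← ofReal_norm, ← ENNReal.ofReal_mul hK]
  exact ENNReal.ofReal_le_ofReal
    (h t₁ ⟨h0, h12.le.trans h2⟩ t₂ ⟨h0.trans h12.le, h2⟩ h12.le)

/-- The upper bound on r keeps the Lebesgue exponent at least 1; positivity of r, in the next lemma,
makes t^{-κ} integrable to that exponent. -/
theorem one_le_one_div_sub {κ r : ℝ} (hκ : 0 < κ) (hr : r ≤ (1 - κ) / κ) : 1 ≤ 1 / κ - r := by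
  rw [sub_div, div_self hκ.ne'] at hr
  linarith

theorem mul_one_div_sub_lt_one {κ r : ℝ} (hκ : 0 < κ) (hr : 0 < r) : κ * (1 / κ - r) < 1 := by
  rw [mul_sub, mul_one_div_cancel hκ.ne']
  linarith [mul_pos hκ hr]

namespace Eigensystem

variable {k : ℕ} {D : Set (EuclideanSpace ℝ (Fin k))} {L : EllipticOperator D}
  {B : BoundaryOperator} (S : Eigensystem L B)

/-! ### The scale of spaces -/

/-- The spectrum is bounded below by m₀ > 0, so the negative powers m_j^{-γ} are bounded
multipliers. Series in V_γ can then be summed in L²(D) and pulled back isometrically. -/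
theorem pow_surjective {γ : ℝ} (hγ : 0 ≤ γ) : Function.Surjective (S.pow γ) := by
  intro x
  have hb : L2Bdd (fun j => S.m j ^ (-γ) * ⟪S.e j, x⟫_ℝ) (S.m 0 ^ (-γ) * ‖x‖) := by
    refine (l2Bdd_coords S.e x).of_abs_le (Real.rpow_nonneg (S.m_pos 0).le _) fun j => ?_
    rw [abs_mul, abs_of_pos (Real.rpow_pos_of_pos (S.m_pos j) _)]
    exact mul_le_mul_of_nonneg_right (Real.rpow_le_rpow_of_nonpos (S.m_pos 0)
      (S.m_mono (Nat.zero_le j)) (by linarith)) (abs_nonneg _)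
  obtain ⟨y, -, hy, -⟩ := hb.exists_hasSum S.e
  have hc : ∀ j, S.m j ^ γ * ⟪S.e j, y⟫_ℝ = ⟪S.e j, x⟫_ℝ := fun j => by
    rw [hy, ← mul_assoc, ← Real.rpow_add (S.m_pos j)]
    simp
  have hmem : y ∈ S.powDomain γ := by
    change Memℓp (fun j => S.m j ^ γ * ⟪S.e j, y⟫_ℝ) 2
    have := lp.memℓp (S.e.repr x)
    refine (funext fun j => ?_ : (fun j => S.m j ^ γ * ⟪S.e j, y⟫_ℝ) = S.e.repr x) ▸ this
    rw [hc, S.e.repr_apply_apply]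
  let v : S.V γ := ⟨y, hmem⟩
  refine ⟨v, ?_⟩
  apply S.e.repr.injective
  ext j
  rw [S.e.repr_apply_apply, S.e.repr_apply_apply]
  exact (S.inner_pow γ v j).trans (hc j)

/-- The isometry `ℒ^γ : V_γ → L²(D)`. -/
def powIsometry (γ : ℝ) : S.V γ →ₗᵢ[ℝ] L2 D where
  toLinearMap := S.pow γ
  norm_map' _ := rfl

/-- The isometric isomorphism `ℒ^γ : V_γ ≃ L²(D)` for `γ ≥ 0`. -/
def powEquiv {γ : ℝ} (hγ : 0 ≤ γ) : S.V γ ≃ₗᵢ[ℝ] L2 D :=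
  LinearIsometryEquiv.ofSurjective (S.powIsometry γ) (S.pow_surjective hγ)

theorem pow_powEquiv_symm {γ : ℝ} (hγ : 0 ≤ γ) (x : L2 D) :
    S.pow γ ((S.powEquiv hγ).symm x) = x := (S.powEquiv hγ).apply_symm_apply x

theorem toL2_eq_of_inner {γ : ℝ} {v : S.V γ} {y : L2 D}
    (h : ∀ j, ⟪S.e j, S.pow γ v⟫_ℝ = S.m j ^ γ * ⟪S.e j, y⟫_ℝ) : S.toL2 γ v = y := by
  apply S.e.repr.injective
  ext j
  rw [S.e.repr_apply_apply, S.e.repr_apply_apply]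
  have := h j
  rw [S.inner_pow] at this
  exact mul_left_cancel₀ (Real.rpow_pos_of_pos (S.m_pos j) γ).ne' this

/-- The map `L²(D) → V_{-γ}` extending `ℒ^γ`. -/
def powNeg (γ : ℝ) : L2 D →L[ℝ] S.VNeg γ :=
  ((ContinuousLinearMap.compL ℝ (S.V γ) (L2 D) ℝ).flip
    (S.powIsometry γ).toContinuousLinearMap).comp (innerSL ℝ)

theorem powNeg_apply (γ : ℝ) (x : L2 D) (w : S.V γ) : S.powNeg γ x w = ⟪x, S.pow γ w⟫_ℝ := rfl

theorem norm_powNeg_le (γ : ℝ) (x : L2 D) : ‖S.powNeg γ x‖ ≤ ‖x‖ := by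
  refine ContinuousLinearMap.opNorm_le_bound _ (norm_nonneg _) fun w => ?_
  rw [powNeg_apply, S.norm_V]
  exact norm_inner_le_norm _ _

theorem powNeg_smul_e (γ : ℝ) (j : ℕ) : S.powNeg γ (S.m j ^ (-γ) • S.e j) = S.eNeg γ j := by
  ext w
  rw [powNeg_apply, real_inner_smul_left, S.inner_pow, ← mul_assoc,
    ← Real.rpow_add (S.m_pos j), S.isFunction_eNeg γ j w]
  simp

/-- Parseval on both sides: the multipliers m_j^{-γ} and m_j^γ cancel in each term. -/
theorem isFunction_powNeg {γ : ℝ} {x y : L2 D}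
    (h : ∀ j, ⟪S.e j, x⟫_ℝ = S.m j ^ (-γ) * ⟪S.e j, y⟫_ℝ) : S.IsFunction (S.powNeg γ x) y := by
  intro w
  rw [powNeg_apply, ← (S.e.hasSum_inner_mul_inner x (S.pow γ w)).tsum_eq,
    ← (S.e.hasSum_inner_mul_inner y (S.toL2 γ w)).tsum_eq]
  congr 1
  ext j
  rw [real_inner_comm, h, S.inner_pow, mul_mul_mul_comm, ← Real.rpow_add (S.m_pos j),
    real_inner_comm]
  simp

theorem l2Bdd_toL2 (β p : ℝ) (φ : S.V (β * p)) :
    L2Bdd (fun j => (S.m j ^ β) ^ p * ⟪S.toL2 _ φ, S.e j⟫_ℝ) ‖φ‖ := by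
  have := l2Bdd_coords S.e (S.pow _ φ)
  simp only [S.inner_pow] at this
  simpa only [← Real.rpow_mul (S.m_pos _).le, real_inner_comm, S.norm_V] using this

theorem spectralFormula_unique {Y : Type*} [NormedAddCommGroup Y] [NormedSpace ℝ Y] {ε : ℕ → Y}
    {α β T : ℝ} {φ : L2 D} {F : ℝ → L2 D} {t : ℝ} {y z : Y}
    (hy : S.SpectralFormula ε α β T φ F t y) (hz : S.SpectralFormula ε α β T φ F t z) : y = z := by
  obtain ⟨y₁, y₂, y₃, h1, h2, h3, rfl⟩ := hy
  obtain ⟨z₁, z₂, z₃, g1, g2, g3, rfl⟩ := hz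
  rw [h1.unique g1, h2.unique g2, h3.unique g3]

theorem ae_eq_of_isMildSolution {α β T : ℝ} {φ : L2 D} {F u v : ℝ → L2 D}
    (hu : ∀ t ∈ Ioc 0 T, S.SpectralFormula S.e α β T φ F t (u t))
    (hv : S.IsMildSolution α β T φ F v) : v =ᵐ[volume.restrict (Ioo 0 T)] u := by
  filter_upwards [hv.2, ae_restrict_mem measurableSet_Ioo] with t h1 h2
  exact S.spectralFormula_unique h1 (hu t ⟨h2.1, h2.2.le⟩)

theorem isMildSolution_of_spectralFormula {α β T : ℝ} {φ : L2 D} {F u : ℝ → L2 D} {ϱ : ℝ}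
    (hu : ∀ t ∈ Ioc 0 T, S.SpectralFormula S.e α β T φ F t (u t)) (hϱ : 1 ≤ ϱ)
    (hm : MemLp u (ENNReal.ofReal ϱ) (volume.restrict (Ioo 0 T))) :
    S.IsMildSolution α β T φ F u :=
  ⟨⟨_, ENNReal.one_le_ofReal.2 hϱ, hm⟩,
    (ae_restrict_iff' measurableSet_Ioo).2 (ae_of_all _ fun t ht => hu t ⟨ht.1, ht.2.le⟩)⟩

theorem spectralFormula_of_spectralSum {α β T : ℝ} {φ : L2 D} {F : ℝ → L2 D} {t : ℝ} {y : L2 D}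
    (h : SpectralSum S.e (fun j => (S.m j ^ β) ^ (0 : ℝ) • S.e j) α T (fun j => S.m j ^ β)
      (fun j => ⟪φ, S.e j⟫_ℝ) F t y) : S.SpectralFormula S.e α β T φ F t y := by
  simp only [Real.rpow_zero, one_smul] at h
  exact h

theorem ofReal_mul_norm_add {T η C : ℝ} (hC : 0 ≤ C) {γ : ℝ} (φ : S.V γ) {F : ℝ → L2 D}
    (hF : MemX T η F) :
    ENNReal.ofReal (C * (‖φ‖ + (normX T η F).toReal))
      = ENNReal.ofReal C * ‖φ‖ₑ + ENNReal.ofReal C * normX T η F := by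
  rw [ENNReal.ofReal_mul hC, ENNReal.ofReal_add (norm_nonneg _) ENNReal.toReal_nonneg, mul_add,
    ofReal_norm, ENNReal.ofReal_toReal hF.2.ne]

/-- The case θ = 0, κ = q. Allowing η ≤ αq covers both η = αq in (a) and η = αq - s in (b). -/
theorem exists_mildSolution {α β T p q : ℝ} (hα : 0 < α) (hα1 : α < 1) (hβ : 0 < β) (hT : 0 < T)
    (hp : 0 < p) (hq : 0 < q) (hpq : p + q = 1) {η : ℝ} (hη : η ≤ α * q) :
    ∃ C : ℝ, 0 < C ∧ ∀ (φ : S.V (β * p)) (F : ℝ → L2 D), MemX T η F →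
      ∃ u : ℝ → L2 D, (∀ t ∈ Ioc 0 T, S.SpectralFormula S.e α β T (S.toL2 _ φ) F t (u t)) ∧
        ContinuousOn u (Ioc 0 T) ∧
        ∀ t ∈ Ioc 0 T, ‖u t‖ ≤ C * (‖φ‖ + (normX T η F).toReal) * t ^ (-(α * q)) := by
  have hl₀ : 0 < S.m 0 ^ β := Real.rpow_pos_of_pos (S.m_pos 0) β
  have hl : ∀ j, S.m 0 ^ β ≤ S.m j ^ β := fun j =>
    Real.rpow_le_rpow (S.m_pos 0).le (S.m_mono (Nat.zero_le j)) hβ.le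
  have hq1 : 1 - p = q := by linarith
  obtain ⟨C, hC, h⟩ := exists_spectralSum_le (T := T) (η := η) S.e hα hα1 hT hl₀ hl (p := p)
    (θ := 0) (κ := q) le_rfl hp.le (by linarith) (by linarith) (by rwa [hq1])
  refine ⟨C, hC, fun φ F hF => ?_⟩
  have hX := hF.xBound
  have hφ := S.l2Bdd_toL2 β p φ
  obtain ⟨u, hu⟩ := h _ F _ _ hX hφ
  have hform : ∀ t ∈ Ioc 0 T, S.SpectralFormula S.e α β T (S.toL2 _ φ) F t (u t) :=
    fun t ht => S.spectralFormula_of_spectralSum (hu t ht).1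
  exact ⟨u, hform, continuousOn_of_spectralSum S.e hα hα1 hT hl₀ hl hp hq hpq
    (hX.mono_exponent hT hη) hφ hform, fun t ht => (hu t ht).2⟩

/-- The series weighted by m_j^{βθ} is summed in L²(D) and ℒ^{βθ} is inverted; comparing coordinates
identifies the result with the given u. -/
theorem exists_mildSolution_V {α β T p θ κ : ℝ} (hα : 0 < α) (hα1 : α < 1) (hβ : 0 < β)
    (hT : 0 < T) (hθ : 0 ≤ θ) (hθp : θ ≤ p) (hp : p ≤ 1) (hκ : θ + (1 - κ) = p) {η : ℝ}
    (hη0 : 0 ≤ η) (hηα : η < α) (hη : η ≤ α * (1 - p)) :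
    ∃ C : ℝ, 0 < C ∧ ∀ (φ : S.V (β * p)) (F : ℝ → L2 D), MemX T η F →
      ∀ u : ℝ → L2 D, (∀ t ∈ Ioc 0 T, S.SpectralFormula S.e α β T (S.toL2 _ φ) F t (u t)) →
      ∃ w : ℝ → S.V (β * θ), (∀ t ∈ Ioc 0 T, S.toL2 _ (w t) = u t) ∧
        AEStronglyMeasurable w (volume.restrict (Ioo 0 T)) ∧
        ∀ t ∈ Ioc 0 T, ‖w t‖ ≤ C * (‖φ‖ + (normX T η F).toReal) * t ^ (-(α * κ)) := by
  have hl₀ : 0 < S.m 0 ^ β := Real.rpow_pos_of_pos (S.m_pos 0) β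
  have hl : ∀ j, S.m 0 ^ β ≤ S.m j ^ β := fun j =>
    Real.rpow_le_rpow (S.m_pos 0).le (S.m_mono (Nat.zero_le j)) hβ.le
  obtain ⟨C, hC, h⟩ := exists_spectralSum_le (T := T) (η := η) S.e hα hα1 hT hl₀ hl (p := p)
    (θ := θ) (κ := κ) hθ hθp hp hκ hη
  refine ⟨C, hC, fun φ F hF u hu => ?_⟩
  have hX := hF.xBound
  obtain ⟨y, hy⟩ := h _ F _ _ hX (S.l2Bdd_toL2 β p φ)
  have hγ : 0 ≤ β * θ := by positivity
  refine ⟨fun t => (S.powEquiv hγ).symm (y t), fun t ht => ?_, ?_, fun t ht => ?_⟩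
  · refine S.toL2_eq_of_inner fun j => ?_
    have h1 : SpectralSum S.e (fun j => (1 : ℝ) • S.e j) α T (fun j => S.m j ^ β)
      (fun j => ⟪S.toL2 _ φ, S.e j⟫_ℝ) F t (u t) := by
        simp only [one_smul]
        exact hu t ht
    rw [pow_powEquiv_symm, (hy t ht).1.inner_eq, h1.inner_eq, one_mul,
      Real.rpow_mul (S.m_pos j).le]
  · exact (S.powEquiv hγ).symm.continuous.comp_aestronglyMeasurable
      (aestronglyMeasurable_of_spectralSum S.e hα hα1 hT hl₀ hl hX hη0 hηα
        fun t ht => (hy t ht).1)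
  · rw [LinearIsometryEquiv.norm_map]
    exact (hy t ht).2

theorem exists_mildSolution_VNeg {α β T p p' s : ℝ} (hα : 0 < α) (hα1 : α < 1) (hβ : 0 < β)
    (hT : 0 < T) (hp0 : 0 < p) (hp1 : p < 1) (hs : 0 < s) (hsα : s ≤ α * (1 - p))
    (hp' : p' ≤ p - s / α) :
    ∃ C : ℝ, 0 < C ∧ ∀ (φ : S.V (β * p)) (F : ℝ → L2 D), MemX T (α * (1 - p) - s) F →
      ∀ u : ℝ → L2 D, (∀ t ∈ Ioc 0 T, S.SpectralFormula S.e α β T (S.toL2 _ φ) F t (u t)) →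
      ∃ w : ℝ → S.VNeg (β * (1 - p')), (∀ t ∈ Ioc 0 T, S.IsFunction (w t) (u t)) ∧
        (∀ t ∈ Icc 0 T, S.SpectralFormula (S.eNeg _) α β T (S.toL2 _ φ) F t (w t)) ∧
        ∀ t₁ ∈ Icc 0 T, ∀ t₂ ∈ Icc 0 T, t₁ ≤ t₂ → ‖w t₂ - w t₁‖
          ≤ C * (‖φ‖ + (normX T (α * (1 - p) - s) F).toReal) * (t₂ - t₁) ^ s := by
  have hl₀ : 0 < S.m 0 ^ β := Real.rpow_pos_of_pos (S.m_pos 0) β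
  have hl : ∀ j, S.m 0 ^ β ≤ S.m j ^ β := fun j =>
    Real.rpow_le_rpow (S.m_pos 0).le (S.m_mono (Nat.zero_le j)) hβ.le
  obtain ⟨C, hC, h⟩ := exists_spectralSum_holder (T := T) S.e hα hα1 hT hl₀ hl (p := p)
    (p' := p') hp0 hp1 hs hsα hp'
  refine ⟨C, hC, fun φ F hF u hu => ?_⟩
  obtain ⟨y, hy, hyH⟩ := h _ F _ _ hF.xBound (S.l2Bdd_toL2 β p φ)
  have hpow : ∀ j, (S.m j ^ β) ^ (p' - 1) = S.m j ^ (-(β * (1 - p'))) := fun j => by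
    rw [← Real.rpow_mul (S.m_pos j).le]; ring_nf
  refine ⟨fun t => S.powNeg _ (y t), fun t ht => ?_, fun t ht => ?_, ?_⟩
  · refine S.isFunction_powNeg fun j => ?_
    have h1 : SpectralSum S.e (fun j => (1 : ℝ) • S.e j) α T (fun j => S.m j ^ β)
      (fun j => ⟪S.toL2 _ φ, S.e j⟫_ℝ) F t (u t) := by
        simp only [one_smul]
        exact hu t ht
    rw [(hy t (Ioc_subset_Icc_self ht)).inner_eq, h1.inner_eq, one_mul, hpow]
  · have := (hy t ht).map (S.powNeg (β * (1 - p')))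
    simp only [hpow, powNeg_smul_e] at this
    exact this
  · intro t₁ ht₁ t₂ ht₂ h12
    rw [← map_sub]
    exact (S.norm_powNeg_le _ _).trans (hyH t₁ ht₁ t₂ ht₂ h12)

end Eigensystem

end TerminalValue

end

/-! ### Choice of exponents and constants for both parts. -/

theorem theorem3p1 {k : ℕ} (hk : 1 ≤ k) (D : Set (EuclideanSpace ℝ (Fin k)))
    (hD_open : IsOpen D) (hD_conn : IsConnected D) (hD_bdd : Bornology.IsBounded D)
    (L : EllipticOperator D) (B : BoundaryOperator) (S : Eigensystem L B)
    (α β T : ℝ) (hα : 0 < α ∧ α < 1) (hβ : 0 < β ∧ β ≤ 1) (hT : 0 < T)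
    (p q : ℝ) (hp : 0 < p ∧ p < 1) (hq : 0 < q ∧ q < 1) (hpq : p + q = 1) :
    -- Part (a)
    (∀ r : ℝ, 0 < r → r ≤ (1 - α * q) / (α * q) →
      ∃ C₁ : ℝ, 0 < C₁ ∧ ∀ (φ : S.V (β * p)) (F : ℝ → L2 D), MemX T (α * q) F →
        ∃ u : ℝ → L2 D,
          S.IsMildSolution α β T (S.toL2 _ φ) F u ∧
          (∀ t ∈ Set.Ioc 0 T, S.SpectralFormula S.e α β T (S.toL2 _ φ) F t (u t)) ∧
          MemLp u (ENNReal.ofReal (1 / (α * q) - r)) (volume.restrict (Set.Ioo 0 T)) ∧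
          (∀ v, S.IsMildSolution α β T (S.toL2 _ φ) F v →
            v =ᵐ[volume.restrict (Set.Ioo 0 T)] u) ∧
          eLpNorm u (ENNReal.ofReal (1 / (α * q) - r)) (volume.restrict (Set.Ioo 0 T))
            ≤ ENNReal.ofReal C₁ * ‖φ‖ₑ + ENNReal.ofReal C₁ * normX T (α * q) F) ∧
    -- Part (b)
    (∀ s p' q' r : ℝ, 0 < s → s < min (α * q) (1 - α * q) →
      0 < p' → p' ≤ p - s / α → q' = 1 - p' → 0 < r → r ≤ (1 - α * q') / (α * q') →
      ∃ C₂ : ℝ, 0 < C₂ ∧ ∀ (φ : S.V (β * p)) (F : ℝ → L2 D), MemX T (α * q - s) F →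
        ∃ (u : ℝ → L2 D) (uV : ℝ → S.V (β * (p - p'))) (uNeg : ℝ → S.VNeg (β * q')),
          S.IsMildSolution α β T (S.toL2 _ φ) F u ∧
          (∀ t ∈ Set.Ioc 0 T, S.SpectralFormula S.e α β T (S.toL2 _ φ) F t (u t)) ∧
          (∀ v, S.IsMildSolution α β T (S.toL2 _ φ) F v →
            v =ᵐ[volume.restrict (Set.Ioo 0 T)] u) ∧
          -- `uV` is `u` with values in `V_{β(p-p')}`
          (∀ᵐ t ∂(volume.restrict (Set.Ioo 0 T)), S.toL2 _ (uV t) = u t) ∧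
          -- `uNeg` is `u` with values in `V_{-βq'}`, also defined at `t = 0`
          (∀ t ∈ Set.Ioc 0 T, S.IsFunction (uNeg t) (u t)) ∧
          (∀ t ∈ Set.Icc 0 T,
            S.SpectralFormula (S.eNeg (β * q')) α β T (S.toL2 _ φ) F t (uNeg t)) ∧
          MemLp uV (ENNReal.ofReal (1 / (α * q') - r)) (volume.restrict (Set.Ioo 0 T)) ∧
          MemCWeighted T (α * q) u ∧
          MemHolder T s uNeg ∧
          eLpNorm uV (ENNReal.ofReal (1 / (α * q') - r)) (volume.restrict (Set.Ioo 0 T))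
              + normCWeighted T (α * q) u + normHolder T s uNeg
            ≤ ENNReal.ofReal C₂ * ‖φ‖ₑ + ENNReal.ofReal C₂ * normX T (α * q - s) F) := by
  obtain ⟨hα0, hα1⟩ := hα
  obtain ⟨hp0, hp1⟩ := hp
  obtain ⟨hq0, hq1⟩ := hq
  have hαq0 : 0 < α * q := mul_pos hα0 hq0
  have hαq1 : α * q < 1 := by nlinarith
  have hq_eq : 1 - p = q := by linarith
  refine ⟨?_, ?_⟩
  · intro r hr hr'
    have hρ := one_le_one_div_sub hαq0 hr'
    obtain ⟨C, hC, h⟩ := S.exists_mildSolution (T := T) (η := α * q) hα0 hα1 hβ.1 hT hp0 hq0 hpq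
      le_rfl
    obtain ⟨A, hA, hLp⟩ := exists_eLpNorm_le_of_norm_le_rpow hT hρ (mul_one_div_sub_lt_one hαq0 hr)
    refine ⟨A * C, by positivity, fun φ F hF => ?_⟩
    obtain ⟨u, hform, hcont, hbd⟩ := h φ F hF
    obtain ⟨hm, hn⟩ := hLp u _ (by positivity)
      ((hcont.mono Ioo_subset_Ioc_self).aestronglyMeasurable measurableSet_Ioo) hbd
    refine ⟨u, S.isMildSolution_of_spectralFormula hform hρ hm, hform, hm,
      fun v hv => S.ae_eq_of_isMildSolution hform hv, ?_⟩
    rwa [← mul_assoc, S.ofReal_mul_norm_add (by positivity) φ hF] at hn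
  · intro s p' q' r hs hs' hp' hp'' hq' hr hr'
    subst hq'
    have hsq : s < α * q := hs'.trans_le (min_le_left _ _)
    have hsα : 0 < s / α := div_pos hs hα0
    have hκ0 : 0 < α * (1 - p') := mul_pos hα0 (by linarith)
    have hρ := one_le_one_div_sub hκ0 hr'
    obtain ⟨C, hC, h⟩ := S.exists_mildSolution (T := T) (η := α * q - s) hα0 hα1 hβ.1 hT hp0 hq0
      hpq (by linarith)
    -- Reserving p - p' powers leaves p' = 1 - κ for the quotient, hence κ = q' and the singularity
    -- t^{-αq'}.
    obtain ⟨C', hC', h'⟩ := S.exists_mildSolution_V (T := T) (p := p) (θ := p - p')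
      (κ := 1 - p') (η := α * q - s) hα0 hα1 hβ.1 hT (by linarith) (by linarith) hp1.le (by ring)
      (by linarith) (by nlinarith) (by rw [hq_eq]; linarith)
    obtain ⟨C'', hC'', h''⟩ := S.exists_mildSolution_VNeg (T := T) (p := p) (p' := p') (s := s)
      hα0 hα1 hβ.1 hT hp0 hp1 hs (by rw [hq_eq]; exact hsq.le) hp''
    rw [hq_eq] at h''
    -- The L²(D)-valued u is placed in L¹(0,T), which αq < 1 allows; ϱ = 1 is enough for a mild
    -- solution.
    obtain ⟨A₁, -, hL1⟩ := exists_eLpNorm_le_of_norm_le_rpow (κ := α * q) hT le_rfl (by linarith)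
    obtain ⟨A, hA, hLp⟩ := exists_eLpNorm_le_of_norm_le_rpow hT hρ (mul_one_div_sub_lt_one hκ0 hr)
    refine ⟨A * C' + C + C'', by positivity, fun φ F hF => ?_⟩
    obtain ⟨u, hform, hcont, hbd⟩ := h φ F hF
    obtain ⟨w, hwu, hwm, hwbd⟩ := h' φ F hF u hform
    obtain ⟨z, hzu, hzform, hzbd⟩ := h'' φ F hF u hform
    obtain ⟨hm1, -⟩ := hL1 u _ (by positivity)
      ((hcont.mono Ioo_subset_Ioc_self).aestronglyMeasurable measurableSet_Ioo) hbd
    obtain ⟨hm, hn⟩ := hLp w _ (by positivity) hwm hwbd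
    have hW := normCWeighted_le hbd
    have hHol := normHolder_le (by positivity) hzbd
    refine ⟨u, w, z, S.isMildSolution_of_spectralFormula hform le_rfl hm1, hform,
      fun v hv => S.ae_eq_of_isMildSolution hform hv,
      (ae_restrict_iff' measurableSet_Ioo).2 (ae_of_all _ fun t ht => hwu t ⟨ht.1, ht.2.le⟩),
      hzu, hzform, hm, ⟨hcont, hW.trans_lt ENNReal.ofReal_lt_top⟩,
      ⟨continuousOn_of_norm_sub_le_rpow hs hzbd, hHol.trans_lt ENNReal.ofReal_lt_top⟩, ?_⟩
    refine (add_le_add (add_le_add hn hW) hHol).trans (le_of_eq ?_)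
    rw [← S.ofReal_mul_norm_add (by positivity) φ hF,
      ← ENNReal.ofReal_add (by positivity) (by positivity),
      ← ENNReal.ofReal_add (by positivity) (by positivity)]
    congr 1
    ring
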